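/- \textbf{Conventions.} All vector spaces are complex; bornological vector spaces are convex and complete, $V\hat\otimes W$ is the completed projective bornological tensor product, and $M(A)$ is the algebra of two-sided multipliers of $A$. A bornological algebra $A$ is essential if multiplication induces a bornological isomorphism $A\hat\otimes_A A\cong A$; a bounded homomorphism $f:A\to M(B)$ is essential if it induces bornological isomorphisms $A\hat\otimes_A B\cong B$ and $B\hat\otimes_A A\cong B$. A \emph{bornological quantum group} is an essential (associative, not necessarily unital) bornological algebra $H$ with the approximation property, together with a coassociative essential homomorphism $\Delta:H\to M(H\hat\otimes H)$, $\Delta(x)=x_{(1)}\otimes x_{(2)}$, such that the four Galois maps $$\gamma_l(x\otimes y)=\Delta(x)(y\otimes 1),\quad \gamma_r(x\otimes y)=\Delta(x)(1\otimes y),\quad \rho_l(x\otimes y)=(x\otimes 1)\Delta(y),\quad \rho_r(x\otimes y)=(1\otimes x)\Delta(y)$$ are bornological isomorphisms of $H\hat\otimes H$, and a bounded functional $\phi:H\to\mathbb C$ which is faithful (if $\phi(xy)=0$ for all $y$ then $x=0$, and if $\phi(xy)=0$ for all $x$ then $y=0$) and left invariant, that is, $(\mathrm{id}\hat\otimes\phi)\Delta(x)=\phi(x)1$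 in $M(H)$. Its counit is the essential homomorphism $\epsilon:H\to\mathbb C$ with $(\epsilon\hat\otimes\mathrm{id})\Delta=\mathrm{id}=(\mathrm{id}\hat\otimes\epsilon)\Delta$, and its antipode is the bounded linear map $S:H\to H$ with $\mu(S\hat\otimes\mathrm{id})\gamma_r=\epsilon\hat\otimes\mathrm{id}$ and $\mu(\mathrm{id}\hat\otimes S)\rho_l=\mathrm{id}\hat\otimes\epsilon$, where $\mu$ is the multiplication of $H$. The modular element of $H$ is the multiplier $\delta\in M(H)$ with $(\phi\hat\otimes\mathrm{id})\Delta(x)=\phi(x)\delta$ for all $x\in H$. The dual $\hat H$ is the space of functionals $\mathcal F_l(x)=\phi(\,\cdot\,x)$, $x\in H$, with the bornology transported along the bijection $\mathcal F_l:H\to\hat H$, with the product $(fg)(h)=f(h_{(1)})g(h_{(2)})$ and with the comultiplication $\hat\Delta:\hat H\to M(\hat H\hat\otimes\hat H)$ determined by $\hat\Delta(f)(s\otimes t)=f(st)$. Let $\hat\phi$ be a faithful left invariant bounded functional on $\hat H$; the modular element of $\hat H$ is the multiplier $\hat\delta\in M(\hat H)$ with $(\hat\phi\hat\otimes\mathrm{id})\hat\Delta(f)=\hat\phi(f)\hat\delta$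 for all $f\in\hat H$. For $f\in\hat H$ and $x\in H$ put $$f\rightharpoonup x=x_{(1)}f(x_{(2)}),\qquad x\leftharpoonup f=f(x_{(1)})x_{(2)}.$$ These are essential left and right actions of $\hat H$ on $H$, and they extend to $M(\hat H)$: for $m\in M(\hat H)$, the maps $x\mapsto m\rightharpoonup x$ and $x\mapsto x\leftharpoonup m$ are the bounded linear maps on $H$ with $m\rightharpoonup(f\rightharpoonup x)=(mf)\rightharpoonup x$ and $(x\leftharpoonup f)\leftharpoonup m=x\leftharpoonup(fm)$ for all $f\in\hat H$, $x\in H$. \textbf{Proposition (Radford's formula).} Let $H$ be a bornological quantum group with antipode $S$, and let $\delta\in M(H)$ and $\hat\delta\in M(\hat H)$ be the modular elements of $H$ and of $\hat H$. Then $\delta$ and $\hat\delta$ are invertible, the maps $x\mapsto\hat\delta\rightharpoonup x$ and $x\mapsto x\leftharpoonup\hat\delta^{-1}$ on $H$ exist, and $$S^4(x)=\delta^{-1}\bigl(\hat\delta\rightharpoonup x\leftharpoonup\hat\delta^{-1}\bigr)\delta\qquad\text{for all }x\in H.$$ -/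

import Mathlib

open Bornology

universe u v w z

set_option linter.unusedSectionVars false

noncomputable section

namespace BornQG

/-! ### Bornological vector spaces -/

/-- A linear map is bounded if it maps bounded sets to bounded sets. -/
def IsBoundedLin {V : Type u} {W : Type v} [AddCommGroup V] [Module ℂ V] [Bornology V]
    [AddCommGroup W] [Module ℂ W] [Bornology W] (f : V →ₗ[ℂ] W) : Prop :=
  ∀ B : Set V, IsBounded B → IsBounded (f '' B)

/-- A complete convex bornological vector space: every bounded set is contained in a bounded
complete disc. Here this is phrased as: every bounded set is the injective bounded linear image
of a bounded subset of a Banach space (the Banach space being the span of a complete disc,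
normed by the gauge of that disc). -/
class CompleteBornological (V : Type u) [AddCommGroup V] [Module ℂ V] [Bornology V] : Prop where
  exists_banach : ∀ B : Set V, IsBounded B →
    ∃ (E : Type u) (_ : NormedAddCommGroup E) (_ : NormedSpace ℂ E) (_ : CompleteSpace E)
      (i : E →ₗ[ℂ] V), Function.Injective i ∧ IsBoundedLin i ∧
      ∃ A : Set E, IsBounded A ∧ i '' A = B

/-- Bounded linear maps. -/
structure BLin (V : Type u) (W : Type v) [AddCommGroup V] [Module ℂ V] [Bornology V]
    [AddCommGroup W] [Module ℂ W] [Bornology W] where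
  lin : V →ₗ[ℂ] W
  bdd : IsBoundedLin lin

section basics

variable {V : Type u} {W : Type v} {X : Type w}
  [AddCommGroup V] [Module ℂ V] [Bornology V]
  [AddCommGroup W] [Module ℂ W] [Bornology W]
  [AddCommGroup X] [Module ℂ X] [Bornology X]

instance blinCoeFun : CoeFun (BLin V W) (fun _ => V → W) := ⟨fun f => f.lin⟩

theorem BLin.ext' {f g : BLin V W} (h : ∀ x, f x = g x) : f = g := by
  cases f; cases g
  congr
  exact LinearMap.ext h

theorem isBoundedLin_id : IsBoundedLin (LinearMap.id : V →ₗ[ℂ] V) := by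
  intro B hB
  simpa using hB

theorem IsBoundedLin.comp {g : W →ₗ[ℂ] X} {f : V →ₗ[ℂ] W} (hg : IsBoundedLin g)
    (hf : IsBoundedLin f) : IsBoundedLin (g ∘ₗ f) := by
  intro B hB
  have := hg _ (hf B hB)
  rwa [← Set.image_comp] at this

/-- The identity as a bounded linear map. -/
def BLin.id (V : Type u) [AddCommGroup V] [Module ℂ V] [Bornology V] : BLin V V :=
  ⟨LinearMap.id, isBoundedLin_id⟩

/-- Composition of bounded linear maps. -/
def BLin.comp (g : BLin W X) (f : BLin V W) : BLin V X := ⟨g.lin ∘ₗ f.lin, g.bdd.comp f.bdd⟩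

/-- A bilinear map is bounded if it maps products of bounded sets to bounded sets. -/
def IsBoundedBilin (b : V →ₗ[ℂ] W →ₗ[ℂ] X) : Prop :=
  ∀ (B : Set V) (C : Set W), IsBounded B → IsBounded C →
    IsBounded (Set.image2 (fun v w => b v w) B C)

/-- A subspace is bornologically closed if its preimage under every bounded linear map from a
Banach space is closed (that is, it is closed under limits of bornologically convergent
sequences). -/
def IsBornClosed (S : Submodule ℂ V) : Prop :=
  ∀ (E : Type u) [NormedAddCommGroup E] [NormedSpace ℂ E] [CompleteSpace E] (i : E →ₗ[ℂ] V),
    IsBoundedLin i → IsClosed (S.comap i : Set E)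

/-- The bornological closure: the smallest bornologically closed subspace containing `R`. -/
def bornClosure (R : Set V) : Submodule ℂ V :=
  sInf {S : Submodule ℂ V | IsBornClosed S ∧ R ⊆ S}

theorem subset_bornClosure (R : Set V) : R ⊆ bornClosure R := by
  intro x hx
  simp only [bornClosure, SetLike.mem_coe, Submodule.mem_sInf]
  rintro S ⟨_, hS⟩
  exact hS hx

theorem bornClosure_le {R : Set V} {S : Submodule ℂ V} (hS : IsBornClosed S) (h : R ⊆ S) :
    bornClosure R ≤ S := sInf_le ⟨hS, h⟩

theorem isBornClosed_bornClosure (R : Set V) : IsBornClosed (bornClosure R) := by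
  intro E _ _ _ i hi
  have : ((bornClosure R).comap i : Set E) =
      ⋂ S ∈ {S : Submodule ℂ V | IsBornClosed S ∧ R ⊆ S}, (S.comap i : Set E) := by
    ext x
    simp [bornClosure]
  rw [this]
  exact isClosed_biInter fun S hS => hS.1 E i hi

/-- Every bounded set of a complete space lies in the image of a ball. -/
theorem exists_ball [CompleteBornological V] {B : Set V} (hB : IsBounded B) :
    ∃ (E : Type u) (_ : NormedAddCommGroup E) (_ : NormedSpace ℂ E) (_ : CompleteSpace E)
      (i : E →ₗ[ℂ] V) (M : ℝ), Function.Injective i ∧ IsBoundedLin i ∧ 0 ≤ M ∧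
      ∀ x ∈ B, ∃ e, ‖e‖ ≤ M ∧ i e = x := by
  obtain ⟨E, h1, h2, h3, i, hi, hb, A, hA, rfl⟩ := CompleteBornological.exists_banach B hB
  obtain ⟨M, hM⟩ := hA.exists_norm_le
  refine ⟨E, h1, h2, h3, i, max M 0, hi, hb, le_max_right _ _, ?_⟩
  rintro _ ⟨e, he, rfl⟩
  exact ⟨e, (hM e he).trans (le_max_left _ _), rfl⟩

/-- A linear map from a normed space whose ball lands in a ball of an injectively mapped normed
space factors continuously. -/
theorem exists_factor {E : Type v} {G : Type w} [NormedAddCommGroup E] [NormedSpace ℂ E]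
    [NormedAddCommGroup G] [NormedSpace ℂ G] (i : E →ₗ[ℂ] V) (k : G →ₗ[ℂ] V)
    (hk : Function.Injective k) (M : ℝ) (h : ∀ e : E, ‖e‖ ≤ 1 → ∃ g, ‖g‖ ≤ M ∧ k g = i e) :
    ∃ j : E →L[ℂ] G, ∀ e, k (j e) = i e := by
  have hr : LinearMap.range i ≤ LinearMap.range k := by
    rintro _ ⟨e, rfl⟩
    obtain ⟨g, -, hg⟩ := h ((((‖e‖ + 1 : ℝ) : ℂ))⁻¹ • e) (by
      have : (0 : ℝ) < ‖e‖ + 1 := by positivity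
      rw [norm_smul, norm_inv, Complex.norm_real, Real.norm_of_nonneg this.le,
        inv_mul_le_iff₀ this]
      linarith)
    refine ⟨((‖e‖ + 1 : ℝ) : ℂ) • g, ?_⟩
    have : ((‖e‖ + 1 : ℝ) : ℂ) ≠ 0 := by
      exact_mod_cast (by positivity : (‖e‖ + 1 : ℝ) ≠ 0)
    rw [map_smul, hg, map_smul, smul_smul, mul_inv_cancel₀ this, one_smul]
  let k' := LinearEquiv.ofInjective k hk
  let j0 : E →ₗ[ℂ] G := k'.symm.toLinearMap ∘ₗ
    (Submodule.inclusion hr) ∘ₗ i.rangeRestrict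
  have hj0 : ∀ e, k (j0 e) = i e := by
    intro e
    have := congrArg Subtype.val (k'.apply_symm_apply (Submodule.inclusion hr (i.rangeRestrict e)))
    exact this
  have hM : ∀ e : E, ‖e‖ ≤ 1 → ‖j0 e‖ ≤ M := by
    intro e he
    obtain ⟨g, hg, hge⟩ := h e he
    have : j0 e = g := hk (by rw [hj0, hge])
    rwa [this]
  have hcont : ∀ e, ‖j0 e‖ ≤ M * ‖e‖ := by
    intro e
    by_cases he : e = 0
    · simp [he]
    have hp : 0 < ‖e‖ := norm_pos_iff.2 he
    have := hM (((‖e‖ : ℝ) : ℂ)⁻¹ • e) (by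
      rw [norm_smul, norm_inv, Complex.norm_real, norm_norm, inv_mul_cancel₀ hp.ne'])
    rw [map_smul, norm_smul, norm_inv, Complex.norm_real, norm_norm, inv_mul_le_iff₀ hp] at this
    linarith
  exact ⟨j0.mkContinuous M hcont, fun e => hj0 e⟩

/-- The same for a bounded linear map into a complete space: it factors continuously through
some Banach space. -/
theorem exists_factor_of_bounded [CompleteBornological V] {E : Type v} [NormedAddCommGroup E]
    [NormedSpace ℂ E] (i : E →ₗ[ℂ] V) (hi : IsBoundedLin i) (B : Set V) (hB : IsBounded B) :
    ∃ (G : Type u) (_ : NormedAddCommGroup G) (_ : NormedSpace ℂ G) (_ : CompleteSpace G)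
      (k : G →ₗ[ℂ] V) (j : E →L[ℂ] G) (M : ℝ), Function.Injective k ∧ IsBoundedLin k ∧
      (∀ e, k (j e) = i e) ∧ 0 ≤ M ∧ ∀ x ∈ B, ∃ g, ‖g‖ ≤ M ∧ k g = x := by
  obtain ⟨G, h1, h2, h3, k, M, hk, hkb, hM, h⟩ :=
    exists_ball ((hi _ (Metric.isBounded_closedBall (x := (0 : E)) (r := 1))).union hB)
  obtain ⟨j, hj⟩ := exists_factor i k hk M (fun e he =>
    h (i e) (Or.inl ⟨e, by simpa using he, rfl⟩))
  exact ⟨G, h1, h2, h3, k, j, M, hk, hkb, hj, hM, fun x hx => h x (Or.inr hx)⟩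

theorem isBornClosed_ker [CompleteBornological W] (f : V →ₗ[ℂ] W) (hf : IsBoundedLin f) :
    IsBornClosed (LinearMap.ker f) := by
  intro E _ _ _ i hi
  obtain ⟨G, _, _, _, k, j, M, hk, -, hj, -⟩ :=
    exists_factor_of_bounded (f ∘ₗ i) (hf.comp hi) ∅ isBounded_empty
  have : ((LinearMap.ker f).comap i : Set E) = j ⁻¹' {0} := by
    ext e
    have := hj e
    simp only [Submodule.comap_coe, Set.mem_preimage, SetLike.mem_coe, LinearMap.mem_ker,
      Set.mem_singleton_iff]
    simp only [LinearMap.comp_apply] at this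
    rw [← this, map_eq_zero_iff k hk]
  rw [this]
  exact isClosed_singleton.preimage j.continuous

theorem isBounded_union_add [CompleteBornological V] {B C : Set V} (hB : IsBounded B)
    (hC : IsBounded C) : IsBounded (Set.image2 (fun x y => x + y) B C) := by
  obtain ⟨E, _, _, _, i, M, hi, hb, hM, h⟩ := exists_ball (hB.union hC)
  refine (hb _ (Metric.isBounded_closedBall (x := (0 : E)) (r := M + M))).subset ?_
  rintro _ ⟨x, hx, y, hy, rfl⟩
  obtain ⟨e, he, rfl⟩ := h x (Or.inl hx)
  obtain ⟨e', he', rfl⟩ := h y (Or.inr hy)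
  exact ⟨e + e', by simpa using (norm_add_le e e').trans (add_le_add he he'), map_add _ _ _⟩

theorem isBounded_smul [CompleteBornological V] (c : ℂ) {B : Set V} (hB : IsBounded B) :
    IsBounded ((fun x => c • x) '' B) := by
  obtain ⟨E, _, _, _, i, M, hi, hb, hM, h⟩ := exists_ball hB
  refine (hb _ (Metric.isBounded_closedBall (x := (0 : E)) (r := ‖c‖ * M))).subset ?_
  rintro _ ⟨x, hx, rfl⟩
  obtain ⟨e, he, rfl⟩ := h x hx
  refine ⟨c • e, ?_, map_smul _ _ _⟩
  simpa [norm_smul] using mul_le_mul_of_nonneg_left he (norm_nonneg c)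

theorem IsBoundedLin.add [CompleteBornological W] {f g : V →ₗ[ℂ] W} (hf : IsBoundedLin f)
    (hg : IsBoundedLin g) : IsBoundedLin (f + g) := by
  intro B hB
  refine (isBounded_union_add (hf B hB) (hg B hB)).subset ?_
  rintro _ ⟨x, hx, rfl⟩
  exact ⟨f x, ⟨x, hx, rfl⟩, g x, ⟨x, hx, rfl⟩, rfl⟩

theorem IsBoundedLin.smul [CompleteBornological W] (c : ℂ) {f : V →ₗ[ℂ] W}
    (hf : IsBoundedLin f) : IsBoundedLin (c • f) := by
  intro B hB
  refine (isBounded_smul c (hf B hB)).subset ?_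
  rintro _ ⟨x, hx, rfl⟩
  exact ⟨f x, ⟨x, hx, rfl⟩, rfl⟩

theorem isBoundedLin_zero : IsBoundedLin (0 : V →ₗ[ℂ] W) := by
  intro B hB
  refine (isBounded_singleton (x := (0 : W))).subset ?_
  rintro _ ⟨x, hx, rfl⟩
  rfl

theorem isBornClosed_eqLocus [CompleteBornological W] {f g : V →ₗ[ℂ] W} (hf : IsBoundedLin f)
    (hg : IsBoundedLin g) : IsBornClosed (LinearMap.eqLocus f g) := by
  have h : LinearMap.eqLocus f g = LinearMap.ker (f + (-1 : ℂ) • g) := by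
    ext x
    simp [← sub_eq_add_neg, sub_eq_zero]
  rw [h]
  exact isBornClosed_ker _ (hf.add (hg.smul (-1)))

end basics

/-- The bornology of a normed space is complete and convex for a Banach space. -/
instance banachCompleteBornological (E : Type u) [NormedAddCommGroup E] [NormedSpace ℂ E] [CompleteSpace E] :
    CompleteBornological E :=
  ⟨fun B hB => ⟨E, inferInstance, inferInstance, inferInstance, LinearMap.id,
    Function.injective_id, isBoundedLin_id, B, hB, by simp⟩⟩

/-! ### The completed projective tensor product -/

section tensor

variable (V : Type u) (W : Type v) [AddCommGroup V] [Module ℂ V] [Bornology V]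
  [AddCommGroup W] [Module ℂ W] [Bornology W]

/-- Absolutely summable families `c : V × W → ℂ` supported in a product of bounded sets; such a
family stands for the sum of the terms `c (x, y) • x ⊗ y`. -/
def preSubmodule : Submodule ℂ (lp (fun _ : V × W => ℂ) 1) where
  carrier := {c | ∃ (B : Set V) (C : Set W), IsBounded B ∧ IsBounded C ∧
    ∀ p, c p ≠ 0 → p.1 ∈ B ∧ p.2 ∈ C}
  zero_mem' := ⟨∅, ∅, isBounded_empty, isBounded_empty, fun p hp => (hp rfl).elim⟩
  add_mem' := by
    rintro c d ⟨B, C, hB, hC, h⟩ ⟨B', C', hB', hC', h'⟩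
    refine ⟨B ∪ B', C ∪ C', hB.union hB', hC.union hC', fun p hp => ?_⟩
    by_cases hc : c p = 0
    · have hd : d p ≠ 0 := by
        intro hd
        exact hp (by simp [hc, hd])
      exact ⟨Or.inr (h' p hd).1, Or.inr (h' p hd).2⟩
    · exact ⟨Or.inl (h p hc).1, Or.inl (h p hc).2⟩
  smul_mem' := by
    rintro a c ⟨B, C, hB, hC, h⟩
    refine ⟨B, C, hB, hC, fun p hp => h p ?_⟩
    intro hc
    exact hp (by simp [hc])

/-- The space of absolutely summable families with bounded support. -/
def PreTensor : Type (max u v) := preSubmodule V W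

instance preTensorAddCommGroup : AddCommGroup (PreTensor V W) := inferInstanceAs (AddCommGroup (preSubmodule V W))
instance preTensorModule : Module ℂ (PreTensor V W) := inferInstanceAs (Module ℂ (preSubmodule V W))

variable {V W}

/-- The basic bounded sets: families of norm at most `r` supported in `B × C`. -/
def preBall (B : Set V) (C : Set W) (r : ℝ) : Set (PreTensor V W) :=
  {c | ‖c.1‖ ≤ r ∧ ∀ p, c.1 p ≠ 0 → p.1 ∈ B ∧ p.2 ∈ C}

variable (V W)

instance preTensorBornology : Bornology (PreTensor V W) :=
  Bornology.ofBounded {S | ∃ (B : Set V) (C : Set W) (r : ℝ), IsBounded B ∧ IsBounded C ∧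
      S ⊆ preBall B C r}
    ⟨∅, ∅, 0, isBounded_empty, isBounded_empty, Set.empty_subset _⟩
    (fun _ ⟨B, C, r, hB, hC, h⟩ _ hs => ⟨B, C, r, hB, hC, hs.trans h⟩)
    (fun _ ⟨B, C, r, hB, hC, h⟩ _ ⟨B', C', r', hB', hC', h'⟩ =>
      ⟨B ∪ B', C ∪ C', max r r', hB.union hB', hC.union hC', by
        rintro c (hc | hc)
        · exact ⟨(h hc).1.trans (le_max_left _ _), fun p hp =>
            ⟨Or.inl ((h hc).2 p hp).1, Or.inl ((h hc).2 p hp).2⟩⟩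
        · exact ⟨(h' hc).1.trans (le_max_right _ _), fun p hp =>
            ⟨Or.inr ((h' hc).2 p hp).1, Or.inr ((h' hc).2 p hp).2⟩⟩⟩)
    (fun c => by
      obtain ⟨B, C, hB, hC, h⟩ := c.2
      exact ⟨B, C, ‖c.1‖, hB, hC, by rintro _ rfl; exact ⟨le_rfl, h⟩⟩)

variable {V W}

theorem isBounded_pre_iff {S : Set (PreTensor V W)} : IsBounded S ↔
    ∃ (B : Set V) (C : Set W) (r : ℝ), IsBounded B ∧ IsBounded C ∧ S ⊆ preBall B C r :=
  Bornology.isBounded_ofBounded_iff _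

/-- The Banach space of summable families supported in `B × C`. -/
def suppSubmodule (B : Set V) (C : Set W) : Submodule ℂ (lp (fun _ : V × W => ℂ) 1) where
  carrier := {c | ∀ p, c p ≠ 0 → p.1 ∈ B ∧ p.2 ∈ C}
  zero_mem' := fun p hp => (hp rfl).elim
  add_mem' := by
    intro c d h h' p hp
    by_cases hc : c p = 0
    · have hd : d p ≠ 0 := by
        intro hd
        exact hp (by simp [hc, hd])
      exact h' p hd
    · exact h p hc
  smul_mem' := by
    intro a c h p hp
    refine h p ?_
    intro hc
    exact hp (by simp [hc])

theorem isClosed_supp (B : Set V) (C : Set W) :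
    IsClosed (suppSubmodule B C : Set (lp (fun _ : V × W => ℂ) 1)) := by
  have : (suppSubmodule B C : Set (lp (fun _ : V × W => ℂ) 1)) =
      ⋂ p ∈ {p : V × W | ¬ (p.1 ∈ B ∧ p.2 ∈ C)},
        (lp.evalCLM ℂ (fun _ : V × W => ℂ) 1 p) ⁻¹' {0} := by
    ext c
    simp only [Set.mem_iInter, Set.mem_preimage, Set.mem_singleton_iff]
    constructor
    · intro h p hp
      by_contra hc
      exact hp (h p hc)
    · intro h p hp
      by_contra hc
      exact hp (h p hc)
  rw [this]
  exact isClosed_biInter fun p _ => isClosed_singleton.preimage (ContinuousLinearMap.continuous _)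

instance suppComplete (B : Set V) (C : Set W) : CompleteSpace (suppSubmodule B C) :=
  (isClosed_supp B C).completeSpace_coe

/-- The inclusion of the families supported in `B × C`. -/
def suppIncl {B : Set V} {C : Set W} (hB : IsBounded B) (hC : IsBounded C) :
    suppSubmodule B C →ₗ[ℂ] PreTensor V W where
  toFun c := ⟨c.1, B, C, hB, hC, c.2⟩
  map_add' _ _ := rfl
  map_smul' _ _ := rfl

theorem suppIncl_bdd {B : Set V} {C : Set W} (hB : IsBounded B) (hC : IsBounded C) :
    IsBoundedLin (suppIncl hB hC) := by
  intro A hA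
  obtain ⟨r, hr⟩ := hA.exists_norm_le
  refine isBounded_pre_iff.2 ⟨B, C, r, hB, hC, ?_⟩
  rintro _ ⟨c, hc, rfl⟩
  exact ⟨hr c hc, c.2⟩

theorem suppIncl_inj {B : Set V} {C : Set W} (hB : IsBounded B) (hC : IsBounded C) :
    Function.Injective (suppIncl hB hC) := by
  intro c d h
  exact Subtype.ext (congrArg (fun x : PreTensor V W => x.1) h)

instance preTensorComplete : CompleteBornological (PreTensor V W) := by
  refine ⟨fun S hS => ?_⟩
  obtain ⟨B, C, r, hB, hC, h⟩ := isBounded_pre_iff.1 hS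
  refine ⟨suppSubmodule B C, inferInstance, inferInstance, inferInstance, suppIncl hB hC,
    suppIncl_inj hB hC, suppIncl_bdd hB hC, suppIncl hB hC ⁻¹' S, ?_, ?_⟩
  · refine (Metric.isBounded_closedBall (x := 0) (r := r)).subset fun c hc => ?_
    exact mem_closedBall_zero_iff.2 (h hc).1
  · refine Set.image_preimage_eq_of_subset fun c hc => ?_
    exact ⟨⟨c.1, (h hc).2⟩, rfl⟩

open Classical in
/-- The family with the single entry `1` at `(x, y)`. -/
def preSingle (x : V) (y : W) : PreTensor V W :=
  ⟨lp.single 1 (x, y) 1, {x}, {y}, isBounded_singleton, isBounded_singleton, fun p hp => by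
    by_cases h : p = (x, y)
    · subst h; simp
    · exact (hp (by simp [lp.single_apply, h])).elim⟩

theorem preSingle_norm (x : V) (y : W) : ‖(preSingle x y).1‖ = 1 := by
  classical
  have := lp.norm_single (E := fun _ : V × W => ℂ) (p := 1) (by simp) (x, y) 1
  rw [norm_one] at this
  exact this

theorem preSingle_supp (x : V) (y : W) (p : V × W) (hp : (preSingle x y).1 p ≠ 0) :
    p = (x, y) := by
  by_contra h
  exact hp (by simp [preSingle, lp.single_apply, h])

theorem preSingle_mem {B : Set V} {C : Set W} {x : V} {y : W} (hx : x ∈ B) (hy : y ∈ C) :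
    preSingle x y ∈ preBall B C 1 := by
  refine ⟨(preSingle_norm x y).le, fun p hp => ?_⟩
  rw [preSingle_supp x y p hp]
  exact ⟨hx, hy⟩

/-- A bornologically closed subspace containing all single families is everything. -/
theorem pre_closed_eq_top {S : Submodule ℂ (PreTensor V W)} (hS : IsBornClosed S)
    (h : ∀ x y, preSingle x y ∈ S) (c : PreTensor V W) : c ∈ S := by
  classical
  obtain ⟨B, C, hB, hC, hc⟩ := c.2
  have hcl := hS (suppSubmodule B C) (suppIncl hB hC) (suppIncl_bdd hB hC)
  let c' : suppSubmodule B C := ⟨c.1, hc⟩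
  have hs : ∀ p : V × W, lp.single 1 p (c.1 p) ∈ suppSubmodule B C := by
    intro p q hq
    by_cases hqp : q = p
    · subst hqp
      exact hc q (by simpa using hq)
    · exact (hq (by simp [lp.single_apply, hqp])).elim
  have hsum : HasSum (fun p : V × W => (⟨lp.single 1 p (c.1 p), hs p⟩ : suppSubmodule B C)) c' := by
    have := lp.hasSum_single (E := fun _ : V × W => ℂ) (p := 1) (by simp) c.1
    exact (Topology.IsInducing.subtypeVal.hasSum_iff (g := (suppSubmodule B C).subtype) _ _).1 this
  have hmem : c' ∈ ((S.comap (suppIncl hB hC)) : Set (suppSubmodule B C)) := by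
    refine hcl.mem_of_tendsto hsum (Filter.Eventually.of_forall fun s => ?_)
    refine Submodule.sum_mem _ fun p _ => ?_
    have : suppIncl hB hC ⟨lp.single 1 p (c.1 p), hs p⟩ = c.1 p • preSingle p.1 p.2 := by
      apply Subtype.ext
      change lp.single 1 p (c.1 p) = c.1 p • lp.single (E := fun _ : V × W => ℂ) 1 p 1
      rw [← lp.single_smul]
      simp
    change suppIncl hB hC ⟨lp.single 1 p (c.1 p), hs p⟩ ∈ S
    rw [this]
    exact S.smul_mem _ (h _ _)
  exact hmem

variable (V W) in
/-- The relations expressing bilinearity of `x ⊗ y`. -/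
def bilinRelations : Set (PreTensor V W) :=
  {c | (∃ x x' y, c = preSingle (x + x') y - (preSingle x y + preSingle x' y)) ∨
    (∃ x y y', c = preSingle x (y + y') - (preSingle x y + preSingle x y')) ∨
    (∃ (a : ℂ) (x : V) (y : W), c = preSingle (a • x) y - a • preSingle x y) ∨
    (∃ (a : ℂ) (x : V) (y : W), c = preSingle x (a • y) - a • preSingle x y)}

variable (V W) in
/-- The completed projective tensor product of bornological vector spaces: absolutely convergent
sums of elementary tensors with bounded entries, modulo the bornologically closed subspace
generated by the bilinearity relations. -/
def BTensor : Type (max u v) := PreTensor V W ⧸ bornClosure (bilinRelations V W)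

infixl:70 " ⊗ᵇ " => BTensor

instance tensorAddCommGroup : AddCommGroup (V ⊗ᵇ W) :=
  inferInstanceAs (AddCommGroup (PreTensor V W ⧸ bornClosure (bilinRelations V W)))
instance tensorModule : Module ℂ (V ⊗ᵇ W) :=
  inferInstanceAs (Module ℂ (PreTensor V W ⧸ bornClosure (bilinRelations V W)))

variable (V W) in
/-- The quotient map. -/
def preMk : PreTensor V W →ₗ[ℂ] V ⊗ᵇ W := (bornClosure (bilinRelations V W)).mkQ

theorem preMk_surj : Function.Surjective (preMk V W) :=
  Submodule.mkQ_surjective _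

/-- The quotient bornology on the completed tensor product. -/
instance tensorBornology : Bornology (V ⊗ᵇ W) :=
  Bornology.ofBounded {S | ∃ T : Set (PreTensor V W), IsBounded T ∧ S ⊆ preMk V W '' T}
    ⟨∅, isBounded_empty, Set.empty_subset _⟩
    (fun _ ⟨T, hT, h⟩ _ hs => ⟨T, hT, hs.trans h⟩)
    (fun _ ⟨T, hT, h⟩ _ ⟨T', hT', h'⟩ => ⟨T ∪ T', hT.union hT', by
      rw [Set.image_union]
      exact Set.union_subset_union h h'⟩)
    (fun x => by
      obtain ⟨c, rfl⟩ := preMk_surj x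
      exact ⟨{c}, isBounded_singleton, by simp⟩)

theorem isBounded_tensor_iff {S : Set (V ⊗ᵇ W)} : IsBounded S ↔
    ∃ T : Set (PreTensor V W), IsBounded T ∧ S ⊆ preMk V W '' T :=
  Bornology.isBounded_ofBounded_iff _

theorem preMk_bdd : IsBoundedLin (preMk V W) := fun T hT =>
  isBounded_tensor_iff.2 ⟨T, hT, subset_rfl⟩

instance tensorComplete : CompleteBornological (V ⊗ᵇ W) := by
  refine ⟨fun S hS => ?_⟩
  obtain ⟨T, hT, hST⟩ := isBounded_tensor_iff.1 hS
  obtain ⟨E, _, _, _, i, M, hi, hb, hM, h⟩ := exists_ball hT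
  let N := (bornClosure (bilinRelations V W)).comap i
  have hN : IsClosed (N : Set E) := isBornClosed_bornClosure _ E i hb
  let k : (E ⧸ N) →ₗ[ℂ] V ⊗ᵇ W :=
    Submodule.mapQ N (bornClosure (bilinRelations V W)) i le_rfl
  have hk : ∀ e : E, k (N.mkQ e) = preMk V W (i e) := fun e => rfl
  have hkb : IsBoundedLin k := by
    intro A hA
    obtain ⟨r, hr⟩ := hA.exists_norm_le
    refine (preMk_bdd _ (hb _ (Metric.isBounded_closedBall (x := (0 : E)) (r := r + 1)))).subset ?_
    rintro _ ⟨q, hq, rfl⟩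
    obtain ⟨e, he, heq⟩ := Submodule.Quotient.norm_mk_lt (S := N) q (zero_lt_one)
    refine ⟨i e, ⟨e, ?_, rfl⟩, ?_⟩
    · simpa using (heq.trans_le (by linarith [hr q hq])).le
    · rw [← hk, ← he]; rfl
  refine ⟨E ⧸ N, inferInstance, inferInstance, inferInstance, k, ?_, hkb, k ⁻¹' S ∩ {q | ‖q‖ ≤ M},
    ?_, ?_⟩
  · rw [← LinearMap.ker_eq_bot, LinearMap.ker_eq_bot']
    intro q hq
    obtain ⟨e, rfl⟩ := N.mkQ_surjective q
    rw [hk] at hq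
    have : i e ∈ bornClosure (bilinRelations V W) := (Submodule.Quotient.mk_eq_zero _).1 hq
    exact (Submodule.Quotient.mk_eq_zero _).2 this
  · refine (Metric.isBounded_closedBall (x := 0) (r := M)).subset fun q hq => ?_
    simpa using hq.2
  · ext s
    constructor
    · rintro ⟨q, hq, rfl⟩; exact hq.1
    · intro hs
      obtain ⟨c, hc, rfl⟩ := hST hs
      obtain ⟨e, he, rfl⟩ := h c hc
      exact ⟨N.mkQ e, ⟨hs, (Submodule.Quotient.norm_mk_le N e).trans he⟩, rfl⟩

/-- The elementary tensor `x ⊗ y`. -/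
def tmul (x : V) (y : W) : V ⊗ᵇ W := preMk V W (preSingle x y)

infixl:75 " ⊗ₑ " => tmul

theorem preMk_eq_of_rel {c d : PreTensor V W} (h : c - d ∈ bilinRelations V W) :
    preMk V W c = preMk V W d :=
  (Submodule.Quotient.eq _).2 (subset_bornClosure _ h)

theorem add_tmul (x x' : V) (y : W) : (x + x') ⊗ₑ y = x ⊗ₑ y + x' ⊗ₑ y := by
  rw [tmul, tmul, tmul, ← map_add]
  exact preMk_eq_of_rel (Or.inl ⟨x, x', y, rfl⟩)

theorem tmul_add (x : V) (y y' : W) : x ⊗ₑ (y + y') = x ⊗ₑ y + x ⊗ₑ y' := by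
  rw [tmul, tmul, tmul, ← map_add]
  exact preMk_eq_of_rel (Or.inr (Or.inl ⟨x, y, y', rfl⟩))

theorem smul_tmul (a : ℂ) (x : V) (y : W) : (a • x) ⊗ₑ y = a • x ⊗ₑ y := by
  rw [tmul, tmul, ← map_smul]
  exact preMk_eq_of_rel (Or.inr (Or.inr (Or.inl ⟨a, x, y, rfl⟩)))

theorem tmul_smul (a : ℂ) (x : V) (y : W) : x ⊗ₑ (a • y) = a • x ⊗ₑ y := by
  rw [tmul, tmul, ← map_smul]
  exact preMk_eq_of_rel (Or.inr (Or.inr (Or.inr ⟨a, x, y, rfl⟩)))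

variable (V W) in
/-- The canonical bilinear map `V × W → V ⊗ W`. -/
def mkBilin : V →ₗ[ℂ] W →ₗ[ℂ] V ⊗ᵇ W :=
  LinearMap.mk₂ ℂ tmul add_tmul smul_tmul tmul_add tmul_smul

@[simp] theorem mkBilin_apply (x : V) (y : W) : mkBilin V W x y = x ⊗ₑ y := rfl

theorem mkBilin_bdd : IsBoundedBilin (mkBilin V W) := by
  intro B C hB hC
  refine isBounded_tensor_iff.2 ⟨preBall B C 1, isBounded_pre_iff.2 ⟨B, C, 1, hB, hC, subset_rfl⟩,
    ?_⟩
  rintro _ ⟨x, hx, y, hy, rfl⟩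
  exact ⟨preSingle x y, preSingle_mem hx hy, rfl⟩

/-- Bounded linear maps on the tensor product are determined on elementary tensors. -/
theorem tensor_ext {X : Type w} [AddCommGroup X] [Module ℂ X] [Bornology X]
    [CompleteBornological X] {f g : V ⊗ᵇ W →ₗ[ℂ] X} (hf : IsBoundedLin f) (hg : IsBoundedLin g)
    (h : ∀ x y, f (x ⊗ₑ y) = g (x ⊗ₑ y)) : f = g := by
  have hf' : IsBoundedLin (f ∘ₗ preMk V W) := hf.comp preMk_bdd
  have hg' : IsBoundedLin (g ∘ₗ preMk V W) := hg.comp preMk_bdd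
  refine LinearMap.ext fun t => ?_
  obtain ⟨c, rfl⟩ := preMk_surj t
  exact pre_closed_eq_top (isBornClosed_eqLocus hf' hg') (fun x y => h x y) c

end tensor

section lift

variable {V : Type u} {W : Type v} {X : Type w} [AddCommGroup V] [Module ℂ V] [Bornology V]
  [AddCommGroup W] [Module ℂ W] [Bornology W] [AddCommGroup X] [Module ℂ X] [Bornology X]

theorem summable_family {E : Type z} [NormedAddCommGroup E] [NormedSpace ℂ E] [CompleteSpace E]
    (c : PreTensor V W) (b : V × W → E) (M : ℝ) (hb : ∀ p, ‖b p‖ ≤ M) :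
    Summable (fun p => c.1 p • b p) ∧ ‖∑' p, c.1 p • b p‖ ≤ ‖c.1‖ * M := by
  have hs : HasSum (fun p => ‖c.1 p‖) ‖c.1‖ := by
    simpa using lp.hasSum_norm (p := 1) (by simp) c.1
  have hle : ∀ p, ‖c.1 p • b p‖ ≤ ‖c.1 p‖ * M := fun p => by
    rw [norm_smul]
    exact mul_le_mul_of_nonneg_left (hb p) (norm_nonneg _)
  exact ⟨Summable.of_norm_bounded (hs.mul_right M).summable hle,
    tsum_of_norm_bounded (hs.mul_right M) hle⟩

/-- `x` is the sum of the family `c p • b p`, the sum being formed in a Banach space mapped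
injectively to `X`. -/
def IsVal (b : V →ₗ[ℂ] W →ₗ[ℂ] X) (c : PreTensor V W) (x : X) : Prop :=
  ∃ (E : Type w) (_ : NormedAddCommGroup E) (_ : NormedSpace ℂ E) (_ : CompleteSpace E)
    (i : E →ₗ[ℂ] X) (s : V × W → E) (M : ℝ), Function.Injective i ∧ IsBoundedLin i ∧
    (∀ p, ‖s p‖ ≤ M) ∧ (∀ p, c.1 p ≠ 0 → i (s p) = b p.1 p.2) ∧ x = i (∑' p, c.1 p • s p)

theorem IsVal.unique [CompleteBornological X] {b : V →ₗ[ℂ] W →ₗ[ℂ] X} {c : PreTensor V W}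
    {x x' : X} (h : IsVal b c x) (h' : IsVal b c x') : x = x' := by
  obtain ⟨E, _, _, _, i, s, M, hi, hib, hs, hv, rfl⟩ := h
  obtain ⟨E', _, _, _, i', s', M', hi', hib', hs', hv', rfl⟩ := h'
  obtain ⟨G, _, _, _, k, R, hk, -, -, hR⟩ :=
    exists_ball ((hib _ (Metric.isBounded_closedBall (x := (0 : E)) (r := 1))).union
      (hib' _ (Metric.isBounded_closedBall (x := (0 : E')) (r := 1))))
  obtain ⟨j, hj⟩ := exists_factor i k hk R (fun e he => hR _ (Or.inl ⟨e, by simpa using he, rfl⟩))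
  obtain ⟨j', hj'⟩ := exists_factor i' k hk R
    (fun e he => hR _ (Or.inr ⟨e, by simpa using he, rfl⟩))
  rw [← hj, ← hj', j.map_tsum (summable_family c s M hs).1,
    j'.map_tsum (summable_family c s' M' hs').1]
  congr 1
  refine tsum_congr fun p => ?_
  rw [map_smul, map_smul]
  by_cases hc : c.1 p = 0
  · rw [hc, zero_smul, zero_smul]
  · congr 1
    apply hk
    rw [hj, hj', hv p hc, hv' p hc]

theorem exists_family [CompleteBornological X] {K : Set X} (hK : IsBounded K) :
    ∃ (E : Type w) (_ : NormedAddCommGroup E) (_ : NormedSpace ℂ E) (_ : CompleteSpace E)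
    (i : E →ₗ[ℂ] X) (M : ℝ), Function.Injective i ∧ IsBoundedLin i ∧ 0 ≤ M ∧
    ∀ (b : V →ₗ[ℂ] W →ₗ[ℂ] X) (B : Set V) (C : Set W), (∀ x ∈ B, ∀ y ∈ C, b x y ∈ K) →
      ∃ s : V × W → E, (∀ p, ‖s p‖ ≤ M) ∧ ∀ p : V × W, p.1 ∈ B ∧ p.2 ∈ C → i (s p) = b p.1 p.2 := by
  classical
  obtain ⟨E, h1, h2, h3, i, M, hi, hib, hM, h⟩ := exists_ball hK
  refine ⟨E, h1, h2, h3, i, M, hi, hib, hM, fun b B C hb => ?_⟩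
  have : ∀ p : V × W, ∃ e : E, ‖e‖ ≤ M ∧ (p.1 ∈ B ∧ p.2 ∈ C → i e = b p.1 p.2) := by
    intro p
    by_cases hp : p.1 ∈ B ∧ p.2 ∈ C
    · obtain ⟨e, he, hie⟩ := h _ (hb _ hp.1 _ hp.2)
      exact ⟨e, he, fun _ => hie⟩
    · exact ⟨0, by simpa using hM, fun hp' => (hp hp').elim⟩
  choose s hs using this
  exact ⟨s, fun p => (hs p).1, fun p => (hs p).2⟩

theorem exists_isVal [CompleteBornological X] {b : V →ₗ[ℂ] W →ₗ[ℂ] X} (hb : IsBoundedBilin b)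
    (c : PreTensor V W) : ∃ x, IsVal b c x := by
  obtain ⟨B, C, hB, hC, hc⟩ := c.2
  obtain ⟨E, h1, h2, h3, i, M, hi, hib, hM, h⟩ := exists_family (V := V) (W := W) (hb B C hB hC)
  obtain ⟨s, hs, hsv⟩ := h b B C (fun x hx y hy => ⟨x, hx, y, hy, rfl⟩)
  exact ⟨_, E, h1, h2, h3, i, s, M, hi, hib, hs, fun p hp => hsv p (hc p hp), rfl⟩

variable [CompleteBornological X]

/-- The linear extension of a bounded bilinear map to summable families. -/
def preLift (b : V →ₗ[ℂ] W →ₗ[ℂ] X) (hb : IsBoundedBilin b) : PreTensor V W →ₗ[ℂ] X where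
  toFun c := (exists_isVal hb c).choose
  map_add' c d := by
    obtain ⟨B, C, hB, hC, hc⟩ := c.2
    obtain ⟨B', C', hB', hC', hd⟩ := d.2
    obtain ⟨E, h1, h2, h3, i, M, hi, hib, hM, h⟩ := exists_family (V := V) (W := W)
      (hb _ _ (hB.union hB') (hC.union hC'))
    obtain ⟨s, hs, hsv⟩ := h b _ _ (fun x hx y hy => ⟨x, hx, y, hy, rfl⟩)
    have hc' : ∀ p, c.1 p ≠ 0 → i (s p) = b p.1 p.2 := fun p hp =>
      hsv p ⟨Or.inl (hc p hp).1, Or.inl (hc p hp).2⟩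
    have hd' : ∀ p, d.1 p ≠ 0 → i (s p) = b p.1 p.2 := fun p hp =>
      hsv p ⟨Or.inr (hd p hp).1, Or.inr (hd p hp).2⟩
    have hcd : ∀ p, (c + d).1 p = c.1 p + d.1 p := fun p => rfl
    have v1 : IsVal b c _ := ⟨E, h1, h2, h3, i, s, M, hi, hib, hs, hc', rfl⟩
    have v2 : IsVal b d _ := ⟨E, h1, h2, h3, i, s, M, hi, hib, hs, hd', rfl⟩
    have v3 : IsVal b (c + d) _ := ⟨E, h1, h2, h3, i, s, M, hi, hib, hs, fun p hp => by
      by_cases h0 : c.1 p = 0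
      · exact hd' p (fun h0' => hp (by rw [hcd, h0, h0', add_zero]))
      · exact hc' p h0, rfl⟩
    rw [(exists_isVal hb c).choose_spec.unique v1, (exists_isVal hb d).choose_spec.unique v2,
      (exists_isVal hb (c + d)).choose_spec.unique v3, ← map_add,
      ← (summable_family c s M hs).1.tsum_add (summable_family d s M hs).1]
    simp only [hcd, add_smul]
  map_smul' a c := by
    obtain ⟨E, h1, h2, h3, i, s, M, hi, hib, hs, hv, hx⟩ := (exists_isVal hb c).choose_spec
    have hac : ∀ p, (a • c).1 p = a * c.1 p := fun p => rfl
    have v3 : IsVal b (a • c) _ := ⟨E, h1, h2, h3, i, s, M, hi, hib, hs, fun p hp =>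
      hv p (fun h0 => hp (by rw [hac, h0, mul_zero])), rfl⟩
    rw [(exists_isVal hb (a • c)).choose_spec.unique v3, hx, RingHom.id_apply, ← map_smul,
      ← (summable_family c s M hs).1.tsum_const_smul]
    simp only [hac, mul_smul]

theorem preLift_isVal (b : V →ₗ[ℂ] W →ₗ[ℂ] X) (hb : IsBoundedBilin b) (c : PreTensor V W) :
    IsVal b c (preLift b hb c) := (exists_isVal hb c).choose_spec

/-- A bounded family of bilinear maps extends to a bounded family of linear maps. -/
theorem preLift_uniform {B : Set V} {C : Set W} (r : ℝ) {K : Set X} (hK : IsBounded K) :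
    ∃ K' : Set X, IsBounded K' ∧ ∀ (b : V →ₗ[ℂ] W →ₗ[ℂ] X) (hb : IsBoundedBilin b),
      (∀ x ∈ B, ∀ y ∈ C, b x y ∈ K) → ∀ c ∈ preBall B C r, preLift b hb c ∈ K' := by
  obtain ⟨E, h1, h2, h3, i, M, hi, hib, hM, h⟩ := exists_family (V := V) (W := W) hK
  refine ⟨_, hib _ (Metric.isBounded_closedBall (x := (0 : E)) (r := r * M)), ?_⟩
  intro b hb hbK c hc
  obtain ⟨s, hs, hsv⟩ := h b B C hbK
  have v : IsVal b c _ := ⟨E, h1, h2, h3, i, s, M, hi, hib, hs, fun p hp => hsv p (hc.2 p hp), rfl⟩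
  rw [(preLift_isVal b hb c).unique v]
  refine ⟨_, ?_, rfl⟩
  rw [mem_closedBall_zero_iff]
  exact (summable_family c s M hs).2.trans (mul_le_mul_of_nonneg_right hc.1 hM)

theorem preLift_bdd (b : V →ₗ[ℂ] W →ₗ[ℂ] X) (hb : IsBoundedBilin b) :
    IsBoundedLin (preLift b hb) := by
  intro T hT
  obtain ⟨B, C, r, hB, hC, h⟩ := isBounded_pre_iff.1 hT
  obtain ⟨K', hK', h'⟩ := preLift_uniform (B := B) (C := C) r (hb B C hB hC)
  refine hK'.subset ?_
  rintro _ ⟨c, hc, rfl⟩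
  exact h' b hb (fun x hx y hy => ⟨x, hx, y, hy, rfl⟩) c (h hc)

theorem preLift_single (b : V →ₗ[ℂ] W →ₗ[ℂ] X) (hb : IsBoundedBilin b) (x : V) (y : W) :
    preLift b hb (preSingle x y) = b x y := by
  classical
  obtain ⟨E, h1, h2, h3, i, s, M, hi, hib, hs, hv, hx⟩ := preLift_isVal b hb (preSingle x y)
  have h1 : (preSingle x y).1 (x, y) = 1 := by simp [preSingle]
  have h2 : ∀ p, p ≠ (x, y) → (preSingle x y).1 p = 0 := fun p hp => by
    by_contra h
    exact hp (preSingle_supp x y p h)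
  rw [hx, tsum_eq_single (x, y) (fun p hp => by rw [h2 p hp, zero_smul]), h1, one_smul]
  exact hv (x, y) (by rw [h1]; exact one_ne_zero)

theorem preLift_relations (b : V →ₗ[ℂ] W →ₗ[ℂ] X) (hb : IsBoundedBilin b) :
    bornClosure (bilinRelations V W) ≤ LinearMap.ker (preLift b hb) := by
  refine bornClosure_le (isBornClosed_ker _ (preLift_bdd b hb)) ?_
  rintro c (⟨x, x', y, rfl⟩ | ⟨x, y, y', rfl⟩ | ⟨a, x, y, rfl⟩ | ⟨a, x, y, rfl⟩) <;>
  simp only [SetLike.mem_coe, LinearMap.mem_ker, map_sub, map_add, map_smul, preLift_single,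
    LinearMap.add_apply, LinearMap.smul_apply, sub_self]

/-- The universal property: the bounded linear map `V ⊗ W → X` induced by a bounded bilinear map
`V × W → X` into a complete space. -/
def lift (b : V →ₗ[ℂ] W →ₗ[ℂ] X) (hb : IsBoundedBilin b) : BLin (V ⊗ᵇ W) X where
  lin := (bornClosure (bilinRelations V W)).liftQ (preLift b hb) (preLift_relations b hb)
  bdd := by
    intro S hS
    obtain ⟨T, hT, h⟩ := isBounded_tensor_iff.1 hS
    refine (preLift_bdd b hb T hT).subset ?_
    rintro _ ⟨t, ht, rfl⟩
    obtain ⟨c, hc, rfl⟩ := h ht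
    exact ⟨c, hc, rfl⟩

theorem lift_preMk (b : V →ₗ[ℂ] W →ₗ[ℂ] X) (hb : IsBoundedBilin b) (c : PreTensor V W) :
    lift b hb (preMk V W c) = preLift b hb c := rfl

@[simp] theorem lift_tmul (b : V →ₗ[ℂ] W →ₗ[ℂ] X) (hb : IsBoundedBilin b) (x : V) (y : W) :
    lift b hb (x ⊗ₑ y) = b x y := preLift_single b hb x y

/-- Equibounded bilinear maps induce equibounded linear maps on the tensor product. -/
theorem lift_uniform {Y : Type z} (D : Set Y) (b : Y → V →ₗ[ℂ] W →ₗ[ℂ] X) (hb : ∀ d, IsBoundedBilin (b d))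
    (h : ∀ (B : Set V) (C : Set W), IsBounded B → IsBounded C →
      ∃ K : Set X, IsBounded K ∧ ∀ d ∈ D, ∀ x ∈ B, ∀ y ∈ C, b d x y ∈ K)
    {S : Set (V ⊗ᵇ W)} (hS : IsBounded S) :
    ∃ K : Set X, IsBounded K ∧ ∀ d ∈ D, ∀ t ∈ S, lift (b d) (hb d) t ∈ K := by
  obtain ⟨T, hT, hST⟩ := isBounded_tensor_iff.1 hS
  obtain ⟨B, C, r, hB, hC, hr⟩ := isBounded_pre_iff.1 hT
  obtain ⟨K, hK, hbK⟩ := h B C hB hC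
  obtain ⟨K', hK', h'⟩ := preLift_uniform (B := B) (C := C) r hK
  refine ⟨K', hK', fun d hd t ht => ?_⟩
  obtain ⟨c, hc, rfl⟩ := hST ht
  exact h' (b d) (hb d) (hbK d hd) c (hr hc)

/-- The bounded linear map on the tensor product is unique. -/
theorem lift_unique {f : V ⊗ᵇ W →ₗ[ℂ] X} (hf : IsBoundedLin f) (b : V →ₗ[ℂ] W →ₗ[ℂ] X)
    (hb : IsBoundedBilin b) (h : ∀ x y, f (x ⊗ₑ y) = b x y) (t : V ⊗ᵇ W) : f t = lift b hb t :=
  LinearMap.congr_fun (tensor_ext hf (lift b hb).bdd fun x y => by rw [h, lift_tmul]) t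

end lift

/-- Bornological isomorphisms. -/
structure BIso (V : Type u) (W : Type v) [AddCommGroup V] [Module ℂ V] [Bornology V]
    [AddCommGroup W] [Module ℂ W] [Bornology W] where
  equiv : V ≃ₗ[ℂ] W
  bdd : IsBoundedLin equiv.toLinearMap
  bdd_symm : IsBoundedLin equiv.symm.toLinearMap

section maps

variable {V : Type u} {W : Type v} {X : Type w} {Y : Type z}
  [AddCommGroup V] [Module ℂ V] [Bornology V] [AddCommGroup W] [Module ℂ W] [Bornology W]
  [AddCommGroup X] [Module ℂ X] [Bornology X] [AddCommGroup Y] [Module ℂ Y] [Bornology Y]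

instance bisoCoeFun : CoeFun (BIso V W) (fun _ => V → W) := ⟨fun f => f.equiv⟩

/-- The underlying bounded linear map. -/
def BIso.toBLin (e : BIso V W) : BLin V W := ⟨e.equiv.toLinearMap, e.bdd⟩

theorem IsBoundedBilin.left {b : V →ₗ[ℂ] W →ₗ[ℂ] X} (hb : IsBoundedBilin b) (x : V) :
    IsBoundedLin (b x) := by
  intro C hC
  refine (hb {x} C isBounded_singleton hC).subset ?_
  rintro _ ⟨y, hy, rfl⟩
  exact ⟨x, rfl, y, hy, rfl⟩

theorem IsBoundedBilin.right {b : V →ₗ[ℂ] W →ₗ[ℂ] X} (hb : IsBoundedBilin b) (y : W) :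
    IsBoundedLin (b.flip y) := by
  intro C hC
  refine (hb C {y} hC isBounded_singleton).subset ?_
  rintro _ ⟨x, hx, rfl⟩
  exact ⟨x, hx, y, rfl, rfl⟩

/-- `y ↦ x ⊗ y` -/
def tmulL (x : V) (W : Type v) [AddCommGroup W] [Module ℂ W] [Bornology W] : BLin W (V ⊗ᵇ W) :=
  ⟨mkBilin V W x, mkBilin_bdd.left x⟩

/-- `x ↦ x ⊗ y` -/
def tmulR (V : Type u) [AddCommGroup V] [Module ℂ V] [Bornology V] (y : W) : BLin V (V ⊗ᵇ W) :=
  ⟨(mkBilin V W).flip y, mkBilin_bdd.right y⟩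

/-- The bilinear map `(x, y) ↦ f x ⊗ g y`. -/
def mapBilin (f : BLin V X) (g : BLin W Y) : V →ₗ[ℂ] W →ₗ[ℂ] X ⊗ᵇ Y :=
  (mkBilin X Y).compl₁₂ f.lin g.lin

theorem mapBilin_bdd (f : BLin V X) (g : BLin W Y) : IsBoundedBilin (mapBilin f g) := by
  intro B C hB hC
  refine (mkBilin_bdd _ _ (f.bdd B hB) (g.bdd C hC)).subset ?_
  rintro _ ⟨x, hx, y, hy, rfl⟩
  exact ⟨f x, ⟨x, hx, rfl⟩, g y, ⟨y, hy, rfl⟩, rfl⟩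

/-- The tensor product `f ⊗ g` of bounded linear maps. -/
def map (f : BLin V X) (g : BLin W Y) : BLin (V ⊗ᵇ W) (X ⊗ᵇ Y) :=
  lift (mapBilin f g) (mapBilin_bdd f g)

@[simp] theorem map_tmul (f : BLin V X) (g : BLin W Y) (x : V) (y : W) :
    map f g (x ⊗ₑ y) = f x ⊗ₑ g y := lift_tmul _ _ x y

theorem map_unique (f : BLin V X) (g : BLin W Y) {h : V ⊗ᵇ W →ₗ[ℂ] X ⊗ᵇ Y} (hh : IsBoundedLin h)
    (e : ∀ x y, h (x ⊗ₑ y) = f x ⊗ₑ g y) (t : V ⊗ᵇ W) : map f g t = h t :=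
  (lift_unique hh _ (mapBilin_bdd f g) e t).symm

/-- The map `(V ⊗ W) ⊗ X → V ⊗ (W ⊗ X)` as a bilinear map. -/
def assocBilin (V : Type u) (W : Type v) (X : Type w) [AddCommGroup V] [Module ℂ V] [Bornology V]
    [AddCommGroup W] [Module ℂ W] [Bornology W] [AddCommGroup X] [Module ℂ X] [Bornology X] :
    V ⊗ᵇ W →ₗ[ℂ] X →ₗ[ℂ] V ⊗ᵇ (W ⊗ᵇ X) :=
  LinearMap.mk₂ ℂ (fun t c => map (BLin.id V) (tmulR W c) t)
    (fun _ _ _ => map_add _ _ _) (fun _ _ _ => map_smul _ _ _)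
    (fun t c c' => map_unique _ _
      ((map (BLin.id V) (tmulR W c)).bdd.add (map (BLin.id V) (tmulR W c')).bdd)
      (fun x y => by
        rw [LinearMap.add_apply, map_tmul, map_tmul, ← tmul_add]
        exact congrArg _ (tmul_add y c c').symm) t)
    (fun a t c => map_unique _ _ ((map (BLin.id V) (tmulR W c)).bdd.smul a)
      (fun x y => by
        rw [LinearMap.smul_apply, map_tmul, ← tmul_smul]
        exact congrArg _ (tmul_smul a y c).symm) t)

theorem assocBilin_bdd : IsBoundedBilin (assocBilin V W X) := by
  intro S D hS hD
  obtain ⟨K, hK, h⟩ := lift_uniform D (fun c => mapBilin (BLin.id V) (tmulR W c))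
    (fun c => mapBilin_bdd _ _) (fun B C hB hC => by
      refine ⟨_, mkBilin_bdd B _ hB (mkBilin_bdd C D hC hD), fun c hc x hx y hy => ?_⟩
      exact ⟨x, hx, y ⊗ₑ c, ⟨y, hy, c, hc, rfl⟩, rfl⟩) hS
  refine hK.subset ?_
  rintro _ ⟨t, ht, c, hc, rfl⟩
  exact h c hc t ht

/-- The associativity map `(V ⊗ W) ⊗ X → V ⊗ (W ⊗ X)`. -/
def assoc (V : Type u) (W : Type v) (X : Type w) [AddCommGroup V] [Module ℂ V] [Bornology V]
    [AddCommGroup W] [Module ℂ W] [Bornology W] [AddCommGroup X] [Module ℂ X] [Bornology X] :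
    BLin ((V ⊗ᵇ W) ⊗ᵇ X) (V ⊗ᵇ (W ⊗ᵇ X)) := lift (assocBilin V W X) assocBilin_bdd

@[simp] theorem assoc_tmul (x : V) (y : W) (c : X) :
    assoc V W X ((x ⊗ₑ y) ⊗ₑ c) = x ⊗ₑ (y ⊗ₑ c) :=
  (lift_tmul _ _ _ _).trans (map_tmul _ _ _ _)

theorem isBounded_smul_set [CompleteBornological V] {D : Set ℂ} {B : Set V} (hD : IsBounded D)
    (hB : IsBounded B) : IsBounded (Set.image2 (fun (a : ℂ) (x : V) => a • x) D B) := by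
  obtain ⟨R, hR⟩ := hD.exists_norm_le
  obtain ⟨E, _, _, _, i, M, hi, hib, hM, h⟩ := exists_ball hB
  refine (hib _ (Metric.isBounded_closedBall (x := (0 : E)) (r := R * M))).subset ?_
  rintro _ ⟨a, ha, x, hx, rfl⟩
  obtain ⟨e, he, rfl⟩ := h x hx
  refine ⟨a • e, ?_, map_smul _ _ _⟩
  rw [mem_closedBall_zero_iff, norm_smul]
  exact mul_le_mul (hR a ha) he (norm_nonneg _) ((norm_nonneg _).trans (hR a ha))

/-- The slice map `ω ⊗ id : V ⊗ W → W`, `x ⊗ y ↦ ω(x) y`. -/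
def sliceL [CompleteBornological W] (om : BLin V ℂ) : BLin (V ⊗ᵇ W) W :=
  lift ((LinearMap.lsmul ℂ W : ℂ →ₗ[ℂ] W →ₗ[ℂ] W) ∘ₗ om.lin) (by
    intro B C hB hC
    refine (isBounded_smul_set (om.bdd B hB) hC).subset ?_
    rintro _ ⟨x, hx, y, hy, rfl⟩
    exact ⟨om x, ⟨x, hx, rfl⟩, y, hy, rfl⟩)

/-- The slice map `id ⊗ ω : V ⊗ W → V`, `x ⊗ y ↦ ω(y) x`. -/
def sliceR [CompleteBornological V] (om : BLin W ℂ) : BLin (V ⊗ᵇ W) V :=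
  lift ((LinearMap.lsmul ℂ V : ℂ →ₗ[ℂ] V →ₗ[ℂ] V) ∘ₗ om.lin).flip (by
    intro B C hB hC
    refine (isBounded_smul_set (om.bdd C hC) hB).subset ?_
    rintro _ ⟨x, hx, y, hy, rfl⟩
    exact ⟨om y, ⟨y, hy, rfl⟩, x, hx, rfl⟩)

@[simp] theorem sliceL_tmul [CompleteBornological W] (om : BLin V ℂ) (x : V) (y : W) :
    sliceL om (x ⊗ₑ y) = om x • y := lift_tmul _ _ x y

@[simp] theorem sliceR_tmul [CompleteBornological V] (om : BLin W ℂ) (x : V) (y : W) :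
    sliceR om (x ⊗ₑ y) = om y • x := lift_tmul _ _ x y

/-- A bounded bilinear map `b : M × N → P` induces a bornological isomorphism of the balanced
tensor product `M ⊗_A N` with `P`. Here `M ⊗_A N` is the quotient of `M ⊗ N` by the
bornologically closed subspace generated by `m a ⊗ n - m ⊗ a n`, with the quotient bornology. -/
def InducesBalancedIso {A M N P : Type*} [AddCommGroup A] [Module ℂ A]
    [AddCommGroup M] [Module ℂ M] [Bornology M] [AddCommGroup N] [Module ℂ N] [Bornology N]
    [AddCommGroup P] [Module ℂ P] [Bornology P] [CompleteBornological P]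
    (r : M →ₗ[ℂ] A →ₗ[ℂ] M) (l : A →ₗ[ℂ] N →ₗ[ℂ] N) (b : M →ₗ[ℂ] N →ₗ[ℂ] P) : Prop :=
  ∃ hb : IsBoundedBilin b,
    LinearMap.ker (lift b hb).lin =
      bornClosure {t : M ⊗ᵇ N | ∃ m a n, t = r m a ⊗ₑ n - m ⊗ₑ l a n} ∧
    ∀ B : Set P, IsBounded B → ∃ S : Set (M ⊗ᵇ N), IsBounded S ∧ B ⊆ lift b hb '' S

/-- Bornologically compact sets: images of compact subsets of a Banach space under an injective
bounded linear map. -/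
def IsBornCompact (K : Set V) : Prop :=
  ∃ (E : Type u) (_ : NormedAddCommGroup E) (_ : NormedSpace ℂ E) (_ : CompleteSpace E)
    (i : E →ₗ[ℂ] V) (C : Set E), Function.Injective i ∧ IsBoundedLin i ∧ IsCompact C ∧ i '' C = K

variable (V) in
/-- The approximation property: the identity can be approximated by bounded finite rank operators
uniformly on compact subsets. -/
def ApproximationProperty : Prop :=
  ∀ K : Set V, IsBornCompact K → ∃ T : Set V, IsBounded T ∧ ∀ r : ℝ, 0 < r →
    ∃ F : BLin V V, FiniteDimensional ℂ (LinearMap.range F.lin) ∧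
      ∀ x ∈ K, ∃ y ∈ T, x - F x = (r : ℂ) • y

end maps

/-! ### Bornological algebras and multipliers -/

/-- The standing conditions on the bornology of a (not necessarily unital) algebra: the underlying
bornological vector space is complete and convex, and multiplication is bounded. -/
class BornologicalAlgebra (A : Type u) [NonUnitalNonAssocRing A] [Module ℂ A] [SMulCommClass ℂ A A]
    [IsScalarTower ℂ A A] [Bornology A] : Prop extends CompleteBornological A where
  mul_bdd : IsBoundedBilin (LinearMap.mul ℂ A)

section algebra

variable {A : Type u} [NonUnitalNonAssocRing A] [Module ℂ A] [SMulCommClass ℂ A A]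
  [IsScalarTower ℂ A A] [Bornology A] [BornologicalAlgebra A]
  {B : Type v} [NonUnitalNonAssocRing B] [Module ℂ B] [SMulCommClass ℂ B B]
  [IsScalarTower ℂ B B] [Bornology B] [BornologicalAlgebra B]

/-- Left multiplication by `a`. -/
def mulL (a : A) : BLin A A := ⟨LinearMap.mul ℂ A a, BornologicalAlgebra.mul_bdd.left a⟩

@[simp] theorem mulL_apply (a b : A) : mulL a b = a * b := rfl

/-- The bilinear map `(a, b) ↦ (a ⊗ b) t` for fixed `t`. -/
def tensorMulBilin (t : A ⊗ᵇ B) : A →ₗ[ℂ] B →ₗ[ℂ] A ⊗ᵇ B :=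
  LinearMap.mk₂ ℂ (fun a b => map (mulL a) (mulL b) t)
    (fun a a' b => map_unique _ _ ((map (mulL a) (mulL b)).bdd.add (map (mulL a') (mulL b)).bdd)
      (fun x y => by simp [add_mul, add_tmul]) t)
    (fun c a b => map_unique _ _ ((map (mulL a) (mulL b)).bdd.smul c)
      (fun x y => by simp [smul_mul_assoc, smul_tmul]) t)
    (fun a b b' => map_unique _ _ ((map (mulL a) (mulL b)).bdd.add (map (mulL a) (mulL b')).bdd)
      (fun x y => by simp [add_mul, tmul_add]) t)
    (fun c a b => map_unique _ _ ((map (mulL a) (mulL b)).bdd.smul c)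
      (fun x y => by simp [smul_mul_assoc, tmul_smul]) t)

theorem tensorMulBilin_apply (t : A ⊗ᵇ B) (a : A) (b : B) :
    tensorMulBilin t a b = map (mulL a) (mulL b) t := rfl

theorem tensorMulBilin_uniform {D : Set A} {D' : Set B} {T : Set (A ⊗ᵇ B)} (hD : IsBounded D)
    (hD' : IsBounded D') (hT : IsBounded T) : ∃ K : Set (A ⊗ᵇ B), IsBounded K ∧
      ∀ t ∈ T, ∀ a ∈ D, ∀ b ∈ D', tensorMulBilin t a b ∈ K := by
  obtain ⟨K, hK, h⟩ := lift_uniform (D ×ˢ D') (fun p => mapBilin (mulL p.1) (mulL p.2))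
    (fun p => mapBilin_bdd _ _) (fun B C hB hC => by
      refine ⟨_, mkBilin_bdd _ _ (BornologicalAlgebra.mul_bdd D B hD hB)
        (BornologicalAlgebra.mul_bdd D' C hD' hC), fun p hp x hx y hy => ?_⟩
      exact ⟨_, ⟨p.1, hp.1, x, hx, rfl⟩, _, ⟨p.2, hp.2, y, hy, rfl⟩, rfl⟩) hT
  exact ⟨K, hK, fun t ht a ha b hb => h (a, b) ⟨ha, hb⟩ t ht⟩

theorem tensorMulBilin_bdd (t : A ⊗ᵇ B) : IsBoundedBilin (tensorMulBilin t) := by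
  intro D D' hD hD'
  obtain ⟨K, hK, h⟩ := tensorMulBilin_uniform hD hD' (isBounded_singleton (x := t))
  refine hK.subset ?_
  rintro _ ⟨a, ha, b, hb, rfl⟩
  exact h t rfl a ha b hb

/-- The product on `A ⊗ B`, determined by `(a ⊗ b)(a' ⊗ b') = a a' ⊗ b b'`. -/
instance tensorMul : Mul (A ⊗ᵇ B) := ⟨fun s t => lift (tensorMulBilin t) (tensorMulBilin_bdd t) s⟩

theorem tensor_mul_def (s t : A ⊗ᵇ B) :
    s * t = lift (tensorMulBilin t) (tensorMulBilin_bdd t) s := rfl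

theorem tmul_mul (a : A) (b : B) (t : A ⊗ᵇ B) : (a ⊗ₑ b) * t = map (mulL a) (mulL b) t :=
  lift_tmul _ _ a b

@[simp] theorem tmul_mul_tmul (a a' : A) (b b' : B) :
    (a ⊗ₑ b) * (a' ⊗ₑ b') = (a * a') ⊗ₑ (b * b') := by
  rw [tmul_mul, map_tmul]; rfl

theorem tensor_add_mul (s s' t : A ⊗ᵇ B) : (s + s') * t = s * t + s' * t := map_add _ _ _

theorem tensor_smul_mul (c : ℂ) (s t : A ⊗ᵇ B) : (c • s) * t = c • (s * t) := map_smul _ _ _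

theorem tensor_mul_add (s t t' : A ⊗ᵇ B) : s * (t + t') = s * t + s * t' :=
  (lift_unique ((lift _ (tensorMulBilin_bdd t)).bdd.add (lift _ (tensorMulBilin_bdd t')).bdd) _
    (tensorMulBilin_bdd (t + t')) (fun x y => by
      rw [LinearMap.add_apply, lift_tmul, lift_tmul]
      exact (map_add (map (mulL x) (mulL y)).lin t t').symm) s).symm

theorem tensor_mul_smul (c : ℂ) (s t : A ⊗ᵇ B) : s * (c • t) = c • (s * t) :=
  (lift_unique ((lift _ (tensorMulBilin_bdd t)).bdd.smul c) _
    (tensorMulBilin_bdd (c • t)) (fun x y => by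
      rw [LinearMap.smul_apply, lift_tmul]
      exact (map_smul (map (mulL x) (mulL y)).lin c t).symm) s).symm

instance tensorRing : NonUnitalNonAssocRing (A ⊗ᵇ B) :=
  { (inferInstance : AddCommGroup (A ⊗ᵇ B)), (inferInstance : Mul (A ⊗ᵇ B)) with
    left_distrib := tensor_mul_add
    right_distrib := tensor_add_mul
    zero_mul := fun t => map_zero (lift _ (tensorMulBilin_bdd t)).lin
    mul_zero := fun s => by
      have := tensor_mul_smul 0 s 0
      rwa [zero_smul, zero_smul] at this }

instance tensorSMulComm : SMulCommClass ℂ (A ⊗ᵇ B) (A ⊗ᵇ B) := ⟨fun c s t => (tensor_mul_smul c s t).symm⟩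

instance tensorScalarTower : IsScalarTower ℂ (A ⊗ᵇ B) (A ⊗ᵇ B) := ⟨fun c s t => tensor_smul_mul c s t⟩

instance tensorBornologicalAlgebra : BornologicalAlgebra (A ⊗ᵇ B) where
  mul_bdd := by
    intro S T hS hT
    obtain ⟨K, hK, h⟩ := lift_uniform T (fun t : A ⊗ᵇ B => tensorMulBilin t)
      (fun t => tensorMulBilin_bdd t) (fun D D' hD hD' => tensorMulBilin_uniform hD hD' hT) hS
    refine hK.subset ?_
    rintro _ ⟨s, hs, t, ht, rfl⟩
    exact h t ht s hs

variable (A) in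
/-- The multiplier algebra: pairs `(L, R)` of bounded linear maps with `L (a b) = L a b`,
`R (a b) = a R b` and `a (L b) = (R a) b`. The map `L` is left multiplication by the multiplier
and `R` is right multiplication by it. -/
def multiplierAlgebra : Subalgebra ℂ (Module.End ℂ A × (Module.End ℂ A)ᵐᵒᵖ) where
  carrier := {m | IsBoundedLin m.1 ∧ IsBoundedLin m.2.unop ∧
    (∀ a b, m.1 (a * b) = m.1 a * b) ∧ (∀ a b, m.2.unop (a * b) = a * m.2.unop b) ∧
    (∀ a b, a * m.1 b = m.2.unop a * b)}
  mul_mem' := by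
    rintro m n ⟨h1, h2, h3, h4, h5⟩ ⟨k1, k2, k3, k4, k5⟩
    refine ⟨h1.comp k1, k2.comp h2, ?_, ?_, ?_⟩
    · intro a b; simp [h3, k3]
    · intro a b; simp [h4, k4]
    · intro a b; simp [h5, k5]
  add_mem' := by
    rintro m n ⟨h1, h2, h3, h4, h5⟩ ⟨k1, k2, k3, k4, k5⟩
    refine ⟨h1.add k1, h2.add k2, ?_, ?_, ?_⟩
    · intro a b; simp [h3, k3, add_mul]
    · intro a b; simp [h4, k4, mul_add]
    · intro a b; simp [h5, k5, mul_add, add_mul]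
  algebraMap_mem' := by
    intro c
    refine ⟨isBoundedLin_id.smul c, isBoundedLin_id.smul c, ?_, ?_, ?_⟩
    · intro a b; simp [Algebra.algebraMap_eq_smul_one, smul_mul_assoc]
    · intro a b; simp [Algebra.algebraMap_eq_smul_one, mul_smul_comm]
    · intro a b; simp [Algebra.algebraMap_eq_smul_one, smul_mul_assoc, mul_smul_comm]

variable (A) in
/-- The type of two-sided multipliers of `A`. -/
abbrev Mult : Type u := multiplierAlgebra A

/-- `m.L a` is the product `m a`. -/
def Mult.L (m : Mult A) : A →ₗ[ℂ] A := m.1.1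

/-- `m.R a` is the product `a m`. -/
def Mult.R (m : Mult A) : A →ₗ[ℂ] A := m.1.2.unop

/-- The left action `(x, a) ↦ f(x) a` defined by a homomorphism into a multiplier algebra. -/
def homLeftAct (f : A →ₙₐ[ℂ] Mult B) : A →ₗ[ℂ] B →ₗ[ℂ] B :=
  LinearMap.mk₂ ℂ (fun x b => (f x).L b)
    (fun x y b => by simp [Mult.L]) (fun c x b => by simp [Mult.L])
    (fun x b b' => map_add _ _ _) (fun c x b => map_smul _ _ _)

/-- The right action `(a, x) ↦ a f(x)` defined by a homomorphism into a multiplier algebra. -/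
def homRightAct (f : A →ₙₐ[ℂ] Mult B) : B →ₗ[ℂ] A →ₗ[ℂ] B :=
  LinearMap.mk₂ ℂ (fun b x => (f x).R b)
    (fun b b' x => map_add _ _ _) (fun c b x => map_smul _ _ _)
    (fun x y b => by simp [Mult.R]) (fun c x b => by simp [Mult.R])

/-- An action of `A` on `K` from the left makes `K` an essential module: `A ⊗_A K ≅ K`. -/
def IsEssentialLeft {K : Type*} [AddCommGroup K] [Module ℂ K] [Bornology K]
    [CompleteBornological K] (act : A →ₗ[ℂ] K →ₗ[ℂ] K) : Prop :=
  InducesBalancedIso (LinearMap.mul ℂ A) act act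

/-- An action of `A` on `K` from the right makes `K` an essential module: `K ⊗_A A ≅ K`. -/
def IsEssentialRight {K : Type*} [AddCommGroup K] [Module ℂ K] [Bornology K]
    [CompleteBornological K] (act : K →ₗ[ℂ] A →ₗ[ℂ] K) : Prop :=
  InducesBalancedIso act (LinearMap.mul ℂ A) act

/-- A homomorphism `A → M(B)` is essential if it makes `B` an essential left and right module. -/
def IsEssentialHom (f : A →ₙₐ[ℂ] Mult B) : Prop :=
  IsEssentialLeft (homLeftAct f) ∧ IsEssentialRight (homRightAct f)

variable (A) in
/-- The algebra `A` is essential: multiplication induces `A ⊗_A A ≅ A`. -/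
def IsEssentialAlgebra : Prop := IsEssentialLeft (LinearMap.mul ℂ A)

variable (A) in
/-- Multiplication as a bounded linear map `A ⊗ A → A`. -/
def mulMap : BLin (A ⊗ᵇ A) A := lift (LinearMap.mul ℂ A) BornologicalAlgebra.mul_bdd

/-- A functional is faithful if `φ(xy) = 0` for all `y` implies `x = 0` and `φ(xy) = 0` for all
`x` implies `y = 0`. -/
def IsFaithful (phi : BLin A ℂ) : Prop :=
  (∀ x, (∀ y, phi (x * y) = 0) → x = 0) ∧ ∀ y, (∀ x, phi (x * y) = 0) → y = 0

/-! ### Comultiplications, Galois maps and Haar functionals -/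

/-- `t ∈ A ⊗ A` is the element `Δ(x)(y ⊗ 1)`. -/
def IsGammaL (D : A → Mult (A ⊗ᵇ A)) (x y : A) (t : A ⊗ᵇ A) : Prop :=
  ∀ a b, t * (a ⊗ₑ b) = (D x).L ((y * a) ⊗ₑ b)

/-- `t ∈ A ⊗ A` is the element `Δ(x)(1 ⊗ y)`. -/
def IsGammaR (D : A → Mult (A ⊗ᵇ A)) (x y : A) (t : A ⊗ᵇ A) : Prop :=
  ∀ a b, t * (a ⊗ₑ b) = (D x).L (a ⊗ₑ (y * b))

/-- `t ∈ A ⊗ A` is the element `(x ⊗ 1)Δ(y)`. -/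
def IsRhoL (D : A → Mult (A ⊗ᵇ A)) (x y : A) (t : A ⊗ᵇ A) : Prop :=
  ∀ a b, (a ⊗ₑ b) * t = (D y).R ((a * x) ⊗ₑ b)

/-- `t ∈ A ⊗ A` is the element `(1 ⊗ x)Δ(y)`. -/
def IsRhoR (D : A → Mult (A ⊗ᵇ A)) (x y : A) (t : A ⊗ᵇ A) : Prop :=
  ∀ a b, (a ⊗ₑ b) * t = (D y).R (a ⊗ₑ (b * x))

/-- Left invariance: `(id ⊗ φ)Δ(x) = φ(x) 1`. The left hand side is the multiplier with
`(id ⊗ φ)Δ(x) y = (id ⊗ φ)(Δ(x)(y ⊗ 1))` and `y (id ⊗ φ)Δ(x) = (id ⊗ φ)((y ⊗ 1)Δ(x))`. -/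
def IsLeftInvariant (D : A → Mult (A ⊗ᵇ A)) (phi : BLin A ℂ) : Prop :=
  (∀ x y, ∃ t, IsGammaL D x y t ∧ sliceR phi t = phi x • y) ∧
  (∀ x y, ∃ t, IsRhoL D y x t ∧ sliceR phi t = phi x • y)

/-- Left Haar functionals: faithful left invariant bounded linear functionals. -/
def IsLeftHaar (D : A → Mult (A ⊗ᵇ A)) (phi : BLin A ℂ) : Prop :=
  IsFaithful phi ∧ IsLeftInvariant D phi

/-- The multiplier `δ` is the modular element: `(φ ⊗ id)Δ(x) = φ(x) δ`. The left hand side is the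
multiplier with `(φ ⊗ id)Δ(x) y = (φ ⊗ id)(Δ(x)(1 ⊗ y))` and
`y (φ ⊗ id)Δ(x) = (φ ⊗ id)((1 ⊗ y)Δ(x))`. -/
def IsModularElement (D : A → Mult (A ⊗ᵇ A)) (phi : BLin A ℂ) (d : Mult A) : Prop :=
  (∀ x y, ∃ t, IsGammaR D x y t ∧ sliceL phi t = phi x • d.L y) ∧
  (∀ x y, ∃ t, IsRhoR D y x t ∧ sliceL phi t = phi x • d.R y)

end algebra

/-- A bornological quantum group: an essential bornological algebra with the approximation
property, with a comultiplication whose Galois maps are isomorphisms of `H ⊗ H`, and with a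
faithful left invariant functional. -/
structure BornologicalQuantumGroup (H : Type u) [NonUnitalRing H] [Module ℂ H]
    [SMulCommClass ℂ H H] [IsScalarTower ℂ H H] [Bornology H] [BornologicalAlgebra H] where
  essential : IsEssentialAlgebra H
  approximation : ApproximationProperty H
  /-- the comultiplication `Δ` -/
  comul : H →ₙₐ[ℂ] Mult (H ⊗ᵇ H)
  comul_essential : IsEssentialHom comul
  /-- the Galois map `γ_l (x ⊗ y) = Δ(x)(y ⊗ 1)` -/
  gammaL : BIso (H ⊗ᵇ H) (H ⊗ᵇ H)
  /-- the Galois map `γ_r (x ⊗ y) = Δ(x)(1 ⊗ y)` -/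
  gammaR : BIso (H ⊗ᵇ H) (H ⊗ᵇ H)
  /-- the Galois map `ρ_l (x ⊗ y) = (x ⊗ 1)Δ(y)` -/
  rhoL : BIso (H ⊗ᵇ H) (H ⊗ᵇ H)
  /-- the Galois map `ρ_r (x ⊗ y) = (1 ⊗ x)Δ(y)` -/
  rhoR : BIso (H ⊗ᵇ H) (H ⊗ᵇ H)
  gammaL_spec : ∀ x y, IsGammaL comul x y (gammaL (x ⊗ₑ y))
  gammaR_spec : ∀ x y, IsGammaR comul x y (gammaR (x ⊗ₑ y))
  rhoL_spec : ∀ x y, IsRhoL comul x y (rhoL (x ⊗ₑ y))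
  rhoR_spec : ∀ x y, IsRhoR comul x y (rhoR (x ⊗ₑ y))
  /-- Coassociativity `(Δ ⊗ id)Δ(y) = (id ⊗ Δ)Δ(y)`, multiplied by `x ⊗ 1 ⊗ 1` from the left and by
  `1 ⊗ 1 ⊗ z` from the right, so that both sides are elements of `H ⊗ H ⊗ H`:
  `(x ⊗ 1 ⊗ 1)(Δ ⊗ id)(Δ(y)(1 ⊗ z)) = (id ⊗ Δ)((x ⊗ 1)Δ(y))(1 ⊗ 1 ⊗ z)`. -/
  coassoc : ∀ x y z,
    assoc H H H (map (rhoL.toBLin.comp (tmulL x H)) (BLin.id H) (gammaR (y ⊗ₑ z))) =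
      map (BLin.id H) (gammaR.toBLin.comp (tmulR H z)) (rhoL (x ⊗ₑ y))
  /-- the left Haar functional `φ` -/
  haar : BLin H ℂ
  haar_leftHaar : IsLeftHaar comul haar

namespace BornologicalQuantumGroup

variable {H : Type u} [NonUnitalRing H] [Module ℂ H] [SMulCommClass ℂ H H] [IsScalarTower ℂ H H]
  [Bornology H] [BornologicalAlgebra H] (Q : BornologicalQuantumGroup H)

/-- The counit: an essential algebra homomorphism `ε : H → ℂ` with
`(ε ⊗ id)Δ = id = (id ⊗ ε)Δ`. -/
structure IsCounit (e : BLin H ℂ) : Prop where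
  map_mul : ∀ x y, e (x * y) = e x * e y
  essential_left : IsEssentialLeft (A := H) (K := ℂ) (LinearMap.mul ℂ ℂ ∘ₗ e.lin)
  essential_right : IsEssentialRight (A := H) (K := ℂ) ((LinearMap.mul ℂ ℂ).compl₂ e.lin)
  counit_gammaR : ∀ x y, sliceL e (Q.gammaR (x ⊗ₑ y)) = x * y
  counit_rhoR : ∀ x y, sliceL e (Q.rhoR (y ⊗ₑ x)) = y * x
  counit_gammaL : ∀ x y, sliceR e (Q.gammaL (x ⊗ₑ y)) = x * y
  counit_rhoL : ∀ x y, sliceR e (Q.rhoL (y ⊗ₑ x)) = y * x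

/-- The antipode: the bounded linear map `S` with `μ(S ⊗ id)γ_r = ε ⊗ id` and
`μ(id ⊗ S)ρ_l = id ⊗ ε`. -/
structure IsAntipode (e : BLin H ℂ) (S : BLin H H) : Prop where
  left : ∀ t, mulMap H (map S (BLin.id H) (Q.gammaR t)) = sliceL e t
  right : ∀ t, mulMap H (map (BLin.id H) S (Q.rhoL t)) = sliceR e t

/-! ### The dual quantum group -/

/-- The Fourier transform `F_l(x)(h) = φ(h x)` as a linear map to the space of functionals. -/
def fourierLin : H →ₗ[ℂ] (H →ₗ[ℂ] ℂ) := ((LinearMap.mul ℂ H).compr₂ Q.haar.lin).flip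

@[simp] theorem fourierLin_apply (x h : H) : Q.fourierLin x h = Q.haar (h * x) := rfl

theorem fourierLin_injective : Function.Injective Q.fourierLin := by
  rw [← LinearMap.ker_eq_bot, LinearMap.ker_eq_bot']
  intro x hx
  exact Q.haar_leftHaar.1.2 x fun h => LinearMap.congr_fun hx h

/-- The underlying vector space of the dual quantum group: the space of functionals of the form
`h ↦ φ(h x)`. -/
def Dual : Type u := LinearMap.range Q.fourierLin

instance dualAddCommGroup : AddCommGroup Q.Dual := inferInstanceAs (AddCommGroup (LinearMap.range Q.fourierLin))
instance dualModule : Module ℂ Q.Dual := inferInstanceAs (Module ℂ (LinearMap.range Q.fourierLin))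

/-- Elements of the dual as functionals on `H`. -/
def toFunctional : Q.Dual →ₗ[ℂ] (H →ₗ[ℂ] ℂ) := (LinearMap.range Q.fourierLin).subtype

instance dualCoeFun : CoeFun Q.Dual (fun _ => H → ℂ) := ⟨fun f => Q.toFunctional f⟩

/-- The Fourier transform `F_l` as an isomorphism of `H` with its dual. -/
def fourier : H ≃ₗ[ℂ] Q.Dual := LinearEquiv.ofInjective Q.fourierLin Q.fourierLin_injective

@[simp] theorem fourier_apply (x h : H) : (Q.fourier x) h = Q.haar (h * x) := rfl

/-- The bornology on the dual for which `F_l` is a bornological isomorphism. -/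
instance dualBornology : Bornology Q.Dual := Bornology.induced Q.fourier.symm

theorem isBounded_dual_iff {S : Set Q.Dual} : IsBounded S ↔ IsBounded (Q.fourier.symm '' S) :=
  isBounded_induced

theorem fourier_bdd : IsBoundedLin Q.fourier.toLinearMap := by
  intro B hB
  rw [isBounded_dual_iff, ← Set.image_comp]
  simpa [Function.comp_def] using hB

theorem fourier_symm_bdd : IsBoundedLin Q.fourier.symm.toLinearMap := fun _ hB =>
  Q.isBounded_dual_iff.1 hB

instance dualComplete : CompleteBornological Q.Dual := by
  refine ⟨fun S hS => ?_⟩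
  obtain ⟨E, h1, h2, h3, i, hi, hib, A, hA, h⟩ :=
    CompleteBornological.exists_banach _ (Q.isBounded_dual_iff.1 hS)
  refine ⟨E, h1, h2, h3, Q.fourier.toLinearMap ∘ₗ i, Q.fourier.injective.comp hi,
    Q.fourier_bdd.comp hib, A, hA, ?_⟩
  rw [LinearMap.coe_comp, Set.image_comp, h, ← Set.image_comp]
  simp

/-- The convolution `x ⋆ y = (id ⊗ φ) γ_l⁻¹ (x ⊗ y)` on `H`. -/
def conv : H →ₗ[ℂ] H →ₗ[ℂ] H :=
  (mkBilin H H).compr₂ ((sliceR Q.haar).lin ∘ₗ Q.gammaL.equiv.symm.toLinearMap)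

theorem conv_apply (x y : H) : Q.conv x y = sliceR Q.haar (Q.gammaL.equiv.symm (x ⊗ₑ y)) := rfl

theorem conv_bdd : IsBoundedBilin Q.conv := by
  intro B C hB hC
  refine ((sliceR Q.haar).bdd _ (Q.gammaL.bdd_symm _ (mkBilin_bdd B C hB hC))).subset ?_
  rintro _ ⟨x, hx, y, hy, rfl⟩
  exact ⟨_, ⟨_, ⟨x, hx, y, hy, rfl⟩, rfl⟩, rfl⟩

/-- The product on the dual induced by the comultiplication, `(f g)(h) = (f ⊗ g)Δ(h)`. For
`f = F_l(x)`, `g = F_l(y)` and `x ⊗ y = Δ(a)(b ⊗ 1)` the right hand side is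
`(φ ⊗ φ)(Δ(h)(x ⊗ y)) = (φ ⊗ φ)(Δ(h a)(b ⊗ 1)) = φ(h a) φ(b)` by left invariance, so that
`f g = F_l(φ(b) a) = F_l((id ⊗ φ) γ_l⁻¹ (x ⊗ y))`. -/
instance dualMul : Mul Q.Dual := ⟨fun f g => Q.fourier (Q.conv (Q.fourier.symm f) (Q.fourier.symm g))⟩

theorem dual_mul_def (f g : Q.Dual) :
    f * g = Q.fourier (Q.conv (Q.fourier.symm f) (Q.fourier.symm g)) := rfl

instance dualRing : NonUnitalNonAssocRing Q.Dual :=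
  { (inferInstance : AddCommGroup Q.Dual), (inferInstance : Mul Q.Dual) with
    left_distrib := fun f g k => by simp [dual_mul_def]
    right_distrib := fun f g k => by simp [dual_mul_def]
    zero_mul := fun f => by simp [dual_mul_def]
    mul_zero := fun f => by simp [dual_mul_def] }

instance dualSMulComm : SMulCommClass ℂ Q.Dual Q.Dual := ⟨fun c f g => by simp [dual_mul_def]⟩

instance dualScalarTower : IsScalarTower ℂ Q.Dual Q.Dual := ⟨fun c f g => by simp [dual_mul_def]⟩

instance dualBornologicalAlgebra : BornologicalAlgebra Q.Dual where
  mul_bdd := by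
    intro B C hB hC
    refine (Q.fourier_bdd _ (Q.conv_bdd _ _ (Q.fourier_symm_bdd B hB)
      (Q.fourier_symm_bdd C hC))).subset ?_
    rintro _ ⟨f, hf, g, hg, rfl⟩
    exact ⟨_, ⟨_, ⟨f, hf, rfl⟩, _, ⟨g, hg, rfl⟩, rfl⟩, rfl⟩

/-- Evaluation of elements of the dual at `s`. -/
def evalAt (s : H) : BLin Q.Dual ℂ where
  lin := Q.toFunctional.flip s
  bdd := by
    intro B hB
    refine (Q.haar.bdd _ (BornologicalAlgebra.mul_bdd {s} _ isBounded_singleton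
      (Q.fourier_symm_bdd B hB))).subset ?_
    rintro _ ⟨f, hf, rfl⟩
    refine ⟨_, ⟨s, rfl, _, ⟨f, hf, rfl⟩, rfl⟩, ?_⟩
    obtain ⟨x, rfl⟩ := Q.fourier.surjective f
    simp

@[simp] theorem evalAt_apply (s : H) (f : Q.Dual) : Q.evalAt s f = f s := rfl

/-- The pairing of the dual tensor square with `s ⊗ t`, `f ⊗ g ↦ f(s) g(t)`. -/
def evalAt₂ (s t : H) : BLin (Q.Dual ⊗ᵇ Q.Dual) ℂ := (Q.evalAt s).comp (sliceR (Q.evalAt t))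

@[simp] theorem evalAt₂_tmul (s t : H) (f g : Q.Dual) :
    Q.evalAt₂ s t (f ⊗ₑ g) = f s * g t := by
  change Q.evalAt s (sliceR (Q.evalAt t) (f ⊗ₑ g)) = _
  rw [sliceR_tmul, map_smul, smul_eq_mul, mul_comm]
  rfl

/-- The left regular action `f ⇀ x = (id ⊗ f)Δ(x)` of the dual on `H`; for `f = F_l(y)` this is
`(id ⊗ φ)(Δ(x)(1 ⊗ y))`. -/
def leftAct (f : Q.Dual) (x : H) : H := sliceR Q.haar (Q.gammaR (x ⊗ₑ Q.fourier.symm f))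

/-- The right regular action `x ↼ f = (f ⊗ id)Δ(x)` of the dual on `H`; for `f = F_l(y)` this is
`(φ ⊗ id)(Δ(x)(y ⊗ 1))`. -/
def rightAct (x : H) (f : Q.Dual) : H := sliceL Q.haar (Q.gammaL (x ⊗ₑ Q.fourier.symm f))

/-- The comultiplication of the dual, determined by the multiplication of `H` through
`Δ̂(f)(s ⊗ t) = f(s t)`. In Sweedler notation, the conditions read
`(Δ̂(f)(g ⊗ k))(s ⊗ t) = f(s₁ t₁) g(s₂) k(t₂)` and
`((g ⊗ k)Δ̂(f))(s ⊗ t) = g(s₁) k(t₁) f(s₂ t₂)`. -/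
def IsDualComul (D : Q.Dual → Mult (Q.Dual ⊗ᵇ Q.Dual)) : Prop :=
  ∀ (f g k : Q.Dual) (s t : H),
    Q.evalAt₂ s t ((D f).L (g ⊗ₑ k)) = f (Q.leftAct g s * Q.leftAct k t) ∧
    Q.evalAt₂ s t ((D f).R (g ⊗ₑ k)) = f (Q.rightAct s g * Q.rightAct t k)

/-- `T` is the left action `x ↦ m ⇀ x` on `H` of a multiplier `m` of the dual: the bounded linear
map with `m ⇀ (f ⇀ x) = (m f) ⇀ x`. -/
def IsMultLeftAct (m : Mult Q.Dual) (T : BLin H H) : Prop :=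
  ∀ (f : Q.Dual) (x : H), T (Q.leftAct f x) = Q.leftAct (m.L f) x

/-- `T` is the right action `x ↦ x ↼ m` on `H` of a multiplier `m` of the dual: the bounded linear
map with `(x ↼ f) ↼ m = x ↼ (f m)`. -/
def IsMultRightAct (m : Mult Q.Dual) (T : BLin H H) : Prop :=
  ∀ (f : Q.Dual) (x : H), T (Q.rightAct x f) = Q.rightAct x (m.R f)

end BornologicalQuantumGroup

end BornQG

end

open BornQG

noncomputable section

namespace BornQG

/-! ### Slice maps, the flip, and functoriality of the completed tensor product. -/

section slices

variable {V : Type u} {W : Type v} {X : Type w} {Y : Type z}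
  [AddCommGroup V] [Module ℂ V] [Bornology V] [AddCommGroup W] [Module ℂ W] [Bornology W]
  [AddCommGroup X] [Module ℂ X] [Bornology X] [AddCommGroup Y] [Module ℂ Y] [Bornology Y]

/-! The formula rests on one observation: carried to H by the Fourier transform, the Haar functional
of the dual is a non-zero multiple of a character χ of H (`exists_character_dualHaar`), and the
modular element of the dual is χ itself, read as a functional. For a character α write R_α = (id ⊗
α)Δ and L_α = (α ⊗ id)Δ. With ω = χ ∘ S the maps R_χ, L_χ are algebra automorphisms with inverses
R_ω, L_ω (`IsCharacter.isInversePair`). The action of δ̂ from the left is R_χ and that of δ̂⁻¹ from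
the right is L_ω, so the claim becomes (L_ω R_χ x) δ = δ S⁴(x), which is `IsInversePair.radford`.

Two properties of φ enter: φ(S x) = φ(x δ) (`IsAntipode.haar_antipode`), and the existence of a
modular map σ with φ(x h) = φ(h σ(x)) (`IsAntipode.exists_modularAut`). Their source is strong
invariance, which describes S on slices of Δ: `IsAntipode.antipode_rslice_haar` for φ and
`IsAntipode.antipode_lsliceRho` for φ ∘ S.

Combining strong invariance with σ gives (S² ⊗ σ)Δ = Δσ in Galois form
(`IsAntipode.map_antipode_modularAut_gammaR`). Left invariance of the dual Haar functional means χ ∘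
σ = ε, so applying id ⊗ χ yields S² = R_χ σ. Evaluating φ(S(z v)) once as φ(z · v δ), and once
through anti-multiplicativity of S and σ, gives v δ = δ σ(L_χ S² v). Substituting v = L_ω R_χ x,
together with R_χ S = S L_ω and L_ω S = S R_χ, produces S⁴.

H need not have a unit and Δ has values in multipliers, so all computations run through Galois maps
and slices. Identities in H ⊗ H are tested by slicing with functionals φ(· k) or φ(k ·); this
suffices because the approximation property makes slices separate points of the completed tensor
product (`eq_zero_of_sliceL`). Bounded maps on H are compared on slices of Δ (`ext_rslice`,
`ext_lslice`), because the Galois maps are onto. -/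

@[simp] theorem BLin.comp_apply (g : BLin W X) (f : BLin V W) (x : V) :
    (g.comp f).lin x = g (f x) := rfl

@[simp] theorem BLin.id_apply (x : V) : (BLin.id V).lin x = x := rfl

@[simp] theorem tmulL_apply (x : V) (y : W) : (tmulL x W).lin y = x ⊗ₑ y := rfl

@[simp] theorem tmulR_apply (x : V) (y : W) : (tmulR V y).lin x = x ⊗ₑ y := rfl

theorem BIso.toBLin_apply (e : BIso V W) (x : V) : e.toBLin.lin x = e x := rfl

/-- The inverse of a bornological isomorphism. -/
def BIso.inv (e : BIso V W) : BLin W V := ⟨e.equiv.symm.toLinearMap, e.bdd_symm⟩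

@[simp] theorem BIso.apply_inv (e : BIso V W) (y : W) : e.equiv (e.inv.lin y) = y :=
  e.equiv.apply_symm_apply y

/-- Bounded linear maps on the tensor product agree if they agree on elementary tensors. -/
theorem BLin.eq_of_tmul [CompleteBornological X] (f g : BLin (V ⊗ᵇ W) X)
    (h : ∀ x y, f (x ⊗ₑ y) = g (x ⊗ₑ y)) (t : V ⊗ᵇ W) : f t = g t :=
  LinearMap.congr_fun (tensor_ext f.bdd g.bdd h) t

/-- A scalar multiple of a bounded linear map. -/
def BLin.smul [CompleteBornological W] (c : ℂ) (f : BLin V W) : BLin V W :=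
  ⟨c • f.lin, f.bdd.smul c⟩

@[simp] theorem BLin.smul_apply [CompleteBornological W] (c : ℂ) (f : BLin V W) (x : V) :
    (f.smul c).lin x = c • f x := rfl

/-- The flip `V ⊗ W → W ⊗ V`. -/
def swap (V : Type u) (W : Type v) [AddCommGroup V] [Module ℂ V] [Bornology V]
    [AddCommGroup W] [Module ℂ W] [Bornology W] : BLin (V ⊗ᵇ W) (W ⊗ᵇ V) :=
  lift (mkBilin W V).flip (by
    intro B C hB hC
    refine (mkBilin_bdd C B hC hB).subset ?_
    rintro _ ⟨x, hx, y, hy, rfl⟩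
    exact ⟨y, hy, x, hx, rfl⟩)

@[simp] theorem swap_tmul (x : V) (y : W) : (swap V W).lin (x ⊗ₑ y) = y ⊗ₑ x := lift_tmul _ _ x y

theorem swap_swap (t : V ⊗ᵇ W) : swap W V (swap V W t) = t :=
  BLin.eq_of_tmul ((swap W V).comp (swap V W)) (BLin.id _) (fun x y => by simp) t

theorem map_map {V' : Type*} {W' : Type*} [AddCommGroup V'] [Module ℂ V'] [Bornology V']
    [AddCommGroup W'] [Module ℂ W'] [Bornology W'] (f : BLin V X) (g : BLin W Y)
    (f' : BLin V' V) (g' : BLin W' W) (t : V' ⊗ᵇ W') :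
    map f g (map f' g' t) = map (f.comp f') (g.comp g') t :=
  BLin.eq_of_tmul ((map f g).comp (map f' g')) (map (f.comp f') (g.comp g')) (fun x y => by simp) t

theorem map_congr {f f' : BLin V X} {g g' : BLin W Y} (hf : ∀ x, f x = f' x)
    (hg : ∀ y, g y = g' y) (t : V ⊗ᵇ W) : map f g t = map f' g' t := by
  rw [BLin.ext' hf, BLin.ext' hg]

@[simp] theorem BLin.comp_id (f : BLin V W) : f.comp (BLin.id V) = f := rfl

@[simp] theorem BLin.id_comp (f : BLin V W) : (BLin.id W).comp f = f := rfl

theorem map_id_comm (f : BLin V X) (g : BLin W Y) (t : V ⊗ᵇ W) :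
    map (BLin.id X) g (map f (BLin.id W) t) = map f (BLin.id Y) (map (BLin.id V) g t) := by
  rw [map_map, map_map]
  rfl

theorem sliceL_map [CompleteBornological W] [CompleteBornological Y] (om : BLin X ℂ) (f : BLin V X)
    (g : BLin W Y) (t : V ⊗ᵇ W) : sliceL om (map f g t) = g (sliceL (om.comp f) t) :=
  BLin.eq_of_tmul ((sliceL om).comp (map f g)) (g.comp (sliceL (om.comp f)))
    (fun x y => by simp) t

theorem sliceR_map [CompleteBornological V] [CompleteBornological X] (om : BLin Y ℂ) (f : BLin V X)
    (g : BLin W Y) (t : V ⊗ᵇ W) : sliceR om (map f g t) = f (sliceR (om.comp g) t) :=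
  BLin.eq_of_tmul ((sliceR om).comp (map f g)) (f.comp (sliceR (om.comp g)))
    (fun x y => by simp) t

theorem sliceL_swap [CompleteBornological V] (om : BLin W ℂ) (t : V ⊗ᵇ W) :
    sliceL om (swap V W t) = sliceR om t :=
  BLin.eq_of_tmul ((sliceL om).comp (swap V W)) (sliceR om) (fun x y => by simp) t

theorem sliceL_smul [CompleteBornological W] (c : ℂ) (om : BLin V ℂ) (t : V ⊗ᵇ W) :
    sliceL (om.smul c) t = c • sliceL om t :=
  BLin.eq_of_tmul (sliceL (om.smul c)) ((sliceL om).smul c) (fun x y => by simp [mul_smul]) t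

theorem sliceR_smul [CompleteBornological V] (c : ℂ) (om : BLin W ℂ) (t : V ⊗ᵇ W) :
    sliceR (om.smul c) t = c • sliceR om t :=
  BLin.eq_of_tmul (sliceR (om.smul c)) ((sliceR om).smul c) (fun x y => by simp [mul_smul]) t

/-- Both sides are (f ⊗ g)(t). This Fubini rule is what trades a slice in one leg for a slice in the
other throughout. -/
theorem apply_sliceR [CompleteBornological V] [CompleteBornological W] (f : BLin V ℂ)
    (g : BLin W ℂ) (t : V ⊗ᵇ W) : f (sliceR g t) = g (sliceL f t) :=
  BLin.eq_of_tmul (f.comp (sliceR g)) (g.comp (sliceL f)) (fun x y => by simp [mul_comm]) t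

end slices

/-! ### Slices separate points under the approximation property. -/

section separation

/-- Absolutely summable families admit weights tending to infinity on their support for which
they remain summable. -/
theorem exists_weight {ι : Type*} (a : ι → ℝ) (ha : Summable a) (h0 : ∀ p, 0 ≤ a p) :
    ∃ d : ι → ℝ, (∀ p, 1 ≤ d p) ∧ Summable (fun p => a p * d p) ∧
      ∀ N : ℝ, {p | a p ≠ 0 ∧ d p ≤ N}.Finite := by
  classical
  -- Choose finite sets whose complementary tails are below 2⁻ᵏ. The weight counts how many of them
  -- miss p, so its sum against a is the sum of the tails, bounded by a geometric series.
  have hs : ∀ k : ℕ, ∃ s : Finset ι, ∑' p : {x // x ∉ s}, a p < (1 / 2 : ℝ) ^ k := by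
    intro k
    have := (tendsto_tsum_compl_atTop_zero a).eventually
      (gt_mem_nhds (show (0 : ℝ) < (1 / 2 : ℝ) ^ k by positivity))
    exact this.exists
  choose s hs using hs
  obtain ⟨e, he⟩ : ∃ e : ℕ → ι → ℝ, ∀ k p, e k p = if p ∈ s k then 0 else 1 :=
    ⟨fun k p => if p ∈ s k then 0 else 1, fun _ _ => rfl⟩
  have he0 : ∀ k p, 0 ≤ e k p := fun k p => by rw [he]; split_ifs <;> norm_num
  have hae : ∀ k, ∀ p, a p * e k p = Set.indicator {x | x ∉ s k} a p := by
    intro k p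
    by_cases h : p ∈ s k <;> simp [he, h]
  have h1 : Summable (fun q : ℕ × ι => a q.2 * e q.1 q.2) := by
    rw [summable_prod_of_nonneg (fun q => mul_nonneg (h0 _) (he0 _ _))]
    have hk : ∀ k, Summable (fun p => a p * e k p) := fun k => by
      simp only [hae]; exact ha.indicator _
    refine ⟨hk, Summable.of_nonneg_of_le (fun k => tsum_nonneg fun p => mul_nonneg (h0 _) (he0 _ _))
      (fun k => ?_) (summable_geometric_of_lt_one (by norm_num) (by norm_num : (1 / 2 : ℝ) < 1))⟩
    have : ∑' p, a p * e k p = ∑' p : {x // x ∉ s k}, a p := by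
      simp only [hae]
      exact (tsum_subtype {x | x ∉ s k} a).symm
    exact this.le.trans (hs k).le
  have h2 := (summable_prod_of_nonneg (f := fun q : ι × ℕ => a q.1 * e q.2 q.1)
    (fun q => mul_nonneg (h0 _) (he0 _ _))).1
      ((Equiv.prodComm ι ℕ).summable_iff.2 h1)
  -- Where a p = 0 the inner series may diverge and the sum takes its default value 0. This is
  -- harmless: the product with a p vanishes, and such p are excluded from the finiteness claim.
  refine ⟨fun p => 1 + ∑' k, e k p, fun p => ?_, ?_, fun N => ?_⟩
  · have : 0 ≤ ∑' k, e k p := tsum_nonneg fun k => he0 k p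
    linarith
  · have := ha.add h2.2
    refine this.congr fun p => ?_
    simp only [tsum_mul_left]
    ring
  · obtain ⟨K, hK⟩ := exists_nat_gt N
    refine ((Finset.range K).biUnion s).finite_toSet.subset ?_
    rintro p ⟨hp, hd⟩
    by_contra hcon
    have hn : ∀ k ∈ Finset.range K, e k p = 1 := by
      intro k hk
      have : p ∉ s k := fun h => hcon (by
        simp only [Finset.coe_biUnion, Set.mem_iUnion]
        exact ⟨k, hk, h⟩)
      simp [he, this]
    have hsum : Summable (fun k => e k p) := by
      have := (h2.1 p).mul_left (a p)⁻¹
      refine this.congr fun k => ?_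
      rw [← mul_assoc, inv_mul_cancel₀ hp, one_mul]
    have := hsum.sum_le_tsum (Finset.range K) (fun k _ => he0 k p)
    rw [Finset.sum_congr rfl hn] at this
    simp at this
    linarith

variable {V : Type u} {W : Type v}
  [AddCommGroup V] [Module ℂ V] [Bornology V] [AddCommGroup W] [Module ℂ W] [Bornology W]

/-- A linear functional on the range of a bounded operator of finite rank yields a bounded
functional. -/
theorem isBoundedLin_comp_rangeRestrict [CompleteBornological V] (F : BLin V V)
    [FiniteDimensional ℂ (LinearMap.range F.lin)] (l : LinearMap.range F.lin →ₗ[ℂ] ℂ) :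
    IsBoundedLin (l ∘ₗ F.lin.rangeRestrict) := by
  intro B hB
  obtain ⟨E, _, _, _, i, M, hi, -, hM, h⟩ := exists_ball (F.bdd B hB)
  let E0 := (LinearMap.range F.lin).comap i
  let i0 : E0 →ₗ[ℂ] LinearMap.range F.lin :=
    (i ∘ₗ E0.subtype).codRestrict _ (fun e => e.2)
  have hi0 : Function.Injective i0 := fun e e' h =>
    Subtype.ext (hi (congrArg Subtype.val h))
  -- The preimage in the Banach space is finite-dimensional, so every linear functional on it is
  -- continuous; this is where boundedness comes from.
  have : FiniteDimensional ℂ E0 := Module.Finite.of_injective i0 hi0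
  let f : E0 →L[ℂ] ℂ := LinearMap.toContinuousLinearMap (l ∘ₗ i0)
  refine (Metric.isBounded_closedBall (x := (0 : ℂ)) (r := ‖f‖ * M)).subset ?_
  rintro _ ⟨x, hx, rfl⟩
  obtain ⟨e, he, hie⟩ := h (F x) ⟨x, hx, rfl⟩
  have hmem : e ∈ E0 := by
    change i e ∈ LinearMap.range F.lin
    rw [hie]
    exact ⟨x, rfl⟩
  have heq : (l ∘ₗ F.lin.rangeRestrict) x = f ⟨e, hmem⟩ := by
    change l _ = l (i0 ⟨e, hmem⟩)
    congr 1
    exact Subtype.ext hie.symm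
  rw [mem_closedBall_zero_iff, heq]
  exact (f.le_opNorm _).trans (mul_le_mul_of_nonneg_left he (norm_nonneg _))

/-- If all slices of `t` by bounded functionals vanish, then `(F ⊗ id) t = 0` for all bounded
operators `F` of finite rank. -/
theorem map_finiteRank_eq_zero [CompleteBornological V] [CompleteBornological W] (t : V ⊗ᵇ W)
    (h : ∀ g : BLin V ℂ, sliceL g t = 0) (F : BLin V V)
    [FiniteDimensional ℂ (LinearMap.range F.lin)] : map F (BLin.id W) t = 0 := by
  -- In a basis of the range, F = ∑ gⱼ(·) bⱼ with bounded gⱼ, hence (F ⊗ id)t = ∑ bⱼ ⊗ (gⱼ ⊗ id)t.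
  let b := Module.finBasis ℂ (LinearMap.range F.lin)
  let g : Fin _ → BLin V ℂ := fun j =>
    ⟨b.coord j ∘ₗ F.lin.rangeRestrict, isBoundedLin_comp_rangeRestrict F _⟩
  have hbd : ∀ s : Finset (Fin (Module.finrank ℂ (LinearMap.range F.lin))),
      IsBoundedLin (∑ j ∈ s,
        ((tmulL (b j : V) W).comp (sliceL (g j))).lin : V ⊗ᵇ W →ₗ[ℂ] V ⊗ᵇ W) := by
    classical
    intro s
    induction s using Finset.induction_on with
    | empty => simpa using isBoundedLin_zero
    | insert j s hj ih =>
      rw [Finset.sum_insert hj]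
      exact ((tmulL (b j : V) W).comp (sliceL (g j))).bdd.add ih
  have := LinearMap.congr_fun (tensor_ext (map F (BLin.id W)).bdd (hbd Finset.univ) (fun x y => ?_)) t
  · rw [this]
    simp only [LinearMap.sum_apply, BLin.comp_apply, h, map_zero, Finset.sum_const_zero]
  · have hx : F x = ∑ j, g j x • (b j : V) := by
      have := congrArg Subtype.val (b.sum_repr (F.lin.rangeRestrict x))
      simp only [Submodule.coe_sum, Submodule.coe_smul] at this
      exact this.symm
    simp only [map_tmul, BLin.id_apply, LinearMap.sum_apply, BLin.comp_apply, sliceL_tmul,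
      tmulL_apply, hx]
    rw [show (∑ j, g j x • (b j : V)) ⊗ₑ y = (mkBilin V W).flip y (∑ j, g j x • (b j : V)) from rfl,
      map_sum]
    refine Finset.sum_congr rfl fun j _ => ?_
    rw [map_smul, tmul_smul]
    rfl

/-- For spaces with the approximation property, elements of the completed tensor product are
determined by their slices. -/
theorem eq_zero_of_sliceL [CompleteBornological V] [CompleteBornological W]
    (hV : ApproximationProperty V) (t : V ⊗ᵇ W) (h : ∀ g : BLin V ℂ, sliceL g t = 0) : t = 0 := by
  classical
  obtain ⟨c, rfl⟩ := preMk_surj t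
  obtain ⟨B, C, hB, hC, hc⟩ := c.2
  obtain ⟨E, _, _, _, i, M, hi, hib, hM, hE⟩ := exists_ball hB
  have hsum : Summable (fun p => ‖c.1 p‖) := by
    have := lp.hasSum_norm (p := 1) (by simp) c.1
    simpa using this.summable
  obtain ⟨d, hd1, hds, hdf⟩ := exists_weight (fun p => ‖c.1 p‖) hsum (fun p => norm_nonneg _)
  have hd0 : ∀ p, d p ≠ 0 := fun p => (zero_lt_one.trans_le (hd1 p)).ne'
  have hx : ∀ p : V × W, ∃ e : E, ‖e‖ ≤ M ∧ (c.1 p ≠ 0 → i e = p.1) := by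
    intro p
    by_cases hp : c.1 p = 0
    · exact ⟨0, by simpa using hM, fun h => (h hp).elim⟩
    · obtain ⟨e, he, hie⟩ := hE p.1 (hc p hp).1
      exact ⟨e, he, fun _ => hie⟩
  choose e heM hei using hx
  -- Dividing the first entries of the sum by the weights gives a family tending to 0, hence a
  -- compact set once 0 is added. The weights stay absorbed in the coefficients, which remain
  -- summable.
  let f : V × W → E := fun p => if c.1 p = 0 then 0 else ((d p : ℂ))⁻¹ • e p
  have hf : Filter.Tendsto f Filter.cofinite (nhds 0) := by
    rw [Metric.tendsto_nhds]
    intro r hr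
    refine ((hdf (M / r)).subset ?_)
    intro p hp
    by_cases h0 : c.1 p = 0
    · simp [f, h0, hr] at hp
    · refine ⟨by simpa using h0, ?_⟩
      have hdp : 0 < d p := zero_lt_one.trans_le (hd1 p)
      simp only [Set.mem_compl_iff, Set.mem_ofPred_eq, dist_zero_right, not_lt, f, if_neg h0,
        norm_smul, norm_inv, Complex.norm_real, Real.norm_of_nonneg hdp.le] at hp
      rw [le_div_iff₀ hr]
      rw [le_inv_mul_iff₀ hdp] at hp
      linarith [heM p]
  have hK : IsBornCompact (i '' insert 0 (Set.range f)) :=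
    ⟨E, inferInstance, inferInstance, inferInstance, i, _, hi, hib, hf.isCompact_insert_range_of_cofinite, rfl⟩
  obtain ⟨T, hT, hTF⟩ := hV _ hK
  -- This Banach space depends only on the error set T and on C, not on the accuracy r; all
  -- estimates below take place in it.
  obtain ⟨G, _, _, _, k, N, hk, hkb, hN, hG⟩ := exists_ball (mkBilin_bdd T C hT hC)
  obtain ⟨E', _, _, _, i', s, M', hi', hib', hs, hsv, ht⟩ :=
    preLift_isVal (mkBilin V W) mkBilin_bdd c
  set t := preMk V W c with htdef
  have hti : t = i' (∑' p, c.1 p • s p) := by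
    rw [← ht, ← lift_preMk]
    exact BLin.eq_of_tmul (BLin.id _) (lift (mkBilin V W) mkBilin_bdd) (fun x y => by simp) _
  set A := ∑' p, ‖c.1 p‖ * d p
  -- For a finite rank F with error r on the compact set, (F ⊗ id)t = 0, so t = ((id − F) ⊗ id)t.
  -- Each term of this last sum has size at most r times its weighted coefficient.
  have key : ∀ r : ℝ, 0 < r → ∃ g : G, ‖g‖ ≤ r * (A * N) ∧ k g = t := by
    intro r hr
    obtain ⟨F, hF, hFK⟩ := hTF r hr
    have hFt := map_finiteRank_eq_zero t h F
    let P : BLin V V := ⟨LinearMap.id + (-1 : ℂ) • F.lin, isBoundedLin_id.add (F.bdd.smul _)⟩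
    have hP : map P (BLin.id W) t = t := by
      have := BLin.eq_of_tmul (map P (BLin.id W)) ⟨LinearMap.id + (-1 : ℂ) •
        (map F (BLin.id W)).lin, isBoundedLin_id.add ((map F (BLin.id W)).bdd.smul _)⟩
        (fun x y => by
          simp only [map_tmul, BLin.id_apply, P, LinearMap.add_apply, LinearMap.smul_apply,
            LinearMap.id_apply]
          rw [add_tmul, smul_tmul]) t
      rw [this]
      simp [hFt]
    have hg : ∀ p, ∃ g : G, ‖g‖ ≤ N ∧ (c.1 p ≠ 0 →
        map P (BLin.id W) (p.1 ⊗ₑ p.2) = ((r * d p : ℝ) : ℂ) • k g) := by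
      intro p
      by_cases hp : c.1 p = 0
      · exact ⟨0, by simpa using hN, fun h => (h hp).elim⟩
      · obtain ⟨y, hy, hyF⟩ := hFK (i (f p)) ⟨_, Or.inr ⟨p, rfl⟩, rfl⟩
        obtain ⟨g, hg, hkg⟩ := hG _ ⟨y, hy, p.2, (hc p hp).2, rfl⟩
        refine ⟨g, hg, fun _ => ?_⟩
        have hdc : ((d p : ℝ) : ℂ) ≠ 0 := by exact_mod_cast hd0 p
        have h1 : p.1 = (d p : ℂ) • i (f p) := by
          simp only [f, if_neg hp, map_smul, hei p hp, smul_smul, mul_inv_cancel₀ hdc, one_smul]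
        have h2 : P p.1 = ((r * d p : ℝ) : ℂ) • y := by
          have : P p.1 = (d p : ℂ) • (i (f p) - F (i (f p))) := by
            conv_lhs => rw [h1]
            rw [map_smul]
            simp [P, sub_eq_add_neg]
          rw [this, hyF, smul_smul]
          push_cast
          rw [mul_comm]
        rw [map_tmul, h2, hkg, BLin.id_apply, smul_tmul]
        rfl
    choose g hgN hgP using hg
    -- The sum representing t and the new estimate live in different Banach spaces; a common one is
    -- needed to compare them term by term.
    obtain ⟨G', _, _, _, k', j, R, hk', -, hj, -, hR⟩ := exists_factor_of_bounded
      ((map P (BLin.id W)).lin ∘ₗ i') ((map P (BLin.id W)).bdd.comp hib') _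
      (hkb _ (Metric.isBounded_closedBall (x := (0 : G)) (r := 1)))
    obtain ⟨j', hj'⟩ := exists_factor k k' hk' R
      (fun x hx => hR _ ⟨x, by simpa using hx, rfl⟩)
    have hle : ∀ p, ‖(c.1 p * (d p : ℂ)) • g p‖ ≤ ‖c.1 p‖ * d p * N := by
      intro p
      rw [norm_smul, norm_mul, Complex.norm_real, Real.norm_of_nonneg (zero_le_one.trans (hd1 p))]
      exact mul_le_mul_of_nonneg_left (hgN p)
        (mul_nonneg (norm_nonneg _) (zero_le_one.trans (hd1 p)))
    have hsg : Summable (fun p => (c.1 p * (d p : ℂ)) • g p) :=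
      Summable.of_norm_bounded (hds.mul_right N) hle
    refine ⟨(r : ℂ) • ∑' p, (c.1 p * (d p : ℂ)) • g p, ?_, ?_⟩
    · rw [norm_smul, Complex.norm_real, Real.norm_of_nonneg hr.le]
      refine mul_le_mul_of_nonneg_left ?_ hr.le
      exact tsum_of_norm_bounded (hds.hasSum.mul_right N) hle
    · rw [← hj', map_smul, j'.map_tsum hsg, ← tsum_const_smul'']
      have : ∀ p, (r : ℂ) • j' ((c.1 p * (d p : ℂ)) • g p) = j (c.1 p • s p) := by
        intro p
        by_cases hp : c.1 p = 0
        · simp [hp]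
        · apply hk'
          rw [map_smul, map_smul, map_smul, map_smul, hj', map_smul, hj]
          simp only [LinearMap.comp_apply]
          rw [hsv p hp, mkBilin_apply, hgP p hp, smul_smul, smul_smul]
          push_cast
          congr 1
          ring
      simp only [this]
      rw [← j.map_tsum (summable_family c s M' hs).1, hj]
      simp only [LinearMap.comp_apply]
      rw [← hti, hP]
  -- By injectivity of k all representatives of t in G coincide, so this one has norm at most r · A
  -- · N for every r > 0.
  obtain ⟨g1, -, hg1⟩ := key 1 one_pos
  have hzero : ‖g1‖ ≤ 0 := by
    have hAN : 0 ≤ A * N := mul_nonneg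
      (tsum_nonneg fun p => mul_nonneg (norm_nonneg _) (zero_le_one.trans (hd1 p))) hN
    refine le_of_forall_pos_le_add fun r hr => ?_
    obtain ⟨g, hg, hkg⟩ := key (r / (A * N + 1)) (by positivity)
    rw [hk (hg1.trans hkg.symm), zero_add]
    refine hg.trans ?_
    rw [div_mul_eq_mul_div, div_le_iff₀ (by positivity)]
    nlinarith
  rw [← hg1, norm_le_zero_iff.1 hzero, map_zero]

/-- Slices in the second variable by a separating family of functionals determine an element of
the tensor product. -/
theorem eq_zero_of_sliceR_separating [CompleteBornological V] [CompleteBornological W]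
    (hV : ApproximationProperty V) {ι : Type*} (f : ι → BLin W ℂ)
    (hf : ∀ x, (∀ i, f i x = 0) → x = 0) (t : V ⊗ᵇ W) (h : ∀ i, sliceR (f i) t = 0) : t = 0 :=
  eq_zero_of_sliceL hV t fun g => hf _ fun i => by rw [← apply_sliceR, h, map_zero]

/-- Slices in the first variable by a separating family of functionals determine an element of
the tensor product. -/
theorem eq_zero_of_sliceL_separating [CompleteBornological V] [CompleteBornological W]
    (hW : ApproximationProperty W) {ι : Type*} (f : ι → BLin V ℂ)
    (hf : ∀ x, (∀ i, f i x = 0) → x = 0) (t : V ⊗ᵇ W) (h : ∀ i, sliceL (f i) t = 0) : t = 0 := by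
  have : swap V W t = 0 := eq_zero_of_sliceL hW _ fun g => hf _ fun i => by
    rw [sliceL_swap, apply_sliceR, h, map_zero]
  rw [← swap_swap t, this, map_zero]

end separation

end BornQG

end

noncomputable section

namespace BornQG

/-! ### Slicing one leg of a triple tensor product. -/

section assoc

variable {V : Type u} {W : Type v} {X : Type w}
  [AddCommGroup V] [Module ℂ V] [Bornology V] [AddCommGroup W] [Module ℂ W] [Bornology W]
  [AddCommGroup X] [Module ℂ X] [Bornology X]

/-- Bounded linear maps on a triple tensor product agree if they agree on elementary tensors. -/
theorem BLin.eq_of_tmul₃ {Y : Type z} [AddCommGroup Y] [Module ℂ Y] [Bornology Y]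
    [CompleteBornological Y] (f g : BLin ((V ⊗ᵇ W) ⊗ᵇ X) Y)
    (h : ∀ x y c, f ((x ⊗ₑ y) ⊗ₑ c) = g ((x ⊗ₑ y) ⊗ₑ c)) (t) : f t = g t :=
  BLin.eq_of_tmul f g (fun u c => BLin.eq_of_tmul (f.comp (tmulR _ c)) (g.comp (tmulR _ c))
    (fun x y => h x y c) u) t

theorem map_id_sliceR_assoc [CompleteBornological W] (om : BLin X ℂ) (t : (V ⊗ᵇ W) ⊗ᵇ X) :
    map (BLin.id V) (sliceR om) (assoc V W X t) = sliceR om t :=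
  BLin.eq_of_tmul₃ ((map (BLin.id V) (sliceR om)).comp (assoc V W X)) (sliceR om)
    (fun x y c => by simp [tmul_smul]) t

theorem sliceL_assoc [CompleteBornological W] (om : BLin V ℂ) (t : (V ⊗ᵇ W) ⊗ᵇ X) :
    sliceL om (assoc V W X t) = map (sliceL om) (BLin.id X) t :=
  BLin.eq_of_tmul₃ ((sliceL om).comp (assoc V W X)) (map (sliceL om) (BLin.id X))
    (fun x y c => by simp [smul_tmul]) t

theorem map_id_sliceL_assoc [CompleteBornological V]
    [CompleteBornological X] (om : BLin W ℂ) (t : (V ⊗ᵇ W) ⊗ᵇ X) :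
    map (BLin.id V) (sliceL om) (assoc V W X t) = map (sliceR om) (BLin.id X) t :=
  BLin.eq_of_tmul₃ ((map (BLin.id V) (sliceL om)).comp (assoc V W X))
    (map (sliceR om) (BLin.id X)) (fun x y c => by simp [smul_tmul, tmul_smul]) t

end assoc

/-! ### One-sided multiplication operators and the two actions of a multiplier. -/

section mul

variable {A : Type u} [NonUnitalNonAssocRing A] [Module ℂ A] [SMulCommClass ℂ A A]
  [IsScalarTower ℂ A A] [Bornology A] [BornologicalAlgebra A]

/-- Right multiplication by `a`. -/
def mulR (a : A) : BLin A A := ⟨(LinearMap.mul ℂ A).flip a, BornologicalAlgebra.mul_bdd.right a⟩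

@[simp] theorem mulR_apply (a b : A) : (mulR a).lin b = b * a := rfl

theorem mul_tmul (t : A ⊗ᵇ A) (a b : A) : t * (a ⊗ₑ b) = map (mulR a) (mulR b) t :=
  BLin.eq_of_tmul (lift _ (tensorMulBilin_bdd (a ⊗ₑ b))) (map (mulR a) (mulR b))
    (fun x y => (tmul_mul_tmul x a y b).trans (by simp)) t

@[simp] theorem mulMap_tmul (x y : A) : (mulMap A).lin (x ⊗ₑ y) = x * y := lift_tmul _ _ x y

theorem map_mulL_mulR_id {B : Type v} [AddCommGroup B] [Module ℂ B] [Bornology B]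
    {R : Type z} [NonUnitalRing R] [Module ℂ R] [SMulCommClass ℂ R R]
    [IsScalarTower ℂ R R] [Bornology R] [BornologicalAlgebra R] (a p : R) (t : R ⊗ᵇ B) :
    map (mulL a) (BLin.id B) (map (mulR p) (BLin.id B) t) =
      map (mulR p) (BLin.id B) (map (mulL a) (BLin.id B) t) := by
  rw [map_map, map_map]
  exact map_congr (fun y => by simp [mul_assoc]) (fun _ => rfl) _

theorem map_id_mulL_mulR {B : Type v} [AddCommGroup B] [Module ℂ B] [Bornology B]
    {R : Type z} [NonUnitalRing R] [Module ℂ R] [SMulCommClass ℂ R R]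
    [IsScalarTower ℂ R R] [Bornology R] [BornologicalAlgebra R] (a p : R) (t : B ⊗ᵇ R) :
    map (BLin.id B) (mulL a) (map (BLin.id B) (mulR p) t) =
      map (BLin.id B) (mulR p) (map (BLin.id B) (mulL a) t) := by
  rw [map_map, map_map]
  exact map_congr (fun _ => rfl) (fun y => by simp [mul_assoc]) _

/-- The left action of a multiplier as a bounded map. -/
def Mult.bL (m : Mult A) : BLin A A := ⟨m.L, m.2.1⟩

/-- The right action of a multiplier as a bounded map. -/
def Mult.bR (m : Mult A) : BLin A A := ⟨m.R, m.2.2.1⟩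

@[simp] theorem Mult.bL_apply (m : Mult A) (a : A) : m.bL.lin a = m.L a := rfl

@[simp] theorem Mult.bR_apply (m : Mult A) (a : A) : m.bR.lin a = m.R a := rfl

theorem Mult.L_mul (m : Mult A) (a b : A) : m.L (a * b) = m.L a * b := m.2.2.2.1 a b

theorem Mult.R_mul (m : Mult A) (a b : A) : m.R (a * b) = a * m.R b := m.2.2.2.2.1 a b

theorem Mult.mul_L (m : Mult A) (a b : A) : a * m.L b = m.R a * b := m.2.2.2.2.2 a b

end mul

namespace BornologicalQuantumGroup

variable {H : Type u} [NonUnitalRing H] [Module ℂ H] [SMulCommClass ℂ H H] [IsScalarTower ℂ H H]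
  [Bornology H] [BornologicalAlgebra H] (Q : BornologicalQuantumGroup H)

/-! ### Nondegeneracy -/

theorem eq_of_mul_right (Q : BornologicalQuantumGroup H) {x y : H}
    (h : ∀ b, x * b = y * b) : x = y := by
  rw [← sub_eq_zero]
  refine Q.haar_leftHaar.1.1 _ fun b => ?_
  rw [sub_mul, h, sub_self, map_zero]

theorem eq_of_mul_left (Q : BornologicalQuantumGroup H) {x y : H}
    (h : ∀ b, b * x = b * y) : x = y := by
  rw [← sub_eq_zero]
  refine Q.haar_leftHaar.1.2 _ fun b => ?_
  rw [mul_sub, h, sub_self, map_zero]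

theorem eq_of_haar_mul_right {x y : H} (h : ∀ b, Q.haar (x * b) = Q.haar (y * b)) : x = y := by
  rw [← sub_eq_zero]
  refine Q.haar_leftHaar.1.1 _ fun b => ?_
  rw [sub_mul, map_sub, h, sub_self]

theorem eq_of_haar_mul_left {x y : H} (h : ∀ b, Q.haar (b * x) = Q.haar (b * y)) : x = y := by
  rw [← sub_eq_zero]
  refine Q.haar_leftHaar.1.2 _ fun b => ?_
  rw [mul_sub, map_sub, h, sub_self]

/-- Faithfulness of φ makes the functionals φ(· k) separate points of H, and the approximation
property lifts this to H ⊗ H. -/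
theorem eq_of_sliceL_mulR {s t : H ⊗ᵇ H}
    (h : ∀ k, sliceL (Q.haar.comp (mulR k)) s = sliceL (Q.haar.comp (mulR k)) t) : s = t := by
  rw [← sub_eq_zero]
  refine eq_zero_of_sliceL_separating Q.approximation (fun k => Q.haar.comp (mulR k))
    Q.haar_leftHaar.1.1 _ fun k => ?_
  rw [map_sub, h, sub_self]

theorem eq_of_sliceL_mulL {s t : H ⊗ᵇ H}
    (h : ∀ k, sliceL (Q.haar.comp (mulL k)) s = sliceL (Q.haar.comp (mulL k)) t) : s = t := by
  rw [← sub_eq_zero]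
  refine eq_zero_of_sliceL_separating Q.approximation (fun k => Q.haar.comp (mulL k))
    Q.haar_leftHaar.1.2 _ fun k => ?_
  rw [map_sub, h, sub_self]

theorem eq_of_sliceR_mulR {s t : H ⊗ᵇ H}
    (h : ∀ k, sliceR (Q.haar.comp (mulR k)) s = sliceR (Q.haar.comp (mulR k)) t) : s = t := by
  rw [← sub_eq_zero]
  refine eq_zero_of_sliceR_separating Q.approximation (fun k => Q.haar.comp (mulR k))
    Q.haar_leftHaar.1.1 _ fun k => ?_
  rw [map_sub, h, sub_self]

theorem eq_of_sliceR_mulL {s t : H ⊗ᵇ H}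
    (h : ∀ k, sliceR (Q.haar.comp (mulL k)) s = sliceR (Q.haar.comp (mulL k)) t) : s = t := by
  rw [← sub_eq_zero]
  refine eq_zero_of_sliceR_separating Q.approximation (fun k => Q.haar.comp (mulL k))
    Q.haar_leftHaar.1.2 _ fun k => ?_
  rw [map_sub, h, sub_self]

/-- A slice by φ(a ·) sees only (a ⊗ 1)s. This lemma and its three variants allow cancelling a
leg-wise factor, in place of multiplying by 1. -/
theorem eq_of_map_mulL_id (Q : BornologicalQuantumGroup H) {s t : H ⊗ᵇ H}
    (h : ∀ a, map (mulL a) (BLin.id H) s = map (mulL a) (BLin.id H) t) : s = t :=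
  Q.eq_of_sliceL_mulL fun k => by
    simpa only [sliceL_map, BLin.id_apply] using congrArg (sliceL Q.haar).lin (h k)

theorem eq_of_map_mulR_id (Q : BornologicalQuantumGroup H) {s t : H ⊗ᵇ H}
    (h : ∀ a, map (mulR a) (BLin.id H) s = map (mulR a) (BLin.id H) t) : s = t :=
  Q.eq_of_sliceL_mulR fun k => by
    simpa only [sliceL_map, BLin.id_apply] using congrArg (sliceL Q.haar).lin (h k)

theorem eq_of_map_id_mulL (Q : BornologicalQuantumGroup H) {s t : H ⊗ᵇ H}
    (h : ∀ a, map (BLin.id H) (mulL a) s = map (BLin.id H) (mulL a) t) : s = t :=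
  Q.eq_of_sliceR_mulL fun k => by
    simpa only [sliceR_map, BLin.id_apply] using congrArg (sliceR Q.haar).lin (h k)

theorem eq_of_map_id_mulR (Q : BornologicalQuantumGroup H) {s t : H ⊗ᵇ H}
    (h : ∀ a, map (BLin.id H) (mulR a) s = map (BLin.id H) (mulR a) t) : s = t :=
  Q.eq_of_sliceR_mulR fun k => by
    simpa only [sliceR_map, BLin.id_apply] using congrArg (sliceR Q.haar).lin (h k)

theorem eq_of_mul_tmul (Q : BornologicalQuantumGroup H) {s t : H ⊗ᵇ H}
    (h : ∀ a b, s * (a ⊗ₑ b) = t * (a ⊗ₑ b)) : s = t := by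
  refine Q.eq_of_map_mulR_id fun a => Q.eq_of_map_id_mulR fun b => ?_
  simpa only [map_map, BLin.id_comp, BLin.comp_id, mul_tmul] using h a b

theorem eq_of_tmul_mul (Q : BornologicalQuantumGroup H) {s t : H ⊗ᵇ H}
    (h : ∀ a b, (a ⊗ₑ b) * s = (a ⊗ₑ b) * t) : s = t := by
  refine Q.eq_of_map_mulL_id fun a => Q.eq_of_map_id_mulL fun b => ?_
  simpa only [map_map, BLin.id_comp, BLin.comp_id, tmul_mul] using h a b

theorem eq_gammaL {x y : H} {t : H ⊗ᵇ H} (h : IsGammaL Q.comul x y t) : t = Q.gammaL (x ⊗ₑ y) :=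
  Q.eq_of_mul_tmul fun a b => (h a b).trans (Q.gammaL_spec x y a b).symm

theorem eq_gammaR {x y : H} {t : H ⊗ᵇ H} (h : IsGammaR Q.comul x y t) : t = Q.gammaR (x ⊗ₑ y) :=
  Q.eq_of_mul_tmul fun a b => (h a b).trans (Q.gammaR_spec x y a b).symm

theorem eq_rhoR {x y : H} {t : H ⊗ᵇ H} (h : IsRhoR Q.comul x y t) : t = Q.rhoR (x ⊗ₑ y) :=
  Q.eq_of_tmul_mul fun a b => (h a b).trans (Q.rhoR_spec x y a b).symm

/-! ### Relations between the Galois maps -/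

theorem comul_mul_L (x y : H) (t : H ⊗ᵇ H) :
    (Q.comul (x * y)).L t = (Q.comul x).L ((Q.comul y).L t) := by
  rw [map_mul]; rfl

theorem comul_mul_R (x y : H) (t : H ⊗ᵇ H) :
    (Q.comul (x * y)).R t = (Q.comul y).R ((Q.comul x).R t) := by
  rw [map_mul]; rfl

/-- Here p ⊗ q is split as (1 ⊗ q)(p ⊗ 1). Comparing this with the other splittings of one-sided
products with Δ(x) yields the relations between the four Galois maps. -/
theorem comul_L_tmul_gammaR (x p q : H) :
    (Q.comul x).L (p ⊗ₑ q) = map (mulR p) (BLin.id H) (Q.gammaR (x ⊗ₑ q)) := by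
  refine Q.eq_of_mul_tmul fun a b => ?_
  rw [← Mult.L_mul, tmul_mul_tmul, ← Q.gammaR_spec x q, mul_tmul, mul_tmul, map_map]
  exact map_congr (fun x => by simp [mul_assoc]) (fun _ => rfl) _

theorem comul_L_tmul_gammaL (x p q : H) :
    (Q.comul x).L (p ⊗ₑ q) = map (BLin.id H) (mulR q) (Q.gammaL (x ⊗ₑ p)) := by
  refine Q.eq_of_mul_tmul fun a b => ?_
  rw [← Mult.L_mul, tmul_mul_tmul, ← Q.gammaL_spec x p, mul_tmul, mul_tmul, map_map]
  exact map_congr (fun _ => rfl) (fun x => by simp [mul_assoc]) _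

theorem comul_R_tmul_rhoR (x p q : H) :
    (Q.comul x).R (p ⊗ₑ q) = map (mulL p) (BLin.id H) (Q.rhoR (q ⊗ₑ x)) := by
  refine Q.eq_of_tmul_mul fun a b => ?_
  rw [← Mult.R_mul, tmul_mul_tmul, ← Q.rhoR_spec q x, tmul_mul, tmul_mul, map_map]
  exact map_congr (fun x => by simp [mul_assoc]) (fun _ => rfl) _

theorem comul_R_tmul_rhoL (x p q : H) :
    (Q.comul x).R (p ⊗ₑ q) = map (BLin.id H) (mulL q) (Q.rhoL (p ⊗ₑ x)) := by
  refine Q.eq_of_tmul_mul fun a b => ?_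
  rw [← Mult.R_mul, tmul_mul_tmul, ← Q.rhoL_spec p x, tmul_mul, tmul_mul, map_map]
  exact map_congr (fun _ => rfl) (fun x => by simp [mul_assoc]) _

theorem gammaR_mul_left (x y q : H) :
    Q.gammaR ((x * y) ⊗ₑ q) = (Q.comul x).L (Q.gammaR (y ⊗ₑ q)) := by
  refine Q.eq_of_mul_tmul fun a b => ?_
  rw [Q.gammaR_spec (x * y) q, comul_mul_L, ← Q.gammaR_spec y q, Mult.L_mul]

theorem gammaL_mul_left (x y q : H) :
    Q.gammaL ((x * y) ⊗ₑ q) = (Q.comul x).L (Q.gammaL (y ⊗ₑ q)) := by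
  refine Q.eq_of_mul_tmul fun a b => ?_
  rw [Q.gammaL_spec (x * y) q, comul_mul_L, ← Q.gammaL_spec y q, Mult.L_mul]

theorem rhoR_mul_right (b x y : H) :
    Q.rhoR (b ⊗ₑ (x * y)) = (Q.comul y).R (Q.rhoR (b ⊗ₑ x)) := by
  refine Q.eq_of_tmul_mul fun p q => ?_
  rw [Q.rhoR_spec b (x * y), comul_mul_R, ← Q.rhoR_spec b x, Mult.R_mul]

theorem map_mulR_gammaR (x p q : H) : map (mulR p) (BLin.id H) (Q.gammaR (x ⊗ₑ q)) =
    map (BLin.id H) (mulR q) (Q.gammaL (x ⊗ₑ p)) := by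
  rw [← comul_L_tmul_gammaR, comul_L_tmul_gammaL]

theorem map_mulL_rhoR (x p q : H) : map (mulL p) (BLin.id H) (Q.rhoR (q ⊗ₑ x)) =
    map (BLin.id H) (mulL q) (Q.rhoL (p ⊗ₑ x)) := by
  rw [← comul_R_tmul_rhoR, comul_R_tmul_rhoL]

theorem gammaR_mul_right (x q b : H) :
    Q.gammaR (x ⊗ₑ (q * b)) = map (BLin.id H) (mulR b) (Q.gammaR (x ⊗ₑ q)) := by
  refine Q.eq_of_map_mulR_id fun p => ?_
  rw [map_mulR_gammaR, ← map_id_comm, map_mulR_gammaR, map_map]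
  exact map_congr (fun _ => rfl) (fun x => by simp [mul_assoc]) _

/-- The two ways to multiply `Δ(x)` by elementary tensors from both sides agree. -/
theorem map_mulL_comul_L (x e f c d : H) :
    map (mulL e) (mulL f) ((Q.comul x).L (c ⊗ₑ d)) =
      map (mulR c) (mulR d) ((Q.comul x).R (e ⊗ₑ f)) := by
  rw [← tmul_mul, ← mul_tmul, Mult.mul_L]

/-- Associativity of (a ⊗ 1)Δ(x)(p ⊗ 1). Extra factors f and d in the second leg complete both sides
to products with Δ(x) inside H ⊗ H, and are then cancelled. -/
theorem map_mulL_gammaL (a x p : H) : map (mulL a) (BLin.id H) (Q.gammaL (x ⊗ₑ p)) =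
    map (mulR p) (BLin.id H) (Q.rhoL (a ⊗ₑ x)) := by
  refine Q.eq_of_map_id_mulL fun f => Q.eq_of_map_id_mulR fun d => ?_
  have := Q.map_mulL_comul_L x a f p d
  rw [comul_L_tmul_gammaL, comul_R_tmul_rhoL, map_map, map_map] at this
  rw [map_map, map_map, map_map, map_map]
  refine (map_congr (fun _ => rfl) (fun y => ?_) _).trans
    (this.trans (map_congr (fun _ => rfl) (fun y => ?_) _)) <;> simp [mul_assoc]

theorem map_mulL_gammaR (a x q : H) : map (mulL a) (BLin.id H) (Q.gammaR (x ⊗ₑ q)) =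
    map (BLin.id H) (mulR q) (Q.rhoL (a ⊗ₑ x)) := by
  refine Q.eq_of_map_mulR_id fun p => ?_
  rw [← map_mulL_mulR_id, map_mulR_gammaR, ← map_id_comm, map_mulL_gammaL, map_id_comm]

theorem map_mulL_gammaL' (b x p : H) : map (BLin.id H) (mulL b) (Q.gammaL (x ⊗ₑ p)) =
    map (mulR p) (BLin.id H) (Q.rhoR (b ⊗ₑ x)) := by
  refine Q.eq_of_map_mulL_id fun a => ?_
  rw [← map_id_comm, map_mulL_gammaL, map_mulL_mulR_id, map_mulL_rhoR, map_id_comm]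

theorem map_mulL_gammaR' (b x q : H) : map (BLin.id H) (mulL b) (Q.gammaR (x ⊗ₑ q)) =
    map (BLin.id H) (mulR q) (Q.rhoR (b ⊗ₑ x)) := by
  refine Q.eq_of_map_mulL_id fun a => ?_
  rw [← map_id_comm, map_mulL_gammaR, ← map_id_comm, map_mulL_rhoR, map_id_mulL_mulR]

/-! ### Slices of the comultiplication -/

/-- The operator `y ↦ (id ⊗ θ)(Δ(y)(1 ⊗ z))`. -/
def rslice (θ : BLin H ℂ) (z : H) : BLin H H := (sliceR θ).comp (Q.gammaR.toBLin.comp (tmulR H z))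

/-- The operator `y ↦ (θ ⊗ id)(Δ(y)(z ⊗ 1))`. -/
def lslice (θ : BLin H ℂ) (z : H) : BLin H H := (sliceL θ).comp (Q.gammaL.toBLin.comp (tmulR H z))

theorem rslice_apply (θ : BLin H ℂ) (z y : H) :
    Q.rslice θ z y = sliceR θ (Q.gammaR (y ⊗ₑ z)) := rfl

theorem lslice_apply (θ : BLin H ℂ) (z y : H) :
    Q.lslice θ z y = sliceL θ (Q.gammaL (y ⊗ₑ z)) := rfl

/-- The slice is the element (id ⊗ θ(· z))Δ(y), so its products on the right can be read off from
γ_l, and those on the left from ρ_l. -/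
theorem rslice_mul (θ : BLin H ℂ) (z y b : H) :
    Q.rslice θ z y * b = sliceR (θ.comp (mulR z)) (Q.gammaL (y ⊗ₑ b)) := by
  have := congrArg (sliceR θ).lin (Q.map_mulR_gammaR y b z)
  rwa [sliceR_map, sliceR_map, BLin.comp_id, BLin.id_apply] at this

theorem mul_rslice (θ : BLin H ℂ) (z y a : H) :
    a * Q.rslice θ z y = sliceR (θ.comp (mulR z)) (Q.rhoL (a ⊗ₑ y)) := by
  have := congrArg (sliceR θ).lin (Q.map_mulL_gammaR a y z)
  rwa [sliceR_map, sliceR_map, BLin.comp_id, BLin.id_apply] at this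

theorem lslice_mul (θ : BLin H ℂ) (z y b : H) :
    Q.lslice θ z y * b = sliceL (θ.comp (mulR z)) (Q.gammaR (y ⊗ₑ b)) := by
  have := congrArg (sliceL θ).lin (Q.map_mulR_gammaR y z b)
  rw [sliceL_map, sliceL_map, BLin.comp_id, BLin.id_apply] at this
  exact this.symm

theorem mul_lslice (θ : BLin H ℂ) (z y a : H) :
    a * Q.lslice θ z y = sliceL (θ.comp (mulR z)) (Q.rhoR (a ⊗ₑ y)) := by
  have := congrArg (sliceL θ).lin (Q.map_mulL_gammaL' a y z)
  rwa [sliceL_map, sliceL_map, BLin.comp_id, BLin.id_apply] at this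

theorem sliceR_comul_L (θ : BLin H ℂ) (x p q : H) :
    sliceR θ ((Q.comul x).L (p ⊗ₑ q)) = Q.rslice θ q x * p := by
  rw [comul_L_tmul_gammaR, sliceR_map]
  rfl

theorem sliceL_comul_L (θ : BLin H ℂ) (x p q : H) :
    sliceL θ ((Q.comul x).L (p ⊗ₑ q)) = Q.lslice θ p x * q := by
  rw [comul_L_tmul_gammaL, sliceL_map]
  rfl

theorem sliceL_comul_R (θ : BLin H ℂ) (x p q : H) :
    sliceL θ ((Q.comul x).R (p ⊗ₑ q)) = q * sliceL θ (Q.rhoL (p ⊗ₑ x)) := by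
  rw [comul_R_tmul_rhoL, sliceL_map]
  rfl

/-! ### Coassociativity -/

/-- Coassociativity with its third leg sliced by θ: right slices pass through Δ in the second leg.
-/
theorem map_rslice_rhoL (θ : BLin H ℂ) (x y z : H) :
    map (BLin.id H) (Q.rslice θ z) (Q.rhoL (x ⊗ₑ y)) = Q.rhoL (x ⊗ₑ Q.rslice θ z y) := by
  have := congrArg (map (BLin.id H) (sliceR θ)).lin (Q.coassoc x y z)
  rw [map_id_sliceR_assoc, sliceR_map, map_map] at this
  exact this.symm

theorem map_rslice_gammaL (θ : BLin H ℂ) (y p z : H) :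
    map (BLin.id H) (Q.rslice θ z) (Q.gammaL (y ⊗ₑ p)) = Q.gammaL (Q.rslice θ z y ⊗ₑ p) := by
  refine Q.eq_of_map_mulL_id fun a => ?_
  rw [map_mulL_gammaL, ← map_rslice_rhoL, ← map_id_comm, map_mulL_gammaL, map_id_comm]

/-- The operator `y ↦ (θ ⊗ id)((x ⊗ 1)Δ(y))`. -/
def lsliceRho (θ : BLin H ℂ) (x : H) : BLin H H :=
  (sliceL θ).comp (Q.rhoL.toBLin.comp (tmulL x H))

theorem lsliceRho_apply (θ : BLin H ℂ) (x y : H) :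
    Q.lsliceRho θ x y = sliceL θ (Q.rhoL (x ⊗ₑ y)) := rfl

theorem map_lsliceRho_gammaR (θ : BLin H ℂ) (x y z : H) :
    map (Q.lsliceRho θ x) (BLin.id H) (Q.gammaR (y ⊗ₑ z)) =
      Q.gammaR (Q.lsliceRho θ x y ⊗ₑ z) := by
  have := congrArg (sliceL θ).lin (Q.coassoc x y z)
  rw [sliceL_assoc, sliceL_map, map_map] at this
  exact this

/-- The two operators use up opposite outer legs of the iterated comultiplication. -/
theorem rslice_lslice_comm (θ η : BLin H ℂ) (z w y : H) :
    Q.rslice θ z (Q.lslice η w y) = Q.lslice η w (Q.rslice θ z y) := by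
  rw [Q.lslice_apply η w (Q.rslice θ z y), ← map_rslice_gammaL, sliceL_map]
  rfl

theorem rslice_lsliceRho_comm (θ η : BLin H ℂ) (z w y : H) :
    Q.rslice θ z (Q.lsliceRho η w y) = Q.lsliceRho η w (Q.rslice θ z y) := by
  rw [Q.lsliceRho_apply η w (Q.rslice θ z y), ← map_rslice_rhoL, sliceL_map]
  rfl

/-- Coassociativity with its middle leg sliced; for a character this becomes (R ⊗ id)Δ = (id ⊗ L)Δ.
-/
theorem map_sliceR_rhoL_gammaR (θ : BLin H ℂ) (x y z : H) :
    map ((sliceR θ).comp (Q.rhoL.toBLin.comp (tmulL x H))) (BLin.id H) (Q.gammaR (y ⊗ₑ z)) =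
      map (BLin.id H) ((sliceL θ).comp (Q.gammaR.toBLin.comp (tmulR H z))) (Q.rhoL (x ⊗ₑ y)) := by
  have := congrArg (map (BLin.id H) (sliceL θ)).lin (Q.coassoc x y z)
  rw [map_id_sliceL_assoc, map_map, map_map] at this
  exact this

end BornologicalQuantumGroup

end BornQG

end

noncomputable section

namespace BornQG

/-! ### Inverse associativity and multiplication into the first leg. -/

section assocInv

variable {V : Type u} {W : Type v} {X : Type w}
  [AddCommGroup V] [Module ℂ V] [Bornology V] [AddCommGroup W] [Module ℂ W] [Bornology W]
  [AddCommGroup X] [Module ℂ X] [Bornology X]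

variable (V W X) in
/-- The associativity map `V ⊗ (W ⊗ X) → (V ⊗ W) ⊗ X`. -/
def assocInv : BLin (V ⊗ᵇ (W ⊗ᵇ X)) ((V ⊗ᵇ W) ⊗ᵇ X) :=
  (map (swap W V) (BLin.id X)).comp ((swap X (W ⊗ᵇ V)).comp ((assoc X W V).comp
    ((map (swap W X) (BLin.id V)).comp (swap V (W ⊗ᵇ X)))))

@[simp] theorem assocInv_tmul (x : V) (y : W) (c : X) :
    (assocInv V W X).lin (x ⊗ₑ (y ⊗ₑ c)) = (x ⊗ₑ y) ⊗ₑ c := by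
  simp [assocInv]

/-- Multiplication in the first variable, `p ⊗ (a ⊗ b) ↦ p a ⊗ b`. -/
def mulFst (A : Type u) [NonUnitalNonAssocRing A] [Module ℂ A] [SMulCommClass ℂ A A]
    [IsScalarTower ℂ A A] [Bornology A] [BornologicalAlgebra A] (X : Type w) [AddCommGroup X]
    [Module ℂ X] [Bornology X] : BLin (A ⊗ᵇ (A ⊗ᵇ X)) (A ⊗ᵇ X) :=
  (map (mulMap A) (BLin.id X)).comp (assocInv A A X)

theorem mulFst_tmul {A : Type u} [NonUnitalNonAssocRing A] [Module ℂ A] [SMulCommClass ℂ A A]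
    [IsScalarTower ℂ A A] [Bornology A] [BornologicalAlgebra A] (p : A) (t : A ⊗ᵇ X) :
    mulFst A X (p ⊗ₑ t) = map (mulL p) (BLin.id X) t :=
  BLin.eq_of_tmul ((mulFst A X).comp (tmulL p _)) (map (mulL p) (BLin.id X))
    (fun x y => by simp [mulFst]) t

end assocInv

namespace BornologicalQuantumGroup

variable {H : Type u} [NonUnitalRing H] [Module ℂ H] [SMulCommClass ℂ H H] [IsScalarTower ℂ H H]
  [Bornology H] [BornologicalAlgebra H] (Q : BornologicalQuantumGroup H)

/-! ### Invariance of the Haar functional -/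

theorem sliceR_haar_gammaL (x y : H) : sliceR Q.haar (Q.gammaL (x ⊗ₑ y)) = Q.haar x • y := by
  obtain ⟨t, ht, h⟩ := Q.haar_leftHaar.2.1 x y
  rw [← Q.eq_gammaL ht, h]

theorem sliceL_haar_gammaR {δ : Mult H} (hδ : IsModularElement Q.comul Q.haar δ) (x y : H) :
    sliceL Q.haar (Q.gammaR (x ⊗ₑ y)) = Q.haar x • δ.L y := by
  obtain ⟨t, ht, h⟩ := hδ.1 x y
  rw [← Q.eq_gammaR ht, h]

theorem sliceL_haar_rhoR {δ : Mult H} (hδ : IsModularElement Q.comul Q.haar δ) (x y : H) :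
    sliceL Q.haar (Q.rhoR (y ⊗ₑ x)) = Q.haar x • δ.R y := by
  obtain ⟨t, ht, h⟩ := hδ.2 x y
  rw [← Q.eq_rhoR ht, h]

/-! ### Characters -/

/-- A bounded multiplicative functional `α` together with an element `c` with `α(c) = 1`. -/
structure IsCharacter (α : BLin H ℂ) (c : H) : Prop where
  map_mul : ∀ x y, α (x * y) = α x * α y
  apply_eq_one : α c = 1

section character

variable {Q} {α : BLin H ℂ} {c : H}

theorem IsCharacter.comp_mulR (hα : IsCharacter α c) (z : H) :
    α.comp (mulR z) = α.smul (α z) :=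
  BLin.ext' fun x => by simp [hα.map_mul, mul_comm]

theorem IsCharacter.comp_mulL (hα : IsCharacter α c) (z : H) :
    α.comp (mulL z) = α.smul (α z) :=
  BLin.ext' fun x => by simp [hα.map_mul]

theorem IsCharacter.comp_mulR_self (hα : IsCharacter α c) : α.comp (mulR c) = α :=
  BLin.ext' fun x => by simp [hα.map_mul, hα.apply_eq_one]

theorem IsCharacter.rslice_mul (hα : IsCharacter α c) (y b : H) :
    Q.rslice α c y * b = sliceR α (Q.gammaL (y ⊗ₑ b)) := by
  rw [Q.rslice_mul, hα.comp_mulR_self]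

theorem IsCharacter.mul_rslice (hα : IsCharacter α c) (a y : H) :
    a * Q.rslice α c y = sliceR α (Q.rhoL (a ⊗ₑ y)) := by
  rw [Q.mul_rslice, hα.comp_mulR_self]

theorem IsCharacter.lslice_mul (hα : IsCharacter α c) (y b : H) :
    Q.lslice α c y * b = sliceL α (Q.gammaR (y ⊗ₑ b)) := by
  rw [Q.lslice_mul, hα.comp_mulR_self]

/-- Multiplicativity turns α(· z) into α(z)α, so the auxiliary factor contributes only a scalar.
Hence (id ⊗ α)Δ(y) is an honest element of H, and any c with α(c) = 1 computes it. -/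
theorem IsCharacter.rslice_eq_smul (hα : IsCharacter α c) (z y : H) :
    Q.rslice α z y = α z • Q.rslice α c y := by
  refine Q.eq_of_mul_right fun b => ?_
  rw [smul_mul_assoc, hα.rslice_mul, Q.rslice_mul, hα.comp_mulR, sliceR_smul]

theorem IsCharacter.lslice_eq_smul (hα : IsCharacter α c) (z y : H) :
    Q.lslice α z y = α z • Q.lslice α c y := by
  refine Q.eq_of_mul_right fun b => ?_
  rw [smul_mul_assoc, hα.lslice_mul, Q.lslice_mul, hα.comp_mulR, sliceL_smul]

theorem IsCharacter.sliceL_rhoL (hα : IsCharacter α c) (x y : H) :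
    sliceL α (Q.rhoL (x ⊗ₑ y)) = α x • Q.lslice α c y := by
  refine Q.eq_of_mul_right fun b => ?_
  have := congrArg (sliceL α).lin (Q.map_mulL_gammaR x y b)
  rw [sliceL_map, sliceL_map, hα.comp_mulL, sliceL_smul, ← hα.lslice_mul] at this
  rw [smul_mul_assoc]
  exact this.symm

theorem IsCharacter.lsliceRho_eq (hα : IsCharacter α c) (y : H) :
    Q.lsliceRho α c y = Q.lslice α c y := by
  rw [lsliceRho_apply, hα.sliceL_rhoL, hα.apply_eq_one, one_smul]

theorem IsCharacter.map_lslice_gammaR (hα : IsCharacter α c) (y z : H) :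
    map (Q.lslice α c) (BLin.id H) (Q.gammaR (y ⊗ₑ z)) = Q.gammaR (Q.lslice α c y ⊗ₑ z) := by
  rw [← hα.lsliceRho_eq, ← map_lsliceRho_gammaR]
  exact map_congr (fun y => (hα.lsliceRho_eq y).symm) (fun _ => rfl) _

theorem IsCharacter.sliceL_comul_L (hα : IsCharacter α c) (x : H) (t : H ⊗ᵇ H) :
    sliceL α ((Q.comul x).L t) = Q.lslice α c x * sliceL α t :=
  BLin.eq_of_tmul ((sliceL α).comp (Q.comul x).bL) ((mulL (Q.lslice α c x)).comp (sliceL α))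
    (fun p q => by simp [Q.sliceL_comul_L, hα.lslice_eq_smul p x, smul_mul_assoc]) t

theorem IsCharacter.sliceR_comul_L (hα : IsCharacter α c) (x : H) (t : H ⊗ᵇ H) :
    sliceR α ((Q.comul x).L t) = Q.rslice α c x * sliceR α t :=
  BLin.eq_of_tmul ((sliceR α).comp (Q.comul x).bL) ((mulL (Q.rslice α c x)).comp (sliceR α))
    (fun p q => by simp [Q.sliceR_comul_L, hα.rslice_eq_smul q x, smul_mul_assoc]) t

theorem IsCharacter.lslice_map_mul (hα : IsCharacter α c) (x y : H) :
    Q.lslice α c (x * y) = Q.lslice α c x * Q.lslice α c y := by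
  refine Q.eq_of_mul_right fun b => ?_
  rw [hα.lslice_mul, gammaR_mul_left, hα.sliceL_comul_L, ← hα.lslice_mul, mul_assoc]

theorem IsCharacter.rslice_map_mul (hα : IsCharacter α c) (x y : H) :
    Q.rslice α c (x * y) = Q.rslice α c x * Q.rslice α c y := by
  refine Q.eq_of_mul_right fun b => ?_
  rw [hα.rslice_mul, gammaL_mul_left, hα.sliceR_comul_L, ← hα.rslice_mul, mul_assoc]

theorem IsCharacter.haar_lslice (hα : IsCharacter α c) (x : H) :
    Q.haar (Q.lslice α c x) = Q.haar x := by
  rw [lslice_apply, ← apply_sliceR, sliceR_haar_gammaL, map_smul, hα.apply_eq_one, smul_eq_mul,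
    mul_one]

/-- Fubini turns the left side into α applied to (φ ⊗ id)Δ(x) = φ(x)δ. For a character with α(c) =
1, the scalar α(δ c) plays the role of α(δ). -/
theorem haar_rslice {δ : Mult H} (hδ : IsModularElement Q.comul Q.haar δ) (x : H) :
    Q.haar (Q.rslice α c x) = α (δ.L c) * Q.haar x := by
  rw [rslice_apply, apply_sliceR, Q.sliceL_haar_gammaR hδ, map_smul, smul_eq_mul, mul_comm]

/-- `(R ⊗ id)Δ = (id ⊗ L)Δ` for the operators `L = (α ⊗ id)Δ` and `R = (id ⊗ α)Δ`. -/
theorem IsCharacter.map_rslice_gammaR (hα : IsCharacter α c) (y z k : H) :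
    map ((mulR k).comp (Q.rslice α c)) (BLin.id H) (Q.gammaR (y ⊗ₑ z)) =
      map (BLin.id H) ((mulR z).comp (Q.lslice α c)) (Q.gammaL (y ⊗ₑ k)) := by
  refine Q.eq_of_map_mulL_id fun x => ?_
  have h := Q.map_sliceR_rhoL_gammaR α x y z
  rw [map_congr (f' := (mulL x).comp (Q.rslice α c)) (g' := BLin.id H)
      (fun w => (hα.mul_rslice x w).symm) (fun _ => rfl),
    map_congr (f := BLin.id H) (f' := BLin.id H) (g' := (mulR z).comp (Q.lslice α c))
      (fun _ => rfl) (fun w => (hα.lslice_mul w z).symm)] at h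
  rw [← map_id_comm, map_mulL_gammaL, map_id_comm, ← h, map_map, map_map]
  exact map_congr (fun w => by simp [mul_assoc]) (fun _ => rfl) _

/-- The outer R_α becomes L_α on the leg seen by θ, and the hypothesis moves it from there onto the
auxiliary factor. -/
theorem IsCharacter.rslice_rslice (hα : IsCharacter α c) {θ η : BLin H ℂ} {z w : H}
    (h : ∀ x, θ (Q.lslice α c x * z) = η (x * w)) (y : H) :
    Q.rslice α c (Q.rslice θ z y) = Q.rslice η w y := by
  refine Q.eq_of_mul_right fun k => ?_
  have := congrArg (sliceR θ).lin (hα.map_rslice_gammaR (Q := Q) y z k)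
  rw [sliceR_map, sliceR_map, BLin.id_apply,
    BLin.ext' (f := θ.comp ((mulR z).comp (Q.lslice α c))) (g := η.comp (mulR w)) h,
    ← Q.rslice_mul] at this
  exact this

theorem IsCharacter.lslice_lslice (hα : IsCharacter α c) {θ η : BLin H ℂ} {k w : H}
    (h : ∀ x, θ (Q.rslice α c x * k) = η (x * w)) (y : H) :
    Q.lslice α c (Q.lslice θ k y) = Q.lslice η w y := by
  refine Q.eq_of_mul_right fun z => ?_
  have := congrArg (sliceL θ).lin (hα.map_rslice_gammaR (Q := Q) y z k)
  rw [sliceL_map, sliceL_map, BLin.id_apply,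
    BLin.ext' (f := θ.comp ((mulR k).comp (Q.rslice α c))) (g := η.comp (mulR w)) h,
    ← Q.lslice_mul] at this
  exact this.symm

variable {β : BLin H ℂ} {d : H} {ε : BLin H ℂ}

/-- Both sides are (α ⊗ β)Δ(x). -/
theorem IsCharacter.apply_rslice (hα : IsCharacter α c) (hβ : IsCharacter β d) (x : H) :
    α (Q.rslice β d x) = β (Q.lslice α c x) := by
  rw [lslice_apply, ← apply_sliceR, ← hβ.rslice_mul, hα.map_mul, hα.apply_eq_one, mul_one]

/-- Since Δ L_β = (L_β ⊗ id)Δ, the composite is ((α ∘ L_β) ⊗ id)Δ = (ε ⊗ id)Δ. -/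
theorem IsCharacter.lslice_lslice_cancel (hε : Q.IsCounit ε) (hα : IsCharacter α c)
    (hβ : IsCharacter β d) (h : ∀ x, α (Q.lslice β d x) = ε x) (x : H) :
    Q.lslice α c (Q.lslice β d x) = x := by
  refine Q.eq_of_mul_right fun b => ?_
  rw [hα.lslice_mul, ← hβ.map_lslice_gammaR, sliceL_map,
    BLin.ext' (f := α.comp (Q.lslice β d)) (g := ε) h, hε.counit_gammaR, BLin.id_apply]

theorem IsCharacter.rslice_rslice_cancel (hε : Q.IsCounit ε) (hα : IsCharacter α c)
    (h : ∀ x, α (Q.rslice β d x) = ε x) (x : H) :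
    Q.rslice α c (Q.rslice β d x) = x := by
  refine Q.eq_of_mul_right fun b => ?_
  rw [hα.rslice_mul, ← map_rslice_gammaL, sliceR_map,
    BLin.ext' (f := α.comp (Q.rslice β d)) (g := ε) h, hε.counit_gammaL, BLin.id_apply]

end character

/-! ### Counit and antipode -/

section antipode

variable {Q} {ε : BLin H ℂ} {S : BLin H H}

/-- Essentiality forces ε ≠ 0: a zero action would have zero image and miss 1. -/
theorem IsCounit.exists_isCharacter (hε : Q.IsCounit ε) : ∃ c, IsCharacter ε c := by
  by_contra hcon
  push Not at hcon
  have h0 : ∀ x, ε x = 0 := fun x => by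
    by_contra hx
    refine hcon ((ε x)⁻¹ • x) ⟨hε.map_mul, ?_⟩
    rw [map_smul, smul_eq_mul, inv_mul_cancel₀ hx]
  obtain ⟨hb, -, h⟩ := hε.essential_left
  obtain ⟨T, -, hT⟩ := h {1} isBounded_singleton
  obtain ⟨t, -, ht⟩ := hT rfl
  have := lift_unique isBoundedLin_zero _ hb (fun x y => by simp [h0]) t
  rw [← this] at ht
  simp at ht

theorem IsCounit.rslice (hε : Q.IsCounit ε) {c : H} (hc : IsCharacter ε c) (x : H) :
    Q.rslice ε c x = x := by
  refine Q.eq_of_mul_right fun b => ?_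
  rw [hc.rslice_mul, hε.counit_gammaL]

theorem IsCounit.sliceR_gammaR (hε : Q.IsCounit ε) (x y : H) :
    sliceR ε (Q.gammaR (x ⊗ₑ y)) = ε y • x := by
  obtain ⟨c, hc⟩ := hε.exists_isCharacter
  rw [← rslice_apply, hc.rslice_eq_smul, hε.rslice hc]

theorem IsCounit.counit_rslice (hε : Q.IsCounit ε) (θ : BLin H ℂ) (x y : H) :
    ε (Q.rslice θ y x) = θ (x * y) := by
  rw [rslice_apply, apply_sliceR, hε.counit_gammaR]

/-- The antipode axiom solved for S by inverting γ_r; this formula determines S. -/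
theorem IsAntipode.antipode_mul (hS : Q.IsAntipode ε S) (x b : H) :
    S x * b = sliceL ε (Q.gammaR.inv (x ⊗ₑ b)) := by
  rw [← hS.left]
  rw [BIso.apply_inv]
  simp

theorem IsAntipode.map_mul (hS : Q.IsAntipode ε S) (hε : Q.IsCounit ε) (x y : H) :
    S (x * y) = S y * S x := by
  refine Q.eq_of_mul_right fun b => ?_
  -- The map m sends p ⊗ q to (p ⊗ 1)γ_r⁻¹(y ⊗ q). Under γ_r it becomes right multiplication by y ⊗
  -- 1, and under ε ⊗ id it becomes left multiplication by S(y). Evaluating it at γ_r⁻¹(x ⊗ b) gives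
  -- both sides.
  let m : BLin (H ⊗ᵇ H) (H ⊗ᵇ H) :=
    (mulFst H H).comp (map (BLin.id H) (Q.gammaR.inv.comp (tmulL y H)))
  have hm : ∀ p q, m (p ⊗ₑ q) = map (mulL p) (BLin.id H) (Q.gammaR.inv (y ⊗ₑ q)) := fun p q => by
    simp only [m, BLin.comp_apply, map_tmul, mulFst_tmul, BLin.id_apply, tmulL_apply]
  have hg : ∀ p t, Q.gammaR (map (mulL p) (BLin.id H) t) = (Q.comul p).L (Q.gammaR t) :=
    fun p t => BLin.eq_of_tmul (Q.gammaR.toBLin.comp (map (mulL p) (BLin.id H)))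
      ((Q.comul p).bL.comp Q.gammaR.toBLin) (fun a b => by
        simp only [BLin.comp_apply, map_tmul, BIso.toBLin_apply, mulL_apply, BLin.id_apply,
          Mult.bL_apply, gammaR_mul_left]) t
  have h1 : ∀ t, Q.gammaR (m t) = map (mulR y) (BLin.id H) (Q.gammaR t) :=
    BLin.eq_of_tmul (Q.gammaR.toBLin.comp m) ((map (mulR y) (BLin.id H)).comp Q.gammaR.toBLin)
      (fun p q => by
        simp only [BLin.comp_apply, BIso.toBLin_apply, hm, hg, BIso.apply_inv,
          comul_L_tmul_gammaR])
  have h2 : ∀ t, sliceL ε (m t) = S y * sliceL ε t :=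
    BLin.eq_of_tmul ((sliceL ε).comp m) ((mulL (S y)).comp (sliceL ε)) (fun p q => by
      simp only [BLin.comp_apply, hm, sliceL_map, mulL_apply, sliceL_tmul, BLin.id_apply]
      rw [mul_smul_comm, hS.antipode_mul, ← sliceL_smul,
        BLin.ext' (f := ε.comp (mulL p)) (g := ε.smul (ε p)) fun z => by simp [hε.map_mul]])
  have h3 : m (Q.gammaR.inv (x ⊗ₑ b)) = Q.gammaR.inv ((x * y) ⊗ₑ b) := by
    apply Q.gammaR.equiv.injective
    rw [h1, BIso.apply_inv, BIso.apply_inv]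
    simp
  rw [hS.antipode_mul, ← h3, h2, ← hS.antipode_mul, mul_assoc]

/-- Strong left invariance: `S((id ⊗ φ)(Δ(x)(1 ⊗ y))) = (id ⊗ φ)((1 ⊗ x)Δ(y))`. -/
theorem IsAntipode.antipode_rslice_haar (hS : Q.IsAntipode ε S) (hε : Q.IsCounit ε) (x y : H) :
    S (Q.rslice Q.haar y x) = sliceR Q.haar (Q.rhoR (x ⊗ₑ y)) := by
  refine Q.eq_of_mul_right fun b => ?_
  let P : H → BLin H H := fun x => (sliceR Q.haar).comp (Q.gammaR.toBLin.comp (tmulL x H))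
  have hP : ∀ x q, P x q = Q.rslice Q.haar q x := fun _ _ => rfl
  let v : BLin (H ⊗ᵇ H) (H ⊗ᵇ H) := (swap H H).comp (map (BLin.id H) (P x))
  -- This exhibits γ_r⁻¹ of (slice) ⊗ b, so that the antipode axiom computes S of the slice. The
  -- identity is tested against φ(· k), where left invariance of φ collapses the remaining γ_l.
  have hv : Q.gammaR (v (Q.gammaL (y ⊗ₑ b))) = Q.rslice Q.haar y x ⊗ₑ b := by
    refine Q.eq_of_sliceL_mulR fun k => ?_
    have h1 : ∀ w, sliceL (Q.haar.comp (mulR k)) (Q.gammaR (v w)) =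
        sliceR Q.haar ((Q.comul (Q.lslice Q.haar k x)).L w) :=
      BLin.eq_of_tmul ((sliceL (Q.haar.comp (mulR k))).comp (Q.gammaR.toBLin.comp v))
        ((sliceR Q.haar).comp (Q.comul (Q.lslice Q.haar k x)).bL) (fun p q => by
          simp only [BLin.comp_apply, v, map_tmul, swap_tmul, hP, BLin.id_apply,
            BIso.toBLin_apply, Mult.bL_apply, sliceR_comul_L, ← lslice_mul,
            rslice_lslice_comm])
    rw [h1, ← gammaL_mul_left, sliceR_haar_gammaL, sliceL_tmul, ← sliceR_tmul]
    have := apply_sliceR Q.haar Q.haar ((Q.comul x).L (k ⊗ₑ y))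
    rw [sliceR_comul_L, sliceL_comul_L] at this
    simp [this]
  have := hS.left (v (Q.gammaL (y ⊗ₑ b)))
  rw [hv, map_tmul, mulMap_tmul, BLin.id_apply] at this
  rw [this, BLin.comp_apply, sliceL_swap, sliceR_map, BLin.id_apply,
    BLin.ext' (f := ε.comp (P x)) (g := Q.haar.comp (mulL x))
      (fun q => by simp [hP, hε.counit_rslice])]
  have := congrArg (sliceR Q.haar).lin (Q.map_mulL_gammaL' x y b)
  rw [sliceR_map, sliceR_map] at this
  exact this

/-- Strong left invariance rewrites φ ∘ S on the slice as φ of a slice of ρ_r, and the modular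
element evaluates that. -/
theorem IsAntipode.sliceL_comp_gammaR (hS : Q.IsAntipode ε S) (hε : Q.IsCounit ε) {δ : Mult H}
    (hδ : IsModularElement Q.comul Q.haar δ) (x y : H) :
    sliceL (Q.haar.comp S) (Q.gammaR (x ⊗ₑ y)) = Q.haar (δ.R x) • y := by
  refine Q.eq_of_haar_mul_right fun c => ?_
  have h : sliceL (Q.haar.comp S) (Q.gammaR (x ⊗ₑ y)) * c =
      sliceL (Q.haar.comp S) (Q.gammaR (x ⊗ₑ (y * c))) := by
    rw [gammaR_mul_right, sliceL_map]
    rfl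
  rw [h, ← apply_sliceR, ← rslice_apply, BLin.comp_apply, hS.antipode_rslice_haar hε,
    apply_sliceR, Q.sliceL_haar_rhoR hδ, map_smul, smul_mul_assoc, map_smul, smul_eq_mul,
    smul_eq_mul, mul_comm]

/-- Apply ε to the second leg of the preceding identity, with y chosen so that ε(y) = 1. -/
theorem IsAntipode.haar_antipode (hS : Q.IsAntipode ε S) (hε : Q.IsCounit ε) {δ : Mult H}
    (hδ : IsModularElement Q.comul Q.haar δ) (x : H) : Q.haar (S x) = Q.haar (δ.R x) := by
  obtain ⟨c, hc⟩ := hε.exists_isCharacter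
  have := congrArg ε.lin (hS.sliceL_comp_gammaR hε hδ x c)
  rw [← apply_sliceR, hε.sliceR_gammaR, map_smul, map_smul, hc.apply_eq_one] at this
  simpa using this

/-- The functional `φ ∘ S` is right invariant. -/
theorem IsAntipode.sliceL_comp_rhoR (hS : Q.IsAntipode ε S) (hε : Q.IsCounit ε) {δ : Mult H}
    (hδ : IsModularElement Q.comul Q.haar δ) (x b : H) :
    sliceL (Q.haar.comp S) (Q.rhoR (b ⊗ₑ x)) = Q.haar (S x) • b := by
  refine Q.eq_of_mul_right fun c => ?_
  have := congrArg (sliceL (Q.haar.comp S)).lin (Q.map_mulL_gammaR' b x c)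
  rw [sliceL_map, sliceL_map, BLin.comp_id, hS.sliceL_comp_gammaR hε hδ] at this
  rw [← mulR_apply c, ← this, hS.haar_antipode hε hδ]
  simp [smul_mul_assoc]

/-- Strong right invariance of `ψ = φ ∘ S`:
`S((ψ ⊗ id)((z ⊗ 1)Δ(h))) = (ψ ⊗ id)(Δ(z)(h ⊗ 1))`. -/
theorem IsAntipode.antipode_lsliceRho (hS : Q.IsAntipode ε S) (hε : Q.IsCounit ε) {δ : Mult H}
    (hδ : IsModularElement Q.comul Q.haar δ) (z h : H) :
    S (Q.lsliceRho (Q.haar.comp S) z h) = Q.lslice (Q.haar.comp S) h z := by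
  refine Q.eq_of_mul_left fun b => ?_
  set ψ := Q.haar.comp S with hψ
  let P : H → BLin H H := fun h => (sliceL ψ).comp (Q.rhoL.toBLin.comp (tmulR H h))
  have hP : ∀ h p, P h p = Q.lsliceRho ψ p h := fun _ _ => rfl
  let v : BLin (H ⊗ᵇ H) (H ⊗ᵇ H) := (swap H H).comp (map (P h) (BLin.id H))
  -- The mirror image of the argument for φ: ρ_l⁻¹ of b ⊗ (slice) is found explicitly, with right
  -- invariance of ψ in place of left invariance of φ.
  have hv : Q.rhoL (v (Q.rhoR (b ⊗ₑ z))) = b ⊗ₑ Q.lsliceRho ψ z h := by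
    refine Q.eq_of_sliceR_mulR fun k => ?_
    have h1 : ∀ w, sliceR (Q.haar.comp (mulR k)) (Q.rhoL (v w)) =
        sliceL ψ ((Q.comul (Q.rslice Q.haar k h)).R w) :=
      BLin.eq_of_tmul ((sliceR (Q.haar.comp (mulR k))).comp (Q.rhoL.toBLin.comp v))
        ((sliceL ψ).comp (Q.comul (Q.rslice Q.haar k h)).bR) (fun p q => by
          simp only [BLin.comp_apply, v, map_tmul, swap_tmul, hP, BLin.id_apply,
            BIso.toBLin_apply, Mult.bR_apply, sliceL_comul_R, ← mul_rslice,
            rslice_lsliceRho_comm]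
          rfl)
    rw [h1, ← rhoR_mul_right, hψ, hS.sliceL_comp_rhoR hε hδ, sliceR_tmul]
    congr 1
    have h2 := congrArg (sliceR Q.haar).lin (Q.map_mulL_gammaR z h k)
    rw [sliceR_map, sliceR_map, BLin.id_apply, BLin.comp_id] at h2
    have h3 := congrArg ψ.lin h2
    rw [apply_sliceR ψ] at h3
    exact h3
  have := hS.right (v (Q.rhoR (b ⊗ₑ z)))
  rw [hv, map_tmul, mulMap_tmul, BLin.id_apply] at this
  rw [this, BLin.comp_apply, ← sliceL_swap, swap_swap, sliceL_map, BLin.id_apply, mul_lslice,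
    BLin.ext' (f := ε.comp (P h)) (g := ψ.comp (mulR h)) fun p : H => by
      change ε (sliceL ψ (Q.rhoL (p ⊗ₑ h))) = ψ (p * h)
      rw [← apply_sliceR, hε.counit_rhoL]]

end antipode

end BornologicalQuantumGroup

end BornQG

end

noncomputable section

namespace BornQG

/-! ### Invertible multipliers. -/

section unit

variable {A : Type u} [NonUnitalNonAssocRing A] [Module ℂ A] [SMulCommClass ℂ A A]
  [IsScalarTower ℂ A A] [Bornology A] [BornologicalAlgebra A]

/-- A multiplier whose two multiplication operators have bounded inverses is a unit. -/
theorem Mult.exists_unit (m : Mult A) (l r : BLin A A) (hl : ∀ a, m.L (l a) = a)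
    (hl' : ∀ a, l (m.L a) = a) (hr : ∀ a, m.R (r a) = a) (hr' : ∀ a, r (m.R a) = a) :
    ∃ u : (Mult A)ˣ, (u : Mult A) = m ∧ (∀ a, Mult.L ((u⁻¹ : (Mult A)ˣ) : Mult A) a = l a) ∧
      ∀ a, Mult.R ((u⁻¹ : (Mult A)ˣ) : Mult A) a = r a := by
  let n : Mult A := ⟨(l.lin, MulOpposite.op r.lin), l.bdd, r.bdd, fun a b => by
      change l (a * b) = l a * b
      conv_lhs => rw [← hl a, ← Mult.L_mul, hl'],
    fun a b => by
      change r (a * b) = a * r b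
      conv_lhs => rw [← hr b, ← Mult.R_mul, hr'],
    fun a b => by
      change a * l b = r a * b
      conv_lhs => rw [← hr a, ← Mult.mul_L, hl]⟩
  refine ⟨⟨m, n, ?_, ?_⟩, rfl, fun _ => rfl, fun _ => rfl⟩
  · exact Subtype.ext (Prod.ext (LinearMap.ext hl) (MulOpposite.unop_injective (LinearMap.ext hr')))
  · exact Subtype.ext (Prod.ext (LinearMap.ext hl') (MulOpposite.unop_injective (LinearMap.ext hr)))

theorem Mult.inv_L_L (u : (Mult A)ˣ) (x : A) :
    Mult.L ((u⁻¹ : (Mult A)ˣ) : Mult A) (Mult.L (u : Mult A) x) = x :=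
  LinearMap.congr_fun (congrArg (fun m : Mult A => m.1.1) u.inv_mul) x

theorem Mult.R_R_inv (u : (Mult A)ˣ) (x : A) :
    Mult.R (u : Mult A) (Mult.R ((u⁻¹ : (Mult A)ˣ) : Mult A) x) = x :=
  LinearMap.congr_fun (congrArg (fun m : Mult A => m.1.2.unop) u.inv_mul) x

theorem Mult.inv_R_R (u : (Mult A)ˣ) (x : A) :
    Mult.R ((u⁻¹ : (Mult A)ˣ) : Mult A) (Mult.R (u : Mult A) x) = x :=
  LinearMap.congr_fun (congrArg (fun m : Mult A => m.1.2.unop) u.mul_inv) x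

end unit

namespace BornologicalQuantumGroup

variable {H : Type u} [NonUnitalRing H] [Module ℂ H] [SMulCommClass ℂ H H] [IsScalarTower ℂ H H]
  [Bornology H] [BornologicalAlgebra H] {Q : BornologicalQuantumGroup H}
  {ε : BLin H ℂ} {S : BLin H H} {δ : Mult H}

theorem mult_L_R_comm (Q : BornologicalQuantumGroup H) (m n : Mult H) (x : H) :
    m.L (n.R x) = n.R (m.L x) := by
  refine Q.eq_of_mul_left fun a => ?_
  rw [Mult.mul_L, ← Mult.R_mul, ← Mult.R_mul, Mult.mul_L]

theorem IsCounit.exists_haar_eq_one (hε : Q.IsCounit ε) : ∃ c, Q.haar c = 1 := by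
  obtain ⟨c, hc⟩ := hε.exists_isCharacter
  have hc0 : c ≠ 0 := by
    rintro rfl
    simpa using hc.apply_eq_one
  by_contra hcon
  push Not at hcon
  refine hc0 (Q.haar_leftHaar.1.1 c fun y => ?_)
  by_contra hy
  refine hcon ((Q.haar (c * y))⁻¹ • (c * y)) ?_
  rw [map_smul, smul_eq_mul, inv_mul_cancel₀ hy]

/-! ### Density -/

theorem ext_rslice (hε : Q.IsCounit ε) {X : Type*} [AddCommGroup X] [Module ℂ X] [Bornology X]
    [CompleteBornological X] {f g : BLin H X}
    (h : ∀ y x, f (Q.rslice Q.haar y x) = g (Q.rslice Q.haar y x)) (x : H) : f x = g x := by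
  obtain ⟨c, hc⟩ := hε.exists_haar_eq_one
  have := BLin.eq_of_tmul (f.comp ((sliceR Q.haar).comp Q.gammaR.toBLin))
    (g.comp ((sliceR Q.haar).comp Q.gammaR.toBLin)) (fun x y => h y x) (Q.gammaR.inv (x ⊗ₑ c))
  simpa [BIso.toBLin_apply, hc] using this

theorem ext_lslice (hε : Q.IsCounit ε) {X : Type*} [AddCommGroup X] [Module ℂ X] [Bornology X]
    [CompleteBornological X] {f g : BLin H X}
    (h : ∀ y x, f (Q.lslice Q.haar y x) = g (Q.lslice Q.haar y x)) (x : H) : f x = g x := by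
  obtain ⟨c, hc⟩ := hε.exists_haar_eq_one
  have := BLin.eq_of_tmul (f.comp ((sliceL Q.haar).comp Q.gammaL.toBLin))
    (g.comp ((sliceL Q.haar).comp Q.gammaL.toBLin)) (fun x y => h y x) (Q.gammaL.inv (c ⊗ₑ x))
  simpa [BIso.toBLin_apply, hc] using this

theorem ext_mul (hε : Q.IsCounit ε) {X : Type*} [AddCommGroup X] [Module ℂ X] [Bornology X]
    [CompleteBornological X] {f g : BLin H X} (h : ∀ x y, f (x * y) = g (x * y)) (x : H) :
    f x = g x := by
  obtain ⟨c, hc⟩ := hε.exists_isCharacter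
  have := BLin.eq_of_tmul (f.comp ((sliceL ε).comp Q.gammaR.toBLin))
    (g.comp ((sliceL ε).comp Q.gammaR.toBLin))
    (fun x y => by simp [BIso.toBLin_apply, hε.counit_gammaR, h]) (Q.gammaR.inv (c ⊗ₑ x))
  simpa [BIso.toBLin_apply, hc.apply_eq_one] using this

/-! ### Invertibility of the modular element and of the antipode -/

/-- The modular element is invertible. -/
theorem IsCounit.exists_unit_modular (hε : Q.IsCounit ε)
    (hδ : IsModularElement Q.comul Q.haar δ) : ∃ u : (Mult H)ˣ, (u : Mult H) = δ := by
  obtain ⟨c, hc⟩ := hε.exists_haar_eq_one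
  -- The relation (φ ⊗ id)γ_r = δ(φ ⊗ id), with γ_r invertible and φ ≠ 0, gives a right inverse of
  -- left multiplication by δ. In the same way ρ_r serves right multiplication.
  have hL : ∀ t, sliceL Q.haar (Q.gammaR t) = δ.L (sliceL Q.haar t) :=
    BLin.eq_of_tmul ((sliceL Q.haar).comp Q.gammaR.toBLin) (δ.bL.comp (sliceL Q.haar))
      (fun x y => by simp [BIso.toBLin_apply, Q.sliceL_haar_gammaR hδ])
  have hR : ∀ t, sliceL Q.haar (Q.rhoR t) = δ.R (sliceR Q.haar t) :=
    BLin.eq_of_tmul ((sliceL Q.haar).comp Q.rhoR.toBLin) (δ.bR.comp (sliceR Q.haar))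
      (fun x y => by simp [BIso.toBLin_apply, Q.sliceL_haar_rhoR hδ])
  let l : BLin H H := (sliceL Q.haar).comp (Q.gammaR.inv.comp (tmulL c H))
  let r : BLin H H := (sliceR Q.haar).comp (Q.rhoR.inv.comp (tmulL c H))
  have hl : ∀ a, δ.L (l a) = a := fun a => by
    have := hL (Q.gammaR.inv (c ⊗ₑ a))
    rw [BIso.apply_inv, sliceL_tmul, hc, one_smul] at this
    exact this.symm
  have hr : ∀ a, δ.R (r a) = a := fun a => by
    have := hR (Q.rhoR.inv (c ⊗ₑ a))
    rw [BIso.apply_inv, sliceL_tmul, hc, one_smul] at this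
    exact this.symm
  -- The compatibility b(δa) = (bδ)a lets surjectivity on one side prove injectivity on the other.
  have hl' : ∀ a, l (δ.L a) = a := fun a => Q.eq_of_mul_left fun b => by
    rw [← hr b, ← Mult.mul_L, hl, Mult.mul_L]
  have hr' : ∀ a, r (δ.R a) = a := fun a => Q.eq_of_mul_right fun b => by
    rw [← hl b, Mult.mul_L, hr, Mult.mul_L]
  obtain ⟨u, hu, -⟩ := δ.exists_unit l r hl hl' hr hr'
  exact ⟨u, hu⟩

/-- The antipode has a bounded inverse. -/
theorem IsAntipode.exists_inverse (hS : Q.IsAntipode ε S) (hε : Q.IsCounit ε)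
    (hδ : IsModularElement Q.comul Q.haar δ) :
    ∃ S' : BLin H H, (∀ x, S (S' x) = x) ∧ ∀ x, S' (S x) = x := by
  obtain ⟨c, hc⟩ := hε.exists_haar_eq_one
  obtain ⟨u, rfl⟩ := hε.exists_unit_modular hδ
  have h : ∀ t, S (sliceR Q.haar (Q.gammaR t)) = sliceR Q.haar (Q.rhoR t) :=
    BLin.eq_of_tmul (S.comp ((sliceR Q.haar).comp Q.gammaR.toBLin))
      ((sliceR Q.haar).comp Q.rhoR.toBLin) (fun x y => hS.antipode_rslice_haar hε x y)
  -- Strong left invariance reads S(id ⊗ φ)γ_r = (id ⊗ φ)ρ_r; inverting ρ_r at x ⊗ c with φ(c) = 1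
  -- gives a bounded right inverse.
  let S' : BLin H H :=
    (sliceR Q.haar).comp (Q.gammaR.toBLin.comp (Q.rhoR.inv.comp (tmulR H c)))
  have h1 : ∀ x, S (S' x) = x := fun x => by
    have := h (Q.rhoR.inv (x ⊗ₑ c))
    rw [BIso.apply_inv, sliceR_tmul, hc, one_smul] at this
    exact this
  -- If S(x) = 0, then φ(z · xδ) = φ(S(zx)) = φ(S(x)S(z)) = 0 for all z, so xδ = 0 and x = 0.
  have hinj : ∀ x, S x = 0 → x = 0 := fun x hx => by
    have h2 : Mult.R (u : Mult H) x = 0 := Q.haar_leftHaar.1.2 _ fun z => by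
      rw [← Mult.R_mul, ← hS.haar_antipode hε hδ, hS.map_mul hε, hx, zero_mul, map_zero]
    rw [← Mult.inv_R_R u x, h2, map_zero]
  refine ⟨S', h1, fun x => ?_⟩
  rw [← sub_eq_zero]
  exact hinj _ (by rw [map_sub, h1, sub_self])

/-! ### The modular automorphism of the Haar functional -/

/-- The twisted trace property of the Haar functional. -/
theorem IsAntipode.exists_modularAut (hS : Q.IsAntipode ε S) (hε : Q.IsCounit ε)
    (hδ : IsModularElement Q.comul Q.haar δ) :
    ∃ σ : BLin H H, ∀ x h, Q.haar (x * h) = Q.haar (h * σ x) := by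
  obtain ⟨c, hc⟩ := hε.exists_haar_eq_one
  obtain ⟨S', h1, h2⟩ := hS.exists_inverse hε hδ
  obtain ⟨u, rfl⟩ := hε.exists_unit_modular hδ
  set ψ := Q.haar.comp S with hψ
  let B : BLin (H ⊗ᵇ H) H := (sliceL Q.haar).comp (Q.gammaL.toBLin.comp (map S' S))
  have hS' : ∀ x y, S' (x * y) = S' y * S' x := fun x y => by
    rw [← h2 (S' y * S' x), hS.map_mul hε, h1, h1]
  -- On elementary tensors both sides are linked through φ(S(·)S(z)) and ψ(z ·): strong invariance
  -- of φ and then of ψ, with Fubini in between, moves h from the right of the argument to the left.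
  have key : ∀ h t, ψ (sliceR (Q.haar.comp S') (Q.rhoR t) * h) = Q.haar (h * B t) := fun h =>
    BLin.eq_of_tmul (ψ.comp ((mulR h).comp ((sliceR (Q.haar.comp S')).comp Q.rhoR.toBLin)))
      (Q.haar.comp ((mulL h).comp B)) (fun y z => by
        have e1 : B (y ⊗ₑ z) = Q.lslice Q.haar (S z) (S' y) := by
          simp [B, lslice_apply, BIso.toBLin_apply]
        simp only [BLin.comp_apply, mulL_apply, mulR_apply, e1, mul_lslice]
        rw [← apply_sliceR, BLin.comp_apply Q.haar (mulR (S z)), mulR_apply,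
          ← hS.antipode_rslice_haar hε, ← hS.map_mul hε]
        change _ = ψ (z * Q.rslice Q.haar (S' y) h)
        rw [mul_rslice, apply_sliceR, BLin.comp_apply Q.haar (mulR (S' y)), mulR_apply,
          ← lsliceRho_apply,
          ← h2 (Q.lsliceRho ψ z h), hS.antipode_lsliceRho hε hδ, ← hS']
        change _ = (Q.haar.comp S') (y * Q.lslice ψ h z)
        rw [mul_lslice, ← apply_sliceR (ψ.comp (mulR h))]
        rfl)
  refine ⟨(Mult.bL ((u⁻¹ : (Mult H)ˣ) : Mult H)).comp
    (B.comp (Q.rhoR.inv.comp (tmulR H (S c)))), fun x h => ?_⟩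
  -- Taking hδ⁻¹ for h turns ψ back into φ, since ψ(x) = φ(xδ). The choice of t makes the slice on
  -- the left equal to x because φ(S⁻¹(S c)) = φ(c) = 1.
  have := key (Mult.R ((u⁻¹ : (Mult H)ˣ) : Mult H) h) (Q.rhoR.inv (x ⊗ₑ S c))
  rw [BIso.apply_inv, sliceR_tmul, BLin.comp_apply Q.haar S', h2, hc, one_smul, hψ,
    BLin.comp_apply, hS.haar_antipode hε hδ, Mult.R_mul, Mult.R_R_inv, ← Mult.mul_L] at this
  exact this

section modularAut

variable {σ : BLin H H}

theorem modularAut_mul (hσ : ∀ x h, Q.haar (x * h) = Q.haar (h * σ x)) (x y : H) :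
    σ (x * y) = σ x * σ y := by
  refine Q.eq_of_haar_mul_left fun h => ?_
  rw [← hσ, mul_assoc, hσ, mul_assoc, hσ, mul_assoc]

/-- In strong left invariance the factor x stands to the left of Δ(y); σ moves it to the right, so
the result is again a slice of the same kind and S can be iterated. -/
theorem IsAntipode.antipode_rslice (hS : Q.IsAntipode ε S) (hε : Q.IsCounit ε)
    (hσ : ∀ x h, Q.haar (x * h) = Q.haar (h * σ x)) (x y : H) :
    S (Q.rslice Q.haar y x) = Q.rslice Q.haar (σ x) y := by
  rw [hS.antipode_rslice_haar hε]
  refine Q.eq_of_mul_right fun b => ?_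
  have := congrArg (sliceR Q.haar).lin (Q.map_mulL_gammaL' x y b)
  rw [sliceR_map, sliceR_map] at this
  rw [rslice_mul, BLin.ext' (f := Q.haar.comp (mulR (σ x))) (g := Q.haar.comp (mulL x))
    fun q => (hσ x q).symm]
  exact this.symm

theorem IsAntipode.antipode_antipode_rslice (hS : Q.IsAntipode ε S) (hε : Q.IsCounit ε)
    (hσ : ∀ x h, Q.haar (x * h) = Q.haar (h * σ x)) (x y : H) :
    S (S (Q.rslice Q.haar y x)) = Q.rslice Q.haar (σ y) (σ x) := by
  rw [hS.antipode_rslice hε hσ, hS.antipode_rslice hε hσ]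

/-- `(S² ⊗ σ)γ_r = γ_r(σ ⊗ σ)`. -/
theorem IsAntipode.map_antipode_modularAut_gammaR (hS : Q.IsAntipode ε S) (hε : Q.IsCounit ε)
    (hσ : ∀ x h, Q.haar (x * h) = Q.haar (h * σ x)) (x y : H) :
    map (S.comp S) σ (Q.gammaR (x ⊗ₑ y)) = Q.gammaR (σ x ⊗ₑ σ y) := by
  refine Q.eq_of_sliceR_mulL fun w => ?_
  have h1 : ∀ x y, sliceR (Q.haar.comp (mulR w)) (Q.gammaR (x ⊗ₑ y)) =
      Q.rslice Q.haar (y * w) x := fun x y => by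
    rw [rslice_apply, gammaR_mul_right, sliceR_map]
    rfl
  have h2 : sliceR (Q.haar.comp (mulL w)) (Q.gammaR (σ x ⊗ₑ σ y)) =
      Q.rslice Q.haar (σ y * σ w) (σ x) := by
    rw [rslice_apply, gammaR_mul_right, sliceR_map,
      BLin.ext' (f := Q.haar.comp (mulL w)) (g := Q.haar.comp (mulR (σ w))) fun q => hσ w q]
    rfl
  -- Slicing with φ(w ·) absorbs σ in the second leg, since φ(w σ(q)) = φ(q w). What remains is the
  -- formula for S² on slices.
  rw [h2, sliceR_map, BLin.ext' (f := (Q.haar.comp (mulL w)).comp σ)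
    (g := Q.haar.comp (mulR w)) fun q => (hσ q w).symm, h1, BLin.comp_apply,
    hS.antipode_antipode_rslice hε hσ, modularAut_mul hσ]

end modularAut

end BornologicalQuantumGroup

end BornQG

end

noncomputable section

namespace BornQG

namespace BornologicalQuantumGroup

variable {H : Type u} [NonUnitalRing H] [Module ℂ H] [SMulCommClass ℂ H H] [IsScalarTower ℂ H H]
  [Bornology H] [BornologicalAlgebra H] (Q : BornologicalQuantumGroup H)

/-! ### The product of the dual -/

theorem leftAct_fourier (x h : H) : Q.leftAct (Q.fourier x) h = Q.rslice Q.haar x h := by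
  simp [leftAct, rslice_apply]

theorem rightAct_fourier (x h : H) : Q.rightAct h (Q.fourier x) = Q.lslice Q.haar x h := by
  simp [rightAct, lslice_apply]

/-- The Fourier transform as a bounded map. -/
def fourierB : BLin H Q.Dual := ⟨Q.fourier.toLinearMap, Q.fourier_bdd⟩

/-- The inverse Fourier transform as a bounded map. -/
def fourierInvB : BLin Q.Dual H := ⟨Q.fourier.symm.toLinearMap, Q.fourier_symm_bdd⟩

@[simp] theorem fourierB_apply (x : H) : Q.fourierB.lin x = Q.fourier x := rfl

@[simp] theorem fourierInvB_apply (f : Q.Dual) : Q.fourierInvB.lin f = Q.fourier.symm f := rfl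

theorem haar_symm_apply (f : Q.Dual) (h : H) : Q.haar (h * Q.fourier.symm f) = f h := by
  rw [← fourier_apply, LinearEquiv.apply_symm_apply]

theorem dual_ext {f g : Q.Dual} (h : ∀ s, f s = g s) : f = g :=
  Subtype.ext (LinearMap.ext h)

theorem haar_rslice_mul (x y h : H) :
    Q.haar (Q.rslice Q.haar y h * x) = Q.haar (Q.lslice Q.haar x h * y) := by
  rw [← sliceR_comul_L, ← sliceL_comul_L, apply_sliceR]

/-- Both sides are (φ ⊗ φ)(Δ(h)(x ⊗ y)). Writing x ⊗ y as γ_l of a tensor, left invariance collapses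
one leg. -/
theorem haar_mul_conv (x y h : H) :
    Q.haar (h * Q.conv x y) = Q.haar (Q.rslice Q.haar y h * x) := by
  have := BLin.eq_of_tmul (Q.haar.comp ((mulL h).comp (sliceR Q.haar)))
    (Q.haar.comp ((sliceR Q.haar).comp ((Q.comul h).bL.comp Q.gammaL.toBLin)))
    (fun a b => by
      simp only [BLin.comp_apply, BIso.toBLin_apply, Mult.bL_apply, ← gammaL_mul_left,
        sliceR_haar_gammaL, sliceR_tmul, map_smul, mulL_apply, smul_eq_mul, mul_comm])
    (Q.gammaL.inv (x ⊗ₑ y))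
  simp only [BLin.comp_apply, BIso.toBLin_apply, BIso.apply_inv, Mult.bL_apply,
    sliceR_comul_L] at this
  exact this

theorem dual_mul_apply_left (f g : Q.Dual) (h : H) : (f * g) h = f (Q.leftAct g h) := by
  obtain ⟨x, rfl⟩ := Q.fourier.surjective f
  obtain ⟨y, rfl⟩ := Q.fourier.surjective g
  rw [dual_mul_def, fourier_apply, haar_mul_conv, leftAct_fourier]
  simp

theorem dual_mul_apply_right (f g : Q.Dual) (h : H) : (f * g) h = g (Q.rightAct h f) := by
  obtain ⟨x, rfl⟩ := Q.fourier.surjective f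
  obtain ⟨y, rfl⟩ := Q.fourier.surjective g
  rw [dual_mul_apply_left, leftAct_fourier, rightAct_fourier, fourier_apply, haar_rslice_mul,
    fourier_apply]

/-- Pairing with b through φ reduces this to the product formula for functionals and to the
commutation of left and right slices. -/
theorem leftAct_mul (f g : Q.Dual) (h : H) :
    Q.leftAct (f * g) h = Q.leftAct f (Q.leftAct g h) := by
  obtain ⟨x, rfl⟩ := Q.fourier.surjective f
  obtain ⟨y, rfl⟩ := Q.fourier.surjective g
  refine Q.eq_of_haar_mul_right fun b => ?_
  change Q.haar (Q.rslice Q.haar (Q.fourier.symm _) h * b) = _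
  rw [haar_rslice_mul, haar_symm_apply, dual_mul_apply_left, leftAct_fourier, leftAct_fourier,
    leftAct_fourier, fourier_apply, rslice_lslice_comm, haar_rslice_mul Q b x]

theorem rightAct_mul (f g : Q.Dual) (h : H) :
    Q.rightAct h (f * g) = Q.rightAct (Q.rightAct h f) g := by
  obtain ⟨x, rfl⟩ := Q.fourier.surjective f
  obtain ⟨y, rfl⟩ := Q.fourier.surjective g
  refine Q.eq_of_haar_mul_right fun b => ?_
  change Q.haar (Q.lslice Q.haar (Q.fourier.symm _) h * b) = _
  rw [← haar_rslice_mul, haar_symm_apply, dual_mul_apply_right, rightAct_fourier,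
    rightAct_fourier, rightAct_fourier, fourier_apply, ← rslice_lslice_comm,
    haar_rslice_mul Q y b]

/-! ### Evaluation on the tensor square of the dual -/

/-- Multiplication on the dual side is transposed to the regular actions on H; this converts
identities of multipliers of the dual into identities of scalars. -/
theorem evalAt₂_mul_tmul (s s' : H) (t : Q.Dual ⊗ᵇ Q.Dual) (a b : Q.Dual) :
    Q.evalAt₂ s s' (t * (a ⊗ₑ b)) = Q.evalAt₂ (Q.leftAct a s) (Q.leftAct b s') t := by
  rw [mul_tmul]
  exact BLin.eq_of_tmul ((Q.evalAt₂ s s').comp (map (mulR a) (mulR b)))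
    (Q.evalAt₂ (Q.leftAct a s) (Q.leftAct b s')) (fun f g => by
      simp only [BLin.comp_apply, map_tmul, mulR_apply, evalAt₂_tmul, dual_mul_apply_left]) t

theorem evalAt₂_tmul_mul (s s' : H) (t : Q.Dual ⊗ᵇ Q.Dual) (a b : Q.Dual) :
    Q.evalAt₂ s s' ((a ⊗ₑ b) * t) = Q.evalAt₂ (Q.rightAct s a) (Q.rightAct s' b) t := by
  rw [tmul_mul]
  exact BLin.eq_of_tmul ((Q.evalAt₂ s s').comp (map (mulL a) (mulL b)))
    (Q.evalAt₂ (Q.rightAct s a) (Q.rightAct s' b)) (fun f g => by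
      simp only [BLin.comp_apply, map_tmul, mulL_apply, evalAt₂_tmul, dual_mul_apply_right]) t

theorem evalAt₂_apply (s s' : H) (t : Q.Dual ⊗ᵇ Q.Dual) :
    Q.evalAt₂ s s' t = sliceR (Q.evalAt s') t s := rfl

theorem evalAt₂_apply' (s s' : H) (t : Q.Dual ⊗ᵇ Q.Dual) :
    Q.evalAt₂ s s' t = sliceL (Q.evalAt s) t s' :=
  apply_sliceR (Q.evalAt s) (Q.evalAt s') t

variable {Q} {ε : BLin H ℂ} {D : Q.Dual → Mult (Q.Dual ⊗ᵇ Q.Dual)}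

/-- A pairing `H × H → ℂ` given by a bounded bilinear expression agrees with `evalAt₂` if it does
so on the image of the left action. -/
theorem evalAt₂_ext_leftAct (hε : Q.IsCounit ε) {t : Q.Dual ⊗ᵇ Q.Dual} {B : H → H → ℂ}
    (hB1 : ∀ s', ∃ G : BLin H ℂ, ∀ s, G s = B s s') (hB2 : ∀ s, ∃ G : BLin H ℂ, ∀ s', G s' = B s s')
    (h : ∀ a b s s', Q.evalAt₂ (Q.leftAct a s) (Q.leftAct b s') t =
      B (Q.leftAct a s) (Q.leftAct b s')) (s s' : H) : Q.evalAt₂ s s' t = B s s' := by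
  have key : ∀ s b s', Q.evalAt₂ s (Q.leftAct b s') t = B s (Q.leftAct b s') := by
    intro s b s'
    obtain ⟨G, hG⟩ := hB1 (Q.leftAct b s')
    rw [← hG, evalAt₂_apply, ← haar_symm_apply]
    refine ext_rslice hε (f := Q.haar.comp (mulR _)) (g := G) (fun y x => ?_) s
    rw [hG, ← leftAct_fourier, ← h, evalAt₂_apply, ← haar_symm_apply]
    rfl
  obtain ⟨G, hG⟩ := hB2 s
  rw [← hG, evalAt₂_apply', ← haar_symm_apply]
  refine ext_rslice hε (f := Q.haar.comp (mulR _)) (g := G) (fun y x => ?_) s'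
  rw [hG, ← leftAct_fourier, ← key, evalAt₂_apply', ← haar_symm_apply]
  rfl

theorem evalAt₂_ext_rightAct (hε : Q.IsCounit ε) {t : Q.Dual ⊗ᵇ Q.Dual} {B : H → H → ℂ}
    (hB1 : ∀ s', ∃ G : BLin H ℂ, ∀ s, G s = B s s') (hB2 : ∀ s, ∃ G : BLin H ℂ, ∀ s', G s' = B s s')
    (h : ∀ a b s s', Q.evalAt₂ (Q.rightAct s a) (Q.rightAct s' b) t =
      B (Q.rightAct s a) (Q.rightAct s' b)) (s s' : H) : Q.evalAt₂ s s' t = B s s' := by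
  have key : ∀ s b s', Q.evalAt₂ s (Q.rightAct s' b) t = B s (Q.rightAct s' b) := by
    intro s b s'
    obtain ⟨G, hG⟩ := hB1 (Q.rightAct s' b)
    rw [← hG, evalAt₂_apply, ← haar_symm_apply]
    refine ext_lslice hε (f := Q.haar.comp (mulR _)) (g := G) (fun y x => ?_) s
    rw [hG, ← rightAct_fourier, ← h, evalAt₂_apply, ← haar_symm_apply]
    rfl
  obtain ⟨G, hG⟩ := hB2 s
  rw [← hG, evalAt₂_apply', ← haar_symm_apply]
  refine ext_lslice hε (f := Q.haar.comp (mulR _)) (g := G) (fun y x => ?_) s'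
  rw [hG, ← rightAct_fourier, ← key, evalAt₂_apply', ← haar_symm_apply]
  rfl

/-- The definition of t only controls the products t(a ⊗ b), that is, the pairing of t with
acted-upon arguments; density of the regular action removes a and b. -/
theorem IsDualComul.evalAt₂_gammaR (hε : Q.IsCounit ε) (hD : Q.IsDualComul D) {x y : H}
    {t : Q.Dual ⊗ᵇ Q.Dual} (ht : IsGammaR D (Q.fourier x) (Q.fourier y) t) (s s' : H) :
    Q.evalAt₂ s s' t = Q.haar (s * Q.rslice Q.haar y s' * x) := by
  refine evalAt₂_ext_leftAct hε (B := fun s s' => Q.haar (s * Q.rslice Q.haar y s' * x))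
    (fun s' => ⟨Q.haar.comp ((mulR x).comp (mulR (Q.rslice Q.haar y s'))), fun _ => rfl⟩)
    (fun s => ⟨Q.haar.comp ((mulR x).comp ((mulL s).comp (Q.rslice Q.haar y))), fun _ => rfl⟩)
    (fun a b s s' => ?_) s s'
  rw [← evalAt₂_mul_tmul, ht, (hD _ _ _ _ _).1, leftAct_mul, fourier_apply, leftAct_fourier]

theorem IsDualComul.evalAt₂_gammaL (hε : Q.IsCounit ε) (hD : Q.IsDualComul D) {x y : H}
    {t : Q.Dual ⊗ᵇ Q.Dual} (ht : IsGammaL D (Q.fourier x) (Q.fourier y) t) (s s' : H) :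
    Q.evalAt₂ s s' t = Q.haar (Q.rslice Q.haar y s * s' * x) := by
  refine evalAt₂_ext_leftAct hε (B := fun s s' => Q.haar (Q.rslice Q.haar y s * s' * x))
    (fun s' => ⟨Q.haar.comp ((mulR x).comp ((mulR s').comp (Q.rslice Q.haar y))), fun _ => rfl⟩)
    (fun s => ⟨Q.haar.comp ((mulR x).comp (mulL (Q.rslice Q.haar y s))), fun _ => rfl⟩)
    (fun a b s s' => ?_) s s'
  rw [← evalAt₂_mul_tmul, ht, (hD _ _ _ _ _).1, leftAct_mul, fourier_apply, leftAct_fourier]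

theorem IsDualComul.evalAt₂_rhoR (hε : Q.IsCounit ε) (hD : Q.IsDualComul D) {x y : H}
    {t : Q.Dual ⊗ᵇ Q.Dual} (ht : IsRhoR D (Q.fourier y) (Q.fourier x) t) (s s' : H) :
    Q.evalAt₂ s s' t = Q.haar (s * Q.lslice Q.haar y s' * x) := by
  refine evalAt₂_ext_rightAct hε (B := fun s s' => Q.haar (s * Q.lslice Q.haar y s' * x))
    (fun s' => ⟨Q.haar.comp ((mulR x).comp (mulR (Q.lslice Q.haar y s'))), fun _ => rfl⟩)
    (fun s => ⟨Q.haar.comp ((mulR x).comp ((mulL s).comp (Q.lslice Q.haar y))), fun _ => rfl⟩)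
    (fun a b s s' => ?_) s s'
  rw [← evalAt₂_tmul_mul, ht, (hD _ _ _ _ _).2, rightAct_mul, fourier_apply, rightAct_fourier]

/-! ### The Haar functional of the dual, transported to `H` -/

variable {dphi : BLin Q.Dual ℂ} {dδ : Mult Q.Dual} {σ : BLin H H}

/-- A slice of Δ̂(F(x))(1 ⊗ F(y)) is again a Fourier transform, so the modular identity of the dual
becomes one in H. Its use is that x enters the right side only through the first factor. -/
theorem dualHaar_rslice (hε : Q.IsCounit ε) (hD : Q.IsDualComul D)
    (hdδ : IsModularElement D dphi dδ) (x y h : H) :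
    dphi (Q.fourier (Q.rslice Q.haar y h * x)) =
      dphi (Q.fourier x) * Q.haar (h * Q.fourier.symm (dδ.L (Q.fourier y))) := by
  obtain ⟨t, ht, he⟩ := hdδ.1 (Q.fourier x) (Q.fourier y)
  have : sliceR (Q.evalAt h) t = Q.fourier (Q.rslice Q.haar y h * x) := Q.dual_ext fun s => by
    rw [← evalAt₂_apply, hD.evalAt₂_gammaR hε ht, fourier_apply, mul_assoc]
  rw [← this, apply_sliceR, he, map_smul, evalAt_apply, haar_symm_apply, smul_eq_mul]

theorem dualHaar_lslice (hε : Q.IsCounit ε) (hD : Q.IsDualComul D)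
    (hdδ : IsModularElement D dphi dδ) (x y h : H) :
    dphi (Q.fourier (Q.lslice Q.haar y h * x)) =
      dphi (Q.fourier x) * Q.haar (h * Q.fourier.symm (dδ.R (Q.fourier y))) := by
  obtain ⟨t, ht, he⟩ := hdδ.2 (Q.fourier x) (Q.fourier y)
  have : sliceR (Q.evalAt h) t = Q.fourier (Q.lslice Q.haar y h * x) := Q.dual_ext fun s => by
    rw [← evalAt₂_apply, hD.evalAt₂_rhoR hε ht, fourier_apply, mul_assoc]
  rw [← this, apply_sliceR, he, map_smul, evalAt_apply, haar_symm_apply, smul_eq_mul]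

/-- Left invariance on the dual side: the slice at h is the functional φ(R(h) · x), which σ rewrites
as the Fourier transform of x σ(R(h)), where R is the slice operator of y. Density of slices gives
all z. -/
theorem dualHaar_mul_modularAut (hε : Q.IsCounit ε) (hD : Q.IsDualComul D)
    (hphi : IsLeftHaar D dphi) (hσ : ∀ x h, Q.haar (x * h) = Q.haar (h * σ x)) (x z : H) :
    dphi (Q.fourier (x * σ z)) = dphi (Q.fourier x) * ε z := by
  refine ext_rslice hε (f := dphi.comp (Q.fourierB.comp ((mulL x).comp σ)))
    (g := ε.smul (dphi (Q.fourier x))) (fun y h => ?_) z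
  obtain ⟨t, ht, he⟩ := hphi.2.1 (Q.fourier x) (Q.fourier y)
  have : sliceL (Q.evalAt h) t = Q.fourier (x * σ (Q.rslice Q.haar y h)) :=
    Q.dual_ext fun s => by
      rw [← evalAt₂_apply', hD.evalAt₂_gammaL hε ht, fourier_apply, mul_assoc, hσ, mul_assoc]
  simp only [BLin.comp_apply, BLin.smul_apply, mulL_apply, fourierB_apply, hε.counit_rslice]
  rw [← this, ← apply_sliceR, he, map_smul, evalAt_apply, fourier_apply, smul_eq_mul]

/-- The Haar functional of the dual corresponds to a multiple of a character of `H`. -/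
theorem exists_character_dualHaar (hε : Q.IsCounit ε) {S : BLin H H} (hS : Q.IsAntipode ε S)
    (hD : Q.IsDualComul D)
    (hphi : IsLeftHaar D dphi) (hdδ : IsModularElement D dphi dδ) :
    ∃ (χ : BLin H ℂ) (c : H) (k : ℂ), IsCharacter χ c ∧ k ≠ 0 ∧
      ∀ x, dphi (Q.fourier x) = k * χ x := by
  obtain ⟨e, he⟩ := hε.exists_isCharacter
  let κ : BLin H ℂ := dphi.comp Q.fourierB
  have hκ : ∀ x, κ x = dphi (Q.fourier x) := fun _ => rfl
  have hne : ∃ x, κ x ≠ 0 := by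
    by_contra hcon
    push Not at hcon
    have h0 : Q.fourier e = 0 := hphi.1.1 _ fun g => by
      obtain ⟨x, hx⟩ := Q.fourier.surjective (Q.fourier e * g)
      rw [← hx, ← hκ, hcon]
    have : e = 0 := by simpa using h0
    simpa [this] using he.apply_eq_one
  obtain ⟨x₀, hx₀⟩ : ∃ x, κ x = 1 := by
    obtain ⟨x, hx⟩ := hne
    exact ⟨(κ x)⁻¹ • x, by rw [map_smul, smul_eq_mul, inv_mul_cancel₀ hx]⟩
  let χ : BLin H ℂ := κ.comp (mulR x₀)
  -- For h a slice, κ(h x)/κ(x) does not depend on x by the modular identity, so it may be computed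
  -- at x₀. Density extends the factorisation to every h.
  have hmul : ∀ h x, κ (h * x) = χ h * κ x := fun h x => by
    refine ext_rslice hε (f := κ.comp (mulR x)) (g := χ.smul (κ x)) (fun y s => ?_) h |>.trans ?_
    · simp only [BLin.comp_apply, BLin.smul_apply, mulR_apply, χ, hκ,
        dualHaar_rslice hε hD hdδ, smul_eq_mul]
      rw [← hκ x₀, hx₀, one_mul]
    · simp [mul_comm]
  have hχmul : ∀ x y, χ (x * y) = χ x * χ y := fun x y => by
    change κ (x * y * x₀) = χ x * κ (y * x₀)
    rw [mul_assoc, hmul]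
  obtain ⟨c, hc⟩ : ∃ c, χ c = 1 := by
    by_contra hcon
    push Not at hcon
    have h0 : ∀ x, χ x = 0 := fun x => by
      by_contra hx
      exact hcon ((χ x)⁻¹ • x) (by rw [map_smul, smul_eq_mul, inv_mul_cancel₀ hx])
    -- If χ vanished, κ would vanish on all products, hence everywhere, contradicting κ(x₀) = 1.
    have := ext_mul hε (f := κ) (g := ⟨0, isBoundedLin_zero⟩)
      (fun x y => by simp [hmul, h0]) x₀
    rw [hx₀] at this
    simp at this
  have hχ : IsCharacter χ c := ⟨hχmul, hc⟩
  -- Apply κ to x e₍₁₎ S(e₍₂₎) = ε(e)x with ε(e) = 1. Factoring out χ(x)χ(e₍₁₎) shows that κ(x) is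
  -- χ(x) times a constant.
  have hm : ∀ t, κ (mulMap H (map (BLin.id H) S t)) = κ (S (sliceL χ t)) :=
    BLin.eq_of_tmul (κ.comp ((mulMap H).comp (map (BLin.id H) S))) (κ.comp (S.comp (sliceL χ)))
      (fun x y => by simp [hmul])
  have hk : ∀ x, κ x = κ (S (Q.lslice χ c e)) * χ x := fun x => by
    have := hm (Q.rhoL (x ⊗ₑ e))
    rw [hS.right, sliceR_tmul, he.apply_eq_one, one_smul, hχ.sliceL_rhoL] at this
    simpa [mul_comm] using this
  refine ⟨χ, c, _, hχ, fun h0 => ?_, hk⟩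
  have := hk x₀
  rw [hx₀, h0, zero_mul] at this
  exact one_ne_zero this

end BornologicalQuantumGroup

end BornQG

end

noncomputable section

namespace BornQG

namespace BornologicalQuantumGroup

variable {H : Type u} [NonUnitalRing H] [Module ℂ H] [SMulCommClass ℂ H H] [IsScalarTower ℂ H H]
  [Bornology H] [BornologicalAlgebra H] {Q : BornologicalQuantumGroup H}
  {ε : BLin H ℂ} {S : BLin H H} {δ : Mult H} {χ ω : BLin H ℂ} {c d : H} {σ : BLin H H}

/-! ### Characters and the antipode -/

/-- Apply χ to c x₍₁₎ S(x₍₂₎) = ε(x)c: this says that χ ∘ S is a convolution inverse of χ. -/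
theorem IsCharacter.antipode_lslice (hχ : IsCharacter χ c) (hS : Q.IsAntipode ε S) (x : H) :
    χ (S (Q.lslice χ c x)) = ε x := by
  have hm : ∀ t, χ (mulMap H (map (BLin.id H) S t)) = χ (S (sliceL χ t)) :=
    BLin.eq_of_tmul (χ.comp ((mulMap H).comp (map (BLin.id H) S))) (χ.comp (S.comp (sliceL χ)))
      (fun x y => by simp [hχ.map_mul])
  have := hm (Q.rhoL (c ⊗ₑ x))
  rw [hS.right, hχ.sliceL_rhoL, hχ.apply_eq_one, one_smul, sliceR_tmul, map_smul,
    hχ.apply_eq_one, smul_eq_mul, mul_one] at this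
  exact this.symm

theorem IsCharacter.antipode_rslice (hχ : IsCharacter χ c) (hS : Q.IsAntipode ε S) (x : H) :
    χ (S (Q.rslice χ c x)) = ε x := by
  have hm : ∀ t, χ (mulMap H (map S (BLin.id H) t)) = χ (S (sliceR χ t)) :=
    BLin.eq_of_tmul (χ.comp ((mulMap H).comp (map S (BLin.id H)))) (χ.comp (S.comp (sliceR χ)))
      (fun x y => by simp [hχ.map_mul, mul_comm])
  have := hm (Q.gammaR (x ⊗ₑ c))
  rw [hS.left, sliceL_tmul, map_smul, hχ.apply_eq_one, smul_eq_mul, mul_one] at this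
  exact this.symm

/-- The inverse of a character under convolution. -/
theorem IsCharacter.comp_antipode (hχ : IsCharacter χ c) (hS : Q.IsAntipode ε S)
    (hε : Q.IsCounit ε) (hd : S d = c) : IsCharacter (χ.comp S) d :=
  ⟨fun x y => by simp [hS.map_mul hε, hχ.map_mul, mul_comm], by simp [hd, hχ.apply_eq_one]⟩

/-- Two characters that are inverse to each other under convolution. -/
structure IsInversePair (Q : BornologicalQuantumGroup H) (χ ω : BLin H ℂ) (c d : H) : Prop where
  left : IsCharacter χ c
  right : IsCharacter ω d
  lslice_lslice : ∀ x, Q.lslice χ c (Q.lslice ω d x) = x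
  lslice_lslice' : ∀ x, Q.lslice ω d (Q.lslice χ c x) = x
  rslice_rslice : ∀ x, Q.rslice χ c (Q.rslice ω d x) = x
  rslice_rslice' : ∀ x, Q.rslice ω d (Q.rslice χ c x) = x

theorem IsCharacter.isInversePair (hχ : IsCharacter χ c) (hS : Q.IsAntipode ε S)
    (hε : Q.IsCounit ε) (hd : S d = c) : Q.IsInversePair χ (χ.comp S) c d := by
  have hω := hχ.comp_antipode hS hε hd
  have h1 : ∀ x, (χ.comp S) (Q.lslice χ c x) = ε x := hχ.antipode_lslice hS
  have h2 : ∀ x, (χ.comp S) (Q.rslice χ c x) = ε x := hχ.antipode_rslice hS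
  have h3 : ∀ x, χ (Q.lslice (χ.comp S) d x) = ε x := fun x => by
    rw [← hω.apply_rslice hχ, h2]
  have h4 : ∀ x, χ (Q.rslice (χ.comp S) d x) = ε x := fun x => by
    rw [hχ.apply_rslice hω, h1]
  exact ⟨hχ, hω, hχ.lslice_lslice_cancel hε hω h3, hω.lslice_lslice_cancel hε hχ h1,
    hχ.rslice_rslice_cancel hε h4, hω.rslice_rslice_cancel hε h2⟩

/-- L_ω is multiplicative, inverts L_χ, and preserves φ by left invariance. -/
theorem IsInversePair.haar_lslice_mul (h : Q.IsInversePair χ ω c d) (x y : H) :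
    Q.haar (Q.lslice χ c x * y) = Q.haar (x * Q.lslice ω d y) := by
  rw [← h.right.haar_lslice, h.right.lslice_map_mul, h.lslice_lslice']

theorem IsInversePair.haar_mul_lslice (h : Q.IsInversePair χ ω c d) (x y : H) :
    Q.haar (x * Q.lslice χ c y) = Q.haar (Q.lslice ω d x * y) := by
  rw [← h.right.haar_lslice, h.right.lslice_map_mul, h.lslice_lslice']

theorem IsInversePair.haar_rslice_mul (h : Q.IsInversePair χ ω c d)
    (hδ : IsModularElement Q.comul Q.haar δ) (x y : H) :
    Q.haar (Q.rslice χ c x * y) = χ (δ.L c) * Q.haar (x * Q.rslice ω d y) := by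
  rw [← BornologicalQuantumGroup.haar_rslice hδ, h.left.rslice_map_mul, h.rslice_rslice]

/-- Evaluate the scaling rule φ ∘ R_χ = χ(δ)φ at R_ω(e) with φ(e) = 1. -/
theorem IsInversePair.apply_modular_ne_zero (h : Q.IsInversePair χ ω c d) (hε : Q.IsCounit ε)
    (hδ : IsModularElement Q.comul Q.haar δ) : χ (δ.L c) ≠ 0 := by
  intro h0
  obtain ⟨e, he⟩ := hε.exists_haar_eq_one
  have := BornologicalQuantumGroup.haar_rslice (α := χ) (c := c) hδ (Q.rslice ω d e)
  rw [h.rslice_rslice, h0, zero_mul, he] at this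
  exact one_ne_zero this

/-- σ is determined by φ, so it commutes with a φ-preserving automorphism. -/
theorem IsInversePair.modularAut_lslice (h : Q.IsInversePair χ ω c d)
    (hσ : ∀ x h, Q.haar (x * h) = Q.haar (h * σ x)) (x : H) :
    σ (Q.lslice ω d x) = Q.lslice ω d (σ x) :=
  Q.eq_of_haar_mul_left fun y => by
    rw [← hσ, ← h.haar_lslice_mul, ← hσ, ← h.haar_mul_lslice]

theorem IsInversePair.rslice_rslice_haar (h : Q.IsInversePair χ ω c d) (x y : H) :
    Q.rslice χ c (Q.rslice Q.haar y x) = Q.rslice Q.haar (Q.lslice ω d y) x :=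
  h.left.rslice_rslice (fun x => h.haar_lslice_mul x y) x

/-- Here L_χ turns into R_χ on the leg seen by φ. Unlike L_χ, this does not preserve φ, whence the
scalar χ(δ). -/
theorem IsInversePair.lslice_lslice_haar (h : Q.IsInversePair χ ω c d)
    (hδ : IsModularElement Q.comul Q.haar δ) (x y : H) :
    Q.lslice χ c (Q.lslice Q.haar y x) =
      Q.lslice Q.haar (χ (δ.L c) • Q.rslice ω d y) x :=
  h.left.lslice_lslice (fun x => by
    rw [h.haar_rslice_mul hδ, mul_smul_comm, map_smul, smul_eq_mul]) x

/-! ### The fourth power of the antipode -/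

section radford

/-- Checked on slices, where S exchanges the two arguments up to σ. R_χ acts on the auxiliary factor
as L_ω, which commutes with σ and with right slices. -/
theorem IsInversePair.rslice_antipode (h : Q.IsInversePair χ ω c d) (hS : Q.IsAntipode ε S)
    (hε : Q.IsCounit ε) (hσ : ∀ x h, Q.haar (x * h) = Q.haar (h * σ x)) (x : H) :
    Q.rslice χ c (S x) = S (Q.lslice ω d x) :=
  ext_rslice hε (f := (Q.rslice χ c).comp S) (g := S.comp (Q.lslice ω d)) (fun y x => by
    simp only [BLin.comp_apply]
    rw [hS.antipode_rslice hε hσ, h.rslice_rslice_haar, ← h.modularAut_lslice hσ,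
      ← hS.antipode_rslice hε hσ, rslice_lslice_comm]) x

theorem IsInversePair.lslice_antipode (h : Q.IsInversePair χ ω c d) (hS : Q.IsAntipode ε S)
    (hε : Q.IsCounit ε) (hσ : ∀ x h, Q.haar (x * h) = Q.haar (h * σ x)) (x : H) :
    Q.lslice ω d (S x) = S (Q.rslice χ c x) :=
  ext_rslice hε (f := (Q.lslice ω d).comp S) (g := S.comp (Q.rslice χ c)) (fun y x => by
    simp only [BLin.comp_apply]
    rw [hS.antipode_rslice hε hσ, h.rslice_rslice_haar, hS.antipode_rslice hε hσ,
      rslice_lslice_comm]) x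

/-- Apply id ⊗ χ to (S² ⊗ σ)γ_r = γ_r(σ ⊗ σ) at x ⊗ e with ε(e) = 1; χ ∘ σ = ε collapses the second
leg on both sides. -/
theorem IsCharacter.antipode_antipode (hχ : IsCharacter χ c) (hS : Q.IsAntipode ε S)
    (hε : Q.IsCounit ε) (hσ : ∀ x h, Q.haar (x * h) = Q.haar (h * σ x))
    (hχσ : ∀ x, χ (σ x) = ε x) (x : H) : S (S x) = Q.rslice χ c (σ x) := by
  obtain ⟨e, he⟩ := hε.exists_isCharacter
  have := congrArg (sliceR χ).lin (hS.map_antipode_modularAut_gammaR hε hσ x e)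
  rw [sliceR_map, BLin.ext' (f := χ.comp σ) (g := ε) hχσ, hε.sliceR_gammaR, he.apply_eq_one,
    one_smul, ← rslice_apply, hχ.rslice_eq_smul, hχσ, he.apply_eq_one, one_smul] at this
  exact this

theorem IsInversePair.radford (h : Q.IsInversePair χ ω c d) (hS : Q.IsAntipode ε S)
    (hε : Q.IsCounit ε) (hδ : IsModularElement Q.comul Q.haar δ)
    (hσ : ∀ x h, Q.haar (x * h) = Q.haar (h * σ x)) (hχσ : ∀ x, χ (σ x) = ε x) (x : H) :
    δ.R (Q.lslice ω d (Q.rslice χ c x)) = δ.L (S (S (S (S x)))) := by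
  have hTS := h.rslice_antipode hS hε hσ
  have hUS := h.lslice_antipode hS hε hσ
  have hσ' : ∀ x, σ x = Q.rslice ω d (S (S x)) := fun x => by
    rw [h.left.antipode_antipode hS hε hσ hχσ, h.rslice_rslice']
  have hSL : ∀ x, Q.rslice ω d (S x) = S (Q.lslice χ c x) := fun x => by
    conv_lhs => rw [← h.lslice_lslice' x, ← hTS, h.rslice_rslice']
  -- Tested against z: φ(z · vδ) = φ(S(v)S(z)) = φ(S(z)σ(S v)). Since σ(S v) = R_ω S³v = S(L_χ S²v),
  -- anti-multiplicativity gives φ(L_χ(S²v) · zδ), and σ moves the first factor to the right.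
  have key : ∀ v, δ.R v = δ.L (σ (Q.lslice χ c (S (S v)))) := fun v =>
    Q.eq_of_haar_mul_left fun z => by
      rw [← Mult.R_mul, ← hS.haar_antipode hε hδ, hS.map_mul hε, hσ (S v), hσ' (S v), hSL,
        ← hS.map_mul hε, hS.haar_antipode hε hδ, Mult.R_mul, hσ _ (δ.R z), Mult.mul_L]
  -- S² L_ω = S R_χ S = L_ω S², so L_χ on the outside cancels.
  have h1 : ∀ x, Q.lslice χ c (S (S (Q.lslice ω d x))) = S (S x) := fun x => by
    rw [← hTS, ← hUS, h.lslice_lslice]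
  rw [key, h1, hσ', ← hUS, ← hTS, ← hUS, ← hTS, h.rslice_rslice']

end radford

end BornologicalQuantumGroup

end BornQG

end

/-! ### Identification of the dual modular element and conclusion. -/

theorem mainTheorem4 {H : Type u} [NonUnitalRing H] [Module ℂ H] [SMulCommClass ℂ H H]
    [IsScalarTower ℂ H H] [Bornology H] [BornologicalAlgebra H]
    (Q : BornologicalQuantumGroup H)
    (ε : BLin H ℂ) (hε : Q.IsCounit ε) (S : BLin H H) (hS : Q.IsAntipode ε S)
    (δ : Mult H) (hδ : IsModularElement Q.comul Q.haar δ)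
    (dualComul : Q.Dual → Mult (Q.Dual ⊗ᵇ Q.Dual)) (hdualComul : Q.IsDualComul dualComul)
    (dualHaar : BLin Q.Dual ℂ) (hdualHaar : IsLeftHaar dualComul dualHaar)
    (dualδ : Mult Q.Dual) (hdualδ : IsModularElement dualComul dualHaar dualδ) :
    ∃ (uδ : (Mult H)ˣ) (uδ' : (Mult Q.Dual)ˣ) (T U : BLin H H),
      (uδ : Mult H) = δ ∧ (uδ' : Mult Q.Dual) = dualδ ∧
      Q.IsMultLeftAct (uδ' : Mult Q.Dual) T ∧
      Q.IsMultRightAct ((uδ'⁻¹ : (Mult Q.Dual)ˣ) : Mult Q.Dual) U ∧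
      ∀ x : H, S (S (S (S x))) =
        (uδ : Mult H).R (((uδ⁻¹ : (Mult H)ˣ) : Mult H).L (U (T x))) := by
  obtain ⟨S', hS', -⟩ := hS.exists_inverse hε hδ
  obtain ⟨uδ, rfl⟩ := hε.exists_unit_modular hδ
  obtain ⟨σ, hσ⟩ := hS.exists_modularAut hε hδ
  obtain ⟨χ, c, k, hχ, hk, hκ⟩ :=
    BornologicalQuantumGroup.exists_character_dualHaar hε hS hdualComul hdualHaar hdualδ
  -- Surjectivity of S supplies d with S(d) = c, so that ω(d) = χ(c) = 1.
  have hpair := hχ.isInversePair hS hε (hS' c)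
  set ω := χ.comp S
  set d := S' c
  -- Left invariance of the dual Haar functional kχ, evaluated at c; the factor k cancels.
  have hχσ : ∀ x, χ (σ x) = ε x := fun x => by
    have := BornologicalQuantumGroup.dualHaar_mul_modularAut hε hdualComul hdualHaar hσ c x
    rw [hκ, hκ, hχ.map_mul, hχ.apply_eq_one, one_mul, mul_one] at this
    exact mul_left_cancel₀ hk this
  -- With dual Haar functional kχ, the modular identity gives φ(h · F⁻¹(δ̂F(y))) = χ(R(h)) with R
  -- the slice operator of y. By Fubini this is φ(L_χ(h)y) = φ(h L_ω(y)).
  have hL : ∀ y, dualδ.L (Q.fourier y) = Q.fourier (Q.lslice ω d y) := fun y =>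
    Q.dual_ext fun h => by
      have := BornologicalQuantumGroup.dualHaar_rslice hε hdualComul hdualδ c y h
      rw [hκ, hκ, hχ.map_mul, hχ.apply_eq_one, mul_one, mul_one, Q.haar_symm_apply] at this
      rw [← mul_left_cancel₀ hk this, Q.rslice_apply, apply_sliceR, ← hχ.lslice_mul,
        hpair.haar_lslice_mul, Q.fourier_apply]
  set s := χ ((uδ : Mult H).L c)
  have hs : s ≠ 0 := hpair.apply_modular_ne_zero hε hδ
  -- The same on the other side, where moving R_χ across φ costs the scalar s = χ(δ).
  have hR : ∀ y, dualδ.R (Q.fourier y) = Q.fourier (s • Q.rslice ω d y) := fun y =>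
    Q.dual_ext fun h => by
      have := BornologicalQuantumGroup.dualHaar_lslice hε hdualComul hdualδ c y h
      rw [hκ, hκ, hχ.map_mul, hχ.apply_eq_one, mul_one, mul_one, Q.haar_symm_apply] at this
      rw [← mul_left_cancel₀ hk this, Q.lslice_apply, ← apply_sliceR, ← hχ.rslice_mul,
        hpair.haar_rslice_mul hδ, Q.fourier_apply, mul_smul_comm, map_smul, smul_eq_mul]
  obtain ⟨uδ', hu, -, hr⟩ := dualδ.exists_unit
    (Q.fourierB.comp ((Q.lslice χ c).comp Q.fourierInvB))
    (Q.fourierB.comp (((Q.rslice χ c).smul s⁻¹).comp Q.fourierInvB))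
    (fun f => by
      obtain ⟨x, rfl⟩ := Q.fourier.surjective f
      simp [hL, hpair.lslice_lslice'])
    (fun f => by
      obtain ⟨x, rfl⟩ := Q.fourier.surjective f
      simp [hL, hpair.lslice_lslice])
    (fun f => by
      obtain ⟨x, rfl⟩ := Q.fourier.surjective f
      simp [hR, hpair.rslice_rslice', smul_smul, hs])
    (fun f => by
      obtain ⟨x, rfl⟩ := Q.fourier.surjective f
      simp [hR, hpair.rslice_rslice, smul_smul, hs])
  refine ⟨uδ, uδ', Q.rslice χ c, Q.lslice ω d, rfl, hu, fun f x => ?_, fun f x => ?_, fun x => ?_⟩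
  · obtain ⟨y, rfl⟩ := Q.fourier.surjective f
    rw [hu, hL, Q.leftAct_fourier, Q.leftAct_fourier, hpair.rslice_rslice_haar]
  · obtain ⟨y, rfl⟩ := Q.fourier.surjective f
    rw [hr]
    simp only [BLin.comp_apply, BLin.smul_apply, BornologicalQuantumGroup.fourierB_apply,
      BornologicalQuantumGroup.fourierInvB_apply, LinearEquiv.symm_apply_apply,
      Q.rightAct_fourier]
    -- The factor s⁻¹ from the inverse of right multiplication by the dual modular element cancels
    -- the s produced when L_χ passes a left slice of φ.
    rw [← hpair.lslice_lslice' (Q.lslice Q.haar (s⁻¹ • Q.rslice χ c y) x),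
      hpair.lslice_lslice_haar hδ, map_smul, smul_smul, mul_inv_cancel₀ hs, one_smul, hpair.rslice_rslice']
  · rw [← BornologicalQuantumGroup.mult_L_R_comm Q, hpair.radford hS hε hδ hσ hχσ,
      Mult.inv_L_L]
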